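/- Theorem (derivatives of $\sigma=\log\det(1+\hat V_T)$). For real $x,t,\beta,\kappa$ with $t\neq 0$ let $\vartheta(\lambda)=1/(1+e^{\lambda^2-\beta})$, $$G(t,x)=\int_{-\infty}^{\infty}e^{-2it\mu^2-2ix\mu}\,d\mu,\qquad e_-(\lambda)=\frac{\cos(\pi\kappa/2)}{\pi}\sqrt{\vartheta(\lambda)}\,e^{it\lambda^2+ix\lambda},$$ $$e_+(\lambda)=\frac{1}{\pi}\sqrt{\vartheta(\lambda)}\,e^{it\lambda^2+ix\lambda}\Big(\cos(\pi\kappa/2)\,\mathrm{P.V.}\!\int_{-\infty}^{\infty}\frac{e^{-2it\mu^2-2ix\mu}}{\mu-\lambda}\,d\mu+\pi\sin(\pi\kappa/2)\,e^{-2it\lambda^2-2ix\lambda}\Big)$$ (the first integral is an improper, conditionally convergent one, and P.V. is the Cauchy principal value of such an integral). Let $\hat V_T$ be the integral operator on $\mathbb R$ with kernel $$V_T(\lambda,\mu)=\frac{e_+(\lambda)e_-(\mu)-e_-(\lambda)e_+(\mu)}{\lambda-\mu},$$ extended to the diagonal by continuity, i.e. $V_T(\lambda,\lambda)=e_+'(\lambda)e_-(\lambda)-e_-'(\lambda)e_+(\lambda)$,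 and let $$\det(1+\hat V_T)=\sum_{n\ge 0}\frac{1}{n!}\int_{\mathbb R^n}\det\big(V_T(\lambda_i,\lambda_j)\big)_{i,j=1}^n\,d\lambda_1\cdots d\lambda_n$$ be its Fredholm determinant. Suppose that $\det(1+\hat V_T)\neq 0$ at the point $(x,t,\beta,\kappa)$. Then: 1. Each of the integral equations $f_\pm(\lambda)+\int_{-\infty}^{\infty}V_T(\lambda,\mu)f_\pm(\mu)\,d\mu=e_\pm(\lambda)$ $(\lambda\in\mathbb R)$ has exactly one solution $f_\pm\in L^2(\mathbb R)$. For $l,m\in\{+,-\}$ define the auxiliary potentials $$B_{lm}=\int_{-\infty}^{\infty}e_l(\lambda)f_m(\lambda)\,d\lambda,\qquad C_{lm}=\int_{-\infty}^{\infty}\lambda\,e_l(\lambda)f_m(\lambda)\,d\lambda .$$ All $B_{lm}$ and $C_{lm}$ are differentiable in $\beta$ at this point. 2. With $\kappa$ fixed, there is a continuous branch $\sigma$ of $\log\det(1+\hat V_T)$ on a neighbourhood of $(x,t,\beta)$ (that is, a continuous $\sigma$ with $e^{\sigma}=\det(1+\hat V_T)$ there), and every such branch has partial derivatives at $(x,t,\beta)$,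 given by $$\partial_x\sigma=-2iB_{+-},\qquad \partial_t\sigma=-2iG\,B_{--}-2i(C_{+-}+C_{-+}),$$ $$\partial_\beta\sigma=-2it\,\partial_\beta(C_{+-}+C_{-+})-2ix\,\partial_\beta B_{+-}-2it\,B_{--}\,\partial_\beta B_{++}+2it\,(B_{++}-2G)\,\partial_\beta B_{--}+2(\partial_\beta B_{++})(\partial_\beta B_{--})-2(\partial_\beta B_{+-})^2 .$$ -/

import Mathlib

open Filter Topology MeasureTheory

namespace ImpenetrableAnyons

noncomputable section

/-- The improper integral `∫_{-∞}^{+∞} h(μ) dμ` of a locally integrable function: the limit of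
`∫_a^b h(μ) dμ` as `a → -∞` and `b → +∞` independently (possibly only conditionally convergent). -/
def improperIntegral (h : ℝ → ℂ) : ℂ :=
  limUnder (atBot ×ˢ atTop) fun p : ℝ × ℝ => ∫ μ in p.1..p.2, h μ

/-- The Cauchy principal value `P.V. ∫_{-∞}^{+∞} h(μ) / (μ - ξ) dμ`: the limit as `ε → 0+` of the
(improper) integral over `|μ - ξ| > ε`. -/
def principalValue (h : ℝ → ℂ) (ξ : ℝ) : ℂ :=
  limUnder (𝓝[>] (0 : ℝ)) fun ε =>
    improperIntegral fun μ => if ε < |μ - ξ| then h μ / ((μ : ℂ) - (ξ : ℂ)) else 0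

/-- The oscillating factor `e^{-2itμ² - 2ixμ}`. -/
def osc (x t μ : ℝ) : ℂ :=
  Complex.exp (-2 * Complex.I * t * (μ : ℂ) ^ 2 - 2 * Complex.I * x * μ)

/-- `G(t,x) = ∫ e^{-2itμ² - 2ixμ} dμ`, a conditionally convergent Fresnel integral for `t ≠ 0`. -/
def G (x t : ℝ) : ℂ := improperIntegral (osc x t)

/-- The rescaled Fermi weight `ϑ(ξ) = 1 / (1 + e^{ξ² - β})`. -/
def fermiWeight (β ξ : ℝ) : ℝ := 1 / (1 + Real.exp (ξ ^ 2 - β))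

/-- `E(ξ) = P.V. ∫ e^{-2itμ² - 2ixμ} / (μ - ξ) dμ + π tan(πκ/2) e^{-2itξ² - 2ixξ}`, meaningful when
`cos(πκ/2) ≠ 0`. -/
def E (x t κ ξ : ℝ) : ℂ :=
  principalValue (osc x t) ξ + (Real.pi * Real.tan (Real.pi * κ / 2) : ℝ) * osc x t ξ

/-- `e₋(ξ) = (cos(πκ/2) / π) √ϑ(ξ) e^{itξ² + ixξ}`. -/
def eMinus (x t β κ ξ : ℝ) : ℂ :=
  (Real.cos (Real.pi * κ / 2) / Real.pi * Real.sqrt (fermiWeight β ξ) : ℝ) *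
    Complex.exp (Complex.I * t * (ξ : ℂ) ^ 2 + Complex.I * x * ξ)

/-- `e₊(ξ) = (1/π) √ϑ(ξ) e^{itξ² + ixξ} (cos(πκ/2) P.V. ∫ e^{-2itμ² - 2ixμ} / (μ - ξ) dμ
+ π sin(πκ/2) e^{-2itξ² - 2ixξ})`. This is `e₋(ξ) E(ξ)` with the factor `cos(πκ/2)` multiplied out
(see `ePlus_eq`), so that it makes sense also where `tan(πκ/2)` is infinite. -/
def ePlus (x t β κ ξ : ℝ) : ℂ :=
  (1 / Real.pi * Real.sqrt (fermiWeight β ξ) : ℝ) *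
    Complex.exp (Complex.I * t * (ξ : ℂ) ^ 2 + Complex.I * x * ξ) *
    ((Real.cos (Real.pi * κ / 2) : ℝ) * principalValue (osc x t) ξ +
      (Real.pi * Real.sin (Real.pi * κ / 2) : ℝ) * osc x t ξ)

theorem ePlus_eq (x t β κ ξ : ℝ) (hκ : Real.cos (Real.pi * κ / 2) ≠ 0) :
    ePlus x t β κ ξ = eMinus x t β κ ξ * E x t κ ξ := by
  have h : Real.sin (Real.pi * κ / 2) =
      Real.cos (Real.pi * κ / 2) * Real.tan (Real.pi * κ / 2) := by
    rw [mul_comm (Real.cos _), Real.tan_mul_cos hκ]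
  unfold ePlus eMinus E
  rw [h]
  push_cast
  ring

/-- The indices `+` and `-`. -/
inductive PM where
  | plus : PM
  | minus : PM

/-- The two functions `e₊` and `e₋`. -/
def e : PM → ℝ → ℝ → ℝ → ℝ → ℝ → ℂ
  | PM.plus => ePlus
  | PM.minus => eMinus

/-- The kernel `V_T(ξ,μ) = (e₊(ξ) e₋(μ) - e₋(ξ) e₊(μ)) / (ξ - μ)`, with its limiting value
`e₊'(ξ) e₋(ξ) - e₋'(ξ) e₊(ξ)` on the diagonal. -/
def V (x t β κ ξ μ : ℝ) : ℂ :=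
  if ξ = μ then
    deriv (ePlus x t β κ) ξ * eMinus x t β κ ξ - deriv (eMinus x t β κ) ξ * ePlus x t β κ ξ
  else
    (ePlus x t β κ ξ * eMinus x t β κ μ - eMinus x t β κ ξ * ePlus x t β κ μ) /
      ((ξ : ℂ) - (μ : ℂ))

/-- The Fredholm determinant `det(1 + K̂)` of the integral operator on the real line with kernel
`K`, by the Fredholm series `∑ₙ (1/n!) ∫_{ℝⁿ} det (K(ξᵢ,ξⱼ))ᵢⱼ dξ₁ ⋯ dξₙ`. -/
def fredholmDet (K : ℝ → ℝ → ℂ) : ℂ :=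
  ∑' n : ℕ, ((n.factorial : ℂ))⁻¹ *
    ∫ ξ : Fin n → ℝ, (Matrix.of fun i j : Fin n => K (ξ i) (ξ j)).det

/-- `det(1 + V̂_T)` as a function of `x, t, β, κ`. -/
def detV (x t β κ : ℝ) : ℂ := fredholmDet (V x t β κ)

/-- `f` is a square-integrable solution of `f(ξ) + ∫ V_T(ξ,μ) f(μ) dμ = e_s(ξ)` for all real `ξ`. -/
def IsSolution (s : PM) (x t β κ : ℝ) (f : ℝ → ℂ) : Prop :=
  MemLp f 2 volume ∧ ∀ ξ : ℝ, f ξ + ∫ μ : ℝ, V x t β κ ξ μ * f μ = e s x t β κ ξ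

/-- The functions `f₊` and `f₋`: the solution of the integral equation with right-hand side `e_s`. -/
def f (s : PM) (x t β κ : ℝ) : ℝ → ℂ := Classical.epsilon (IsSolution s x t β κ)

/-- The potentials `B_{lm} = ∫ e_l(ξ) f_m(ξ) dξ`. -/
def B (l m : PM) (x t β κ : ℝ) : ℂ := ∫ ξ : ℝ, e l x t β κ ξ * f m x t β κ ξ

/-- The potentials `C_{lm} = ∫ ξ e_l(ξ) f_m(ξ) dξ`. -/
def C (l m : PM) (x t β κ : ℝ) : ℂ := ∫ ξ : ℝ, (ξ : ℂ) * e l x t β κ ξ * f m x t β κ ξ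

/-- On some neighbourhood of `(x,t,β)`, the function `σ` of `(x,t,β)` is a continuous branch of
`log det(1 + V̂_T)`. -/
def IsLogDetBranchNear (κ : ℝ) (σ : ℝ → ℝ → ℝ → ℂ) (x t β : ℝ) : Prop :=
  ∃ U : Set (ℝ × ℝ × ℝ), IsOpen U ∧ (x, t, β) ∈ U ∧
    ContinuousOn (fun q : ℝ × ℝ × ℝ => σ q.1 q.2.1 q.2.2) U ∧
    ∀ q ∈ U, Complex.exp (σ q.1 q.2.1 q.2.2) = detV q.1 q.2.1 q.2.2 κ

end

end ImpenetrableAnyons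

/-! The kernel is of integrable form, `(a - b) V(a,b) = e₊(a) e₋(b) - e₋(a) e₊(b)`. It is
continuous, symmetric and exponentially decaying, so classical Fredholm theory applies. Hadamard's
inequality makes the series for the determinant and for its minors converge absolutely; their
quotient is the resolvent `R`, and `(1 + V)⁻¹ = 1 - R` (`rowMinor_eq`, `IsRegular.inv_add_op_inv`,
`IsRegular.inv_add_op`). This gives existence and uniqueness of `f_±`. Along a differentiable family
of kernels the logarithmic derivative of the determinant is the trace of `(1 + V)⁻¹ ∂V`
(`DiffKer.hasDerivAt_fredholmDet`), and the solutions are differentiable together with the data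
(`DiffFam.inv`).

The derivatives of `V` rest on a closed form for the principal value: with `y = 2tξ + x` it is `-2i
G(t,0) e^{-2itξ² - 2ixξ} y H(y²/(4t))`, where `H(z) = ∫₀¹ e^{2izv²} dv` (`principalValue_osc`). The
equation `2 z H' = e^{2iz} - H` shows that along every curve in the variables `(x, t, β, ξ)` the
pair `e_±` satisfies a closed linear first order system (`hasDerivAt_ePlus`, `hasDerivAt_eMinus`),
and in `∂V` the denominator `a - b` cancels (`hasDerivAt_V`). In the directions of `x` and `t` the
operator `∂V` has finite rank, so the traces are combinations of the potentials at once.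

In the direction of `β`, let `h` be the logarithmic derivative of `√ϑ`. Then `∂V(a,b) = (h(a) +
h(b)) V(a,b)`, the trace is `2 ∫ h(ξ) R(ξ,ξ) dξ` (`IsRegular.trace_multiplier`), and `∂_β B_lm = 2 ∫
h f_l f_m`, with a similar formula for `C_lm` (`hasDerivAt_integral_mul_inv`). The resolvent is
again of integrable form, with `f_±` in place of `e_±`, hence `R(ξ,ξ) = f₊' f₋ - f₋' f₊`. To find
`f_±'`, the translation of the spectral variable is treated as one more parameter
(`hasDerivAt_inv_e`). The result involves `f_±`, `(1 + V)⁻¹(ξ e_±)`, the potentials, terms `ξ h f_±`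
that cancel in `R(ξ,ξ)`, and `R` applied to `ξ h f_±`. Integrated against `h`, all but the last give
`β`-derivatives of potentials. Symmetrising the double integral of the last terms turns the factor
`ξ` into `(a - b) R(a,b)` and yields `∫ h f₊² ∫ h f₋² - (∫ h f₊ f₋)²`
(`IsRegular.integral_commutator`), which is the quadratic part of the formula. -/

namespace Matrix

/-! ### Bounds for determinants and their derivatives -/

open scoped ComplexOrder in
/-- Hadamard's inequality for a complex matrix with entries in the unit disc. -/
theorem norm_det_le_sqrt_of_norm_le_one {n : ℕ} (A : Matrix (Fin n) (Fin n) ℂ)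
    (hA : ∀ i j, ‖A i j‖ ≤ 1) : ‖A.det‖ ≤ Real.sqrt ((n : ℝ) ^ n) := by
  rcases Nat.eq_zero_or_pos n with rfl | hn
  · simp
  have hn' : (0 : ℝ) < n := by exact_mod_cast hn
  have hps := posSemidef_self_mul_conjTranspose A
  set lam := hps.isHermitian.eigenvalues with hlam
  have hlam0 : ∀ i, 0 ≤ lam i := hps.eigenvalues_nonneg
  -- `|det A|²` is the determinant of the positive semidefinite matrix `A A*`, whose trace is the
  -- sum of the squared moduli of the entries. Hadamard's bound becomes the inequality of arithmetic
  -- and geometric means for its eigenvalues.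
  have hdet : ‖A.det‖ ^ 2 = ∏ i, lam i := by
    have h1 := hps.isHermitian.det_eq_prod_eigenvalues
    rw [det_mul, det_conjTranspose, Complex.star_def, Complex.mul_conj,
      Complex.normSq_eq_norm_sq] at h1
    have h2 : ((‖A.det‖ ^ 2 : ℝ) : ℂ) = ((∏ i, lam i : ℝ) : ℂ) := by
      rw [h1]; simp [hlam]
    exact_mod_cast h2
  have htr : ∑ i, lam i ≤ (n : ℝ) * n := by
    have h1 := hps.isHermitian.trace_eq_sum_eigenvalues
    have h2 : (A * A.conjTranspose).trace = ((∑ i, ∑ j, ‖A i j‖ ^ 2 : ℝ) : ℂ) := by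
      simp only [trace, diag, mul_apply, conjTranspose_apply, Complex.star_def, Complex.mul_conj,
        Complex.normSq_eq_norm_sq]
      push_cast
      rfl
    rw [h2] at h1
    have h3 : ∑ i, ∑ j, ‖A i j‖ ^ 2 = ∑ i, lam i := by
      have : ((∑ i, ∑ j, ‖A i j‖ ^ 2 : ℝ) : ℂ) = ((∑ i, lam i : ℝ) : ℂ) := by
        rw [h1]; simp [hlam]
      exact_mod_cast this
    rw [← h3]
    calc ∑ i, ∑ j, ‖A i j‖ ^ 2 ≤ ∑ _i : Fin n, ∑ _j : Fin n, (1 : ℝ) := by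
          gcongr with i _ j _
          exact pow_le_one₀ (norm_nonneg _) (hA i j)
      _ = (n : ℝ) * n := by simp
  have hprod : ∏ i, lam i ≤ (n : ℝ) ^ n := by
    -- The means are compared through `y ≤ exp (y - 1)` at `y = lam i / n`.
    have h1 : ∏ i, (lam i / n) ≤ 1 := by
      calc ∏ i, (lam i / n) ≤ ∏ i, Real.exp (lam i / n - 1) := by
            apply Finset.prod_le_prod
            · intro i _; exact div_nonneg (hlam0 i) hn'.le
            · intro i _
              have := Real.add_one_le_exp (lam i / n - 1)
              linarith
        _ = Real.exp ((∑ i, lam i) / n - n) := by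
            rw [← Real.exp_sum]; simp [Finset.sum_div]
        _ ≤ 1 := by
            rw [Real.exp_le_one_iff, sub_nonpos, div_le_iff₀ hn']
            exact htr
    rw [Finset.prod_div_distrib, Finset.prod_const, Finset.card_univ, Fintype.card_fin,
      div_le_one (by positivity)] at h1
    exact h1
  exact Real.le_sqrt_of_sq_le (hdet ▸ hprod)

/-- Hadamard's inequality for a matrix with entries bounded by a rank one matrix. -/
theorem norm_det_le_of_norm_le_mul {n : ℕ} (A : Matrix (Fin n) (Fin n) ℂ) (u v : Fin n → ℝ)
    (hu : ∀ i, 0 ≤ u i) (hv : ∀ i, 0 ≤ v i) (hA : ∀ i j, ‖A i j‖ ≤ u i * v j) :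
    ‖A.det‖ ≤ Real.sqrt ((n : ℝ) ^ n) * ((∏ i, u i) * ∏ i, v i) := by
  -- A vanishing factor kills a row or a column. Otherwise rows can be divided by `u` and columns by
  -- `v`, which leaves entries in the unit disc.
  by_cases h0 : ∃ i, u i = 0
  · obtain ⟨i, hi⟩ := h0
    rw [det_eq_zero_of_row_eq_zero i fun j => by simpa [hi] using hA i j,
      Finset.prod_eq_zero (Finset.mem_univ i) hi]
    simp
  by_cases h1 : ∃ i, v i = 0
  · obtain ⟨j, hj⟩ := h1
    rw [det_eq_zero_of_column_eq_zero j fun i => by simpa [hj] using hA i j,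
      Finset.prod_eq_zero (s := Finset.univ) (f := v) (Finset.mem_univ j) hj]
    simp
  push Not at h0 h1
  have hu' : ∀ i, 0 < u i := fun i => lt_of_le_of_ne (hu i) (h0 i).symm
  have hv' : ∀ i, 0 < v i := fun i => lt_of_le_of_ne (hv i) (h1 i).symm
  set B : Matrix (Fin n) (Fin n) ℂ := of fun i j => A i j / (u i * v j) with hB
  have hAB : A = diagonal (fun i => (u i : ℂ)) * B * diagonal (fun i => (v i : ℂ)) := by
    ext i j
    have h2 : (u i : ℂ) ≠ 0 := by exact_mod_cast h0 i
    have h3 : (v j : ℂ) ≠ 0 := by exact_mod_cast h1 j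
    rw [mul_diagonal, diagonal_mul, hB, of_apply]
    field_simp
  have hBle : ‖B.det‖ ≤ Real.sqrt ((n : ℝ) ^ n) := by
    apply norm_det_le_sqrt_of_norm_le_one
    intro i j
    rw [hB, of_apply, norm_div, norm_mul, Complex.norm_real, Complex.norm_real,
      Real.norm_of_nonneg (hu i), Real.norm_of_nonneg (hv j),
      div_le_one (mul_pos (hu' i) (hv' j))]
    exact hA i j
  rw [hAB, det_mul, det_mul, det_diagonal, det_diagonal, norm_mul, norm_mul, norm_prod, norm_prod]
  simp only [Complex.norm_real, Real.norm_of_nonneg (hu _), Real.norm_of_nonneg (hv _)]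
  have := mul_le_mul_of_nonneg_left hBle
    (mul_nonneg (Finset.prod_nonneg fun i (_ : i ∈ Finset.univ) => hu i)
      (Finset.prod_nonneg fun i (_ : i ∈ Finset.univ) => hv i))
  linarith

/-- Lipschitz continuity of the determinant on matrices bounded by a rank one matrix. -/
theorem norm_det_sub_det_le {n : ℕ} (A B : Matrix (Fin n) (Fin n) ℂ) (u v : Fin n → ℝ) (δ : ℝ)
    (hu : ∀ i, 0 < u i) (hv : ∀ i, 0 < v i) (hδ : 0 ≤ δ)
    (hA : ∀ i j, ‖A i j‖ ≤ u i * v j) (hB : ∀ i j, ‖B i j‖ ≤ u i * v j)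
    (hAB : ∀ i j, ‖A i j - B i j‖ ≤ δ * (u i * v j)) :
    ‖A.det - B.det‖ ≤ δ * (n * Real.sqrt ((n : ℝ) ^ n) * ((∏ i, u i) * ∏ i, v i)) := by
  -- Hadamard's bound, with the sup norms of the rows as `u`, bounds the determinant as a
  -- multilinear map of its rows; a bounded multilinear map is Lipschitz on the unit ball, which is
  -- applied after scaling rows and columns.
  have hb : ∀ m : Fin n → Fin n → ℂ, ‖(detRowAlternating (R := ℂ) (n := Fin n)).toMultilinearMap m‖
      ≤ Real.sqrt ((n : ℝ) ^ n) * ∏ i, ‖m i‖ := by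
    intro m
    have := norm_det_le_of_norm_le_mul (of m) (fun i => ‖m i‖) (fun _ => 1)
      (fun i => norm_nonneg _) (fun _ => zero_le_one) (fun i j => by
        simpa using norm_le_pi_norm (m i) j)
    rw [Finset.prod_const_one, mul_one] at this
    exact this
  have key := (detRowAlternating (R := ℂ) (n := Fin n)).toMultilinearMap.norm_image_sub_le_of_bound
    (Real.sqrt_nonneg _) hb
  have hscale : ∀ M : Matrix (Fin n) (Fin n) ℂ, M.det = (∏ i, (u i : ℂ)) * (∏ i, (v i : ℂ)) *
      (of fun i j => M i j / (u i * v j)).det := by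
    intro M
    have : M = diagonal (fun i => (u i : ℂ)) * (of fun i j => M i j / (u i * v j)) *
        diagonal (fun i => (v i : ℂ)) := by
      ext i j
      have h2 : (u i : ℂ) ≠ 0 := by exact_mod_cast (hu i).ne'
      have h3 : (v j : ℂ) ≠ 0 := by exact_mod_cast (hv j).ne'
      rw [mul_diagonal, diagonal_mul, of_apply]
      field_simp
    conv_lhs => rw [this]
    rw [det_mul, det_mul, det_diagonal, det_diagonal]
    ring
  have hent : ∀ (M : Matrix (Fin n) (Fin n) ℂ) (c : ℝ), 0 ≤ c → (∀ i j, ‖M i j‖ ≤ c * (u i * v j)) →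
      ‖(fun i j => M i j / (u i * v j) : Fin n → Fin n → ℂ)‖ ≤ c := by
    intro M c hc hM
    refine (pi_norm_le_iff_of_nonneg hc).2 fun i => (pi_norm_le_iff_of_nonneg hc).2 fun j => ?_
    rw [norm_div, norm_mul, Complex.norm_real, Complex.norm_real,
      Real.norm_of_nonneg (hu i).le, Real.norm_of_nonneg (hv j).le,
      div_le_iff₀ (mul_pos (hu i) (hv j))]
    exact hM i j
  have k1 := key (fun i j => A i j / (u i * v j)) (fun i j => B i j / (u i * v j))
  have hA1 := hent A 1 zero_le_one (by simpa using hA)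
  have hB1 := hent B 1 zero_le_one (by simpa using hB)
  have hD : ‖(fun i j => A i j / (u i * v j) : Fin n → Fin n → ℂ) -
      (fun i j => B i j / (u i * v j) : Fin n → Fin n → ℂ)‖ ≤ δ := by
    have := hent (A - B) δ hδ (by simpa using hAB)
    convert this using 2
    ext i j
    simp [sub_div]
  have k2 : ‖(of fun i j => A i j / (u i * v j) : Matrix (Fin n) (Fin n) ℂ).det -
      (of fun i j => B i j / (u i * v j) : Matrix (Fin n) (Fin n) ℂ).det‖ ≤
      Real.sqrt ((n : ℝ) ^ n) * n * δ := by
    refine le_trans k1 ?_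
    rw [Fintype.card_fin]
    have h3 := pow_le_one₀ (n := n - 1) (le_trans (norm_nonneg _) (le_max_left _ _))
      (max_le hA1 hB1)
    calc _ ≤ Real.sqrt ((n : ℝ) ^ n) * n * 1 * δ := by gcongr
      _ = _ := by ring
  rw [hscale A, hscale B, ← mul_sub, norm_mul, norm_mul, norm_prod, norm_prod]
  simp only [Complex.norm_real, Real.norm_of_nonneg (hu _).le, Real.norm_of_nonneg (hv _).le]
  have hp : 0 ≤ (∏ i, u i) * ∏ i, v i := mul_nonneg (Finset.prod_nonneg fun i _ => (hu i).le)
    (Finset.prod_nonneg fun i _ => (hv i).le)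
  have := mul_le_mul_of_nonneg_left k2 hp
  linarith

/-- The determinant is differentiable along differentiable families of matrices, with the row by
row formula for the derivative. -/
theorem hasDerivAt_det {n : ℕ} {A : ℝ → Matrix (Fin n) (Fin n) ℂ} {A' : Matrix (Fin n) (Fin n) ℂ}
    {s : ℝ} (h : ∀ i j, HasDerivAt (fun r => A r i j) (A' i j) s) :
    HasDerivAt (fun r => (A r).det) (∑ i, ((A s).updateRow i (A' i)).det) s := by
  simp only [det_apply]
  -- In `det_apply` the permutation acts on the row index, so the replaced row `i = σ k` is met
  -- exactly in the factor `k`. Reindexing the sum over `i` by `σ` turns it into the product rule.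
  have : ∑ i, ∑ σ : Equiv.Perm (Fin n), Equiv.Perm.sign σ • ∏ k, (A s).updateRow i (A' i) (σ k) k =
      ∑ σ : Equiv.Perm (Fin n), Equiv.Perm.sign σ •
        ∑ k, (∏ j ∈ Finset.univ.erase k, A s (σ j) j) • A' (σ k) k := by
    rw [Finset.sum_comm]
    refine Finset.sum_congr rfl fun σ _ => ?_
    rw [← Finset.smul_sum]
    congr 1
    refine (Equiv.sum_comp σ _).symm.trans (Finset.sum_congr rfl fun k _ => ?_)
    rw [← Finset.mul_prod_erase _ _ (Finset.mem_univ k), updateRow_self, smul_eq_mul, mul_comm]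
    congr 1
    refine Finset.prod_congr rfl fun j hj => ?_
    rw [updateRow_ne]
    exact fun hh => Finset.ne_of_mem_erase hj (σ.injective hh)
  rw [this]
  refine HasDerivAt.fun_sum fun σ _ => ?_
  simp only [Units.smul_def, zsmul_eq_mul]
  refine HasDerivAt.const_mul _ ?_
  have := HasDerivAt.finsetProd (u := Finset.univ) (f := fun k r => A r (σ k) k)
    (f' := fun k => A' (σ k) k) (x := s) fun k _ => h (σ k) k
  convert this using 1
  ext r
  simp

end Matrix

/-! ### Dominated series and integrals -/

/-- The coefficients of Hadamard's bound are summable after division by factorials. -/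
theorem summable_hadamard (M : ℝ) :
    Summable fun n : ℕ => (n.factorial : ℝ)⁻¹ * (n * Real.sqrt ((n : ℝ) ^ n)) * M ^ n := by
  -- By `n ^ n ≤ e ^ n n!` and `n ≤ 2 ^ n` the square of the term is at most `(4 e M²)^n / n!`. The
  -- constant `16 = 4 · 4` leaves a factor `4⁻ⁿ`, whose square root is the geometric term.
  have hg : Summable fun n : ℕ =>
      Real.sqrt (Real.exp (16 * Real.exp 1 * M ^ 2)) * (1 / 2 : ℝ) ^ n :=
    (summable_geometric_of_lt_one (by norm_num) (by norm_num)).mul_left _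
  refine Summable.of_norm_bounded hg fun n => ?_
  have hfac : (0 : ℝ) < n.factorial := by exact_mod_cast n.factorial_pos
  have h1 : (n : ℝ) ^ n / n.factorial ≤ Real.exp 1 ^ n := by
    have := Real.pow_div_factorial_le_exp (x := n) (Nat.cast_nonneg n) n
    rwa [← Real.exp_one_rpow, Real.rpow_natCast] at this
  have h2 := Real.pow_div_factorial_le_exp (x := 16 * Real.exp 1 * M ^ 2) (by positivity) n
  have hn2 : (n : ℝ) ≤ 2 ^ n := by exact_mod_cast Nat.lt_two_pow_self.le
  rw [show (1 / 2 : ℝ) ^ n = Real.sqrt (((1 / 2 : ℝ) ^ n) ^ 2) from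
    (Real.sqrt_sq (by positivity)).symm, ← Real.sqrt_mul (Real.exp_pos _).le]
  apply Real.le_sqrt_of_sq_le
  rw [norm_mul, norm_mul, norm_mul, norm_inv, norm_pow, Real.norm_natCast, Real.norm_natCast,
    Real.norm_of_nonneg (Real.sqrt_nonneg _), mul_pow, mul_pow, mul_pow,
    Real.sq_sqrt (by positivity), ← pow_mul, mul_comm n 2, pow_mul, Real.norm_eq_abs, sq_abs]
  calc ((n.factorial : ℝ)⁻¹) ^ 2 * ((n : ℝ) ^ 2 * (n : ℝ) ^ n) * (M ^ 2) ^ n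
      = ((n : ℝ) ^ n / n.factorial) * (n : ℝ) ^ 2 * (M ^ 2) ^ n / n.factorial := by
        field_simp
    _ ≤ Real.exp 1 ^ n * (2 ^ n) ^ 2 * (M ^ 2) ^ n / n.factorial := by gcongr
    _ = (16 * Real.exp 1 * M ^ 2) ^ n / n.factorial * ((1 / 2 : ℝ) ^ n) ^ 2 := by
        have : ((16 : ℝ) ^ n) = (2 ^ n) ^ 2 * (2 ^ n) ^ 2 := by
          rw [← pow_mul, ← pow_add, show n * 2 + n * 2 = 4 * n by ring, pow_mul]; norm_num
        rw [mul_pow, mul_pow, this, one_div, inv_pow]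
        field_simp
    _ ≤ _ := by gcongr

/-- Differentiation of a parametric integral with a Lipschitz bound at the base point only. -/
theorem hasDerivAt_integral_of_dominated_lip {α : Type*} [MeasurableSpace α] {μ : Measure α}
    {F : ℝ → α → ℂ} {F' : α → ℂ} {s : ℝ} {bound : α → ℝ}
    (hF_meas : ∀ᶠ r in 𝓝 s, AEStronglyMeasurable (F r) μ) (hF_int : Integrable (F s) μ)
    (hlip : ∀ᶠ r in 𝓝 s, ∀ a, ‖F r a - F s a‖ ≤ |r - s| * bound a)
    (hb : Integrable bound μ) (hd : ∀ a, HasDerivAt (fun r => F r a) (F' a) s) :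
    HasDerivAt (fun r => ∫ a, F r a ∂μ) (∫ a, F' a ∂μ) s := by
  have hint : ∀ᶠ r in 𝓝 s, Integrable (F r) μ := by
    filter_upwards [hF_meas, hlip] with r h1 h2
    have h3 : Integrable (fun a => F r a - F s a) μ :=
      Integrable.mono' (hb.const_mul |r - s|) (h1.sub hF_int.aestronglyMeasurable)
        (Eventually.of_forall h2)
    exact (h3.add hF_int).congr (Eventually.of_forall fun a => by simp)
  rw [hasDerivAt_iff_tendsto_slope]
  have hslope : ∀ᶠ r in 𝓝[≠] s, slope (fun r => ∫ a, F r a ∂μ) s r =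
      ∫ a, slope (fun r => F r a) s r ∂μ := by
    filter_upwards [nhdsWithin_le_nhds hint] with r hr
    simp only [slope_def_module]
    rw [integral_smul, integral_sub hr hF_int]
  refine Tendsto.congr' (hslope.mono fun r hr => hr.symm) ?_
  refine tendsto_integral_filter_of_dominated_convergence bound ?_ ?_ hb ?_
  · filter_upwards [nhdsWithin_le_nhds hF_meas] with r hr
    simp only [slope_def_module]
    exact (hr.sub hF_int.aestronglyMeasurable).const_smul _
  · filter_upwards [nhdsWithin_le_nhds hlip, self_mem_nhdsWithin] with r hr hne
    refine Eventually.of_forall fun a => ?_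
    have h0 : 0 < |r - s| := abs_pos.2 (sub_ne_zero.2 hne)
    rw [slope_def_module, norm_smul, norm_inv, Real.norm_eq_abs, inv_mul_le_iff₀ h0]
    exact hr a
  · exact Eventually.of_forall fun a => hasDerivAt_iff_tendsto_slope.1 (hd a)

/-- Differentiation of a series with a summable Lipschitz bound at the base point only. -/
theorem hasDerivAt_tsum_of_lip {f : ℕ → ℝ → ℂ} {f' : ℕ → ℂ} {s : ℝ} {b : ℕ → ℝ}
    (hb : Summable b) (hf : ∀ᶠ r in 𝓝 s, Summable fun n => f n r)
    (hlip : ∀ᶠ r in 𝓝 s, ∀ n, ‖f n r - f n s‖ ≤ |r - s| * b n)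
    (hd : ∀ n, HasDerivAt (f n) (f' n) s) :
    HasDerivAt (fun r => ∑' n, f n r) (∑' n, f' n) s := by
  rw [hasDerivAt_iff_tendsto_slope]
  have hslope : ∀ᶠ r in 𝓝[≠] s, slope (fun r => ∑' n, f n r) s r = ∑' n, slope (f n) s r := by
    filter_upwards [nhdsWithin_le_nhds hf] with r hr
    simp only [slope_def_module]
    rw [← hr.tsum_sub hf.self_of_nhds, tsum_const_smul'']
  refine Tendsto.congr' (hslope.mono fun r hr => hr.symm) ?_
  refine tendsto_tsum_of_dominated_convergence hb
    (fun n => hasDerivAt_iff_tendsto_slope.1 (hd n)) ?_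
  filter_upwards [nhdsWithin_le_nhds hlip, self_mem_nhdsWithin] with r hr hne n
  have h0 : 0 < |r - s| := abs_pos.2 (sub_ne_zero.2 hne)
  rw [slope_def_module, norm_smul, norm_inv, Real.norm_eq_abs, inv_mul_le_iff₀ h0]
  exact hr n

/-! ### Fredholm series and minors of kernels dominated by a weight -/

namespace FredholmTheory

open ImpenetrableAnyons (fredholmDet)

/-- A continuous positive square integrable weight on the line. -/
structure IsWeight (w : ℝ → ℝ) : Prop where
  cont : Continuous w
  pos : ∀ a, 0 < w a
  int : Integrable fun a => w a * w a

/-- A continuous kernel dominated by the weight `w`. -/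
structure IsKernel (w : ℝ → ℝ) (K : ℝ → ℝ → ℂ) : Prop where
  cont : Continuous fun p : ℝ × ℝ => K p.1 p.2
  bound : ∀ a b, ‖K a b‖ ≤ w a * w b

/-- A continuous row dominated by a multiple of the weight `w`. -/
structure IsRow (w : ℝ → ℝ) (p : ℝ) (r : ℝ → ℂ) : Prop where
  cont : Continuous r
  bound : ∀ b, ‖r b‖ ≤ p * w b

/-- The matrix of a kernel at two families of points. -/
def kerMat (K : ℝ → ℝ → ℂ) {n : ℕ} (ξ η : Fin n → ℝ) : Matrix (Fin n) (Fin n) ℂ :=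
  Matrix.of fun i j => K (ξ i) (η j)

/-- The kernel matrix at `ξ`, bordered by a first column at `y` and by a first row `r`. -/
def bord (r : ℝ → ℂ) (K : ℝ → ℝ → ℂ) (y : ℝ) {n : ℕ} (ξ : Fin n → ℝ) :
    Matrix (Fin (n + 1)) (Fin (n + 1)) ℂ :=
  Matrix.of (Fin.cons (fun j => r ((Fin.cons y ξ : Fin (n + 1) → ℝ) j))
    fun i j => K (ξ i) ((Fin.cons y ξ : Fin (n + 1) → ℝ) j))

/-- The `n`-fold integral in the Fredholm series. -/
noncomputable def fd (K : ℝ → ℝ → ℂ) (n : ℕ) : ℂ := ∫ ξ : Fin n → ℝ, (kerMat K ξ ξ).det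

/-- The `n`-fold integral of bordered determinants. -/
noncomputable def mn (r : ℝ → ℂ) (K : ℝ → ℝ → ℂ) (n : ℕ) (y : ℝ) : ℂ :=
  ∫ ξ : Fin n → ℝ, (bord r K y ξ).det

/-- The Fredholm minor with first row `r`. -/
noncomputable def rowMinor (r : ℝ → ℂ) (K : ℝ → ℝ → ℂ) (y : ℝ) : ℂ :=
  ∑' n : ℕ, ((n.factorial : ℂ))⁻¹ * mn r K n y

theorem fredholmDet_eq (K : ℝ → ℝ → ℂ) :
    fredholmDet K = ∑' n : ℕ, ((n.factorial : ℂ))⁻¹ * fd K n := rfl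

/-- Hadamard's constant. -/
noncomputable def had (n : ℕ) : ℝ := Real.sqrt ((n : ℝ) ^ n)

theorem had_nonneg (n : ℕ) : 0 ≤ had n := Real.sqrt_nonneg _

theorem summable_had_mul (M : ℝ) :
    Summable fun n : ℕ => (n.factorial : ℝ)⁻¹ * (n * had n * M ^ n) := by
  refine (summable_hadamard M).congr fun n => ?_
  rw [had]; ring

theorem summable_had (M : ℝ) :
    Summable fun n : ℕ => (n.factorial : ℝ)⁻¹ * (had n * |M| ^ n) := by
  have h := summable_had_mul |M|
  rw [← summable_nat_add_iff 1] at h ⊢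
  refine Summable.of_nonneg_of_le (fun n => ?_) (fun n => ?_) h
  · have := had_nonneg (n + 1); positivity
  · gcongr
    refine le_mul_of_one_le_left (had_nonneg _) ?_
    exact_mod_cast Nat.le_add_left 1 n

/-- A minor of order `n` is a determinant of size `n + 1`, so Hadamard's constant runs one ahead of
the factorial. In the shifted series the factor `n + 1` restores the factorial, and enlarging `|M|`
to `|M| + 1` makes the extra power harmless. -/
theorem summable_had_succ (M : ℝ) :
    Summable fun n : ℕ => (n.factorial : ℝ)⁻¹ * (had (n + 1) * |M| ^ n) := by
  have h := (summable_nat_add_iff 1).2 (summable_had_mul (|M| + 1))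
  refine Summable.of_nonneg_of_le (fun n => ?_) (fun n => ?_) h
  · have := had_nonneg (n + 1); positivity
  · have hf : (n.factorial : ℝ) ≠ 0 := by exact_mod_cast n.factorial_ne_zero
    have h0 := had_nonneg (n + 1)
    rw [Nat.factorial_succ]
    push_cast
    have : ((n : ℝ) + 1) ≠ 0 := by positivity
    rw [show (((n : ℝ) + 1) * n.factorial)⁻¹ * (((n : ℝ) + 1) * had (n + 1) * (|M| + 1) ^ (n + 1)) =
      (n.factorial : ℝ)⁻¹ * (had (n + 1) * (|M| + 1) ^ (n + 1)) by field_simp]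
    gcongr
    calc |M| ^ n ≤ (|M| + 1) ^ n := by gcongr; linarith
      _ ≤ (|M| + 1) ^ (n + 1) := by
        apply pow_le_pow_right₀ _ (Nat.le_succ n)
        linarith [abs_nonneg M]

variable {w : ℝ → ℝ} {K L : ℝ → ℝ → ℂ} {r : ℝ → ℂ} {p : ℝ}

theorem IsKernel.row (hK : IsKernel w K) (x : ℝ) : IsRow w (w x) (K x) :=
  ⟨hK.cont.comp (continuous_const.prodMk continuous_id), hK.bound x⟩

theorem IsRow.nonneg (hw : IsWeight w) (hr : IsRow w p r) : 0 ≤ p := by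
  have := (norm_nonneg _).trans (hr.bound 0)
  exact nonneg_of_mul_nonneg_left this (hw.pos 0)

theorem IsWeight.integrable_prod (hw : IsWeight w) (n : ℕ) :
    Integrable fun ξ : Fin n → ℝ => ∏ i, (w (ξ i) * w (ξ i)) :=
  Integrable.fintype_prod (f := fun _ a => w a * w a) fun _ => hw.int

theorem IsWeight.integral_prod (w : ℝ → ℝ) (n : ℕ) :
    ∫ ξ : Fin n → ℝ, ∏ i, (w (ξ i) * w (ξ i)) = (∫ a, w a * w a) ^ n := by
  have := integral_fintype_prod_volume_eq_pow (ι := Fin n) (𝕜 := ℝ) fun a => w a * w a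
  simpa using this

theorem norm_det_kerMat_le (hw : IsWeight w) (hK : IsKernel w K) {n : ℕ} (ξ : Fin n → ℝ) :
    ‖(kerMat K ξ ξ).det‖ ≤ had n * ∏ i, (w (ξ i) * w (ξ i)) := by
  rw [Finset.prod_mul_distrib]
  exact Matrix.norm_det_le_of_norm_le_mul _ _ _ (fun i => (hw.pos _).le) (fun i => (hw.pos _).le)
    fun i j => hK.bound _ _

theorem norm_det_bord_le (hw : IsWeight w) (hK : IsKernel w K) (hr : IsRow w p r) {n : ℕ} (y : ℝ)
    (ξ : Fin n → ℝ) :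
    ‖(bord r K y ξ).det‖ ≤ had (n + 1) * (p * w y) * ∏ i, (w (ξ i) * w (ξ i)) := by
  have h := Matrix.norm_det_le_of_norm_le_mul (bord r K y ξ)
    (Fin.cons p fun i => w (ξ i)) (fun j => w ((Fin.cons y ξ : Fin (n + 1) → ℝ) j))
    (fun i => by
      refine Fin.cases ?_ (fun k => ?_) i
      · simpa using hr.nonneg hw
      · simpa using (hw.pos _).le)
    (fun i => (hw.pos _).le) (fun i j => by
      refine Fin.cases ?_ (fun k => ?_) i
      · simpa [bord] using hr.bound _
      · simpa [bord] using hK.bound _ _)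
  rw [Fin.prod_univ_succ, Fin.prod_univ_succ] at h
  simp only [Fin.cons_zero, Fin.cons_succ] at h
  rw [Finset.prod_mul_distrib, had]
  refine h.trans (le_of_eq ?_)
  push_cast
  ring

theorem continuous_det_kerMat (hK : IsKernel w K) (n : ℕ) :
    Continuous fun ξ : Fin n → ℝ => (kerMat K ξ ξ).det := by
  refine Continuous.matrix_det (continuous_matrix fun i j => ?_)
  exact hK.cont.comp' (f := fun ξ : Fin n → ℝ => (ξ i, ξ j))
    ((continuous_apply i).prodMk (continuous_apply j))

theorem continuous_cons (n : ℕ) (j : Fin (n + 1)) :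
    Continuous fun q : ℝ × (Fin n → ℝ) => (Fin.cons q.1 q.2 : Fin (n + 1) → ℝ) j := by
  refine Fin.cases ?_ (fun k => ?_) j
  · simpa using continuous_fst
  · simpa using (continuous_apply k).comp' continuous_snd

theorem continuous_det_bord (hK : IsKernel w K) (hr : IsRow w p r) (n : ℕ) :
    Continuous fun q : ℝ × (Fin n → ℝ) => (bord r K q.1 q.2).det := by
  refine Continuous.matrix_det (continuous_matrix fun i j => ?_)
  refine Fin.cases ?_ (fun k => ?_) i
  · simpa [bord] using hr.cont.comp' (continuous_cons n j)
  · simpa [bord] using hK.cont.comp'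
      (((continuous_apply k).comp' continuous_snd).prodMk (continuous_cons n j))

theorem continuous_det_bord_right (hK : IsKernel w K) (hr : IsRow w p r) (n : ℕ) (y : ℝ) :
    Continuous fun ξ : Fin n → ℝ => (bord r K y ξ).det :=
  (continuous_det_bord hK hr n).comp (continuous_const.prodMk continuous_id)

theorem integrable_det_kerMat (hw : IsWeight w) (hK : IsKernel w K) (n : ℕ) :
    Integrable fun ξ : Fin n → ℝ => (kerMat K ξ ξ).det :=
  ((hw.integrable_prod n).const_mul (had n)).mono'
    (continuous_det_kerMat hK n).aestronglyMeasurable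
    (Eventually.of_forall fun ξ => norm_det_kerMat_le hw hK ξ)

/-- The total mass of the squared weight. -/
noncomputable def mass (w : ℝ → ℝ) : ℝ := ∫ a, w a * w a

theorem mass_nonneg (hw : IsWeight w) : 0 ≤ mass w :=
  integral_nonneg fun a => mul_nonneg (hw.pos a).le (hw.pos a).le

theorem norm_fd_le (hw : IsWeight w) (hK : IsKernel w K) (n : ℕ) :
    ‖fd K n‖ ≤ had n * |mass w| ^ n := by
  refine (norm_integral_le_of_norm_le ((hw.integrable_prod n).const_mul (had n))
    (Eventually.of_forall fun ξ => norm_det_kerMat_le hw hK ξ)).trans (le_of_eq ?_)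
  rw [integral_const_mul, IsWeight.integral_prod, abs_of_nonneg (mass_nonneg hw), mass]

theorem norm_mn_le (hw : IsWeight w) (hK : IsKernel w K) (hr : IsRow w p r) (n : ℕ) (y : ℝ) :
    ‖mn r K n y‖ ≤ had (n + 1) * |mass w| ^ n * (p * w y) := by
  refine (norm_integral_le_of_norm_le ((hw.integrable_prod n).const_mul (had (n + 1) * (p * w y)))
    (Eventually.of_forall fun ξ => norm_det_bord_le hw hK hr y ξ)).trans (le_of_eq ?_)
  rw [integral_const_mul, IsWeight.integral_prod, abs_of_nonneg (mass_nonneg hw), mass]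
  ring

theorem norm_inv_factorial_mul (n : ℕ) (z : ℂ) :
    ‖((n.factorial : ℂ))⁻¹ * z‖ = (n.factorial : ℝ)⁻¹ * ‖z‖ := by
  rw [norm_mul, norm_inv, Complex.norm_natCast]

theorem norm_fdTerm_le (hw : IsWeight w) (hK : IsKernel w K) (n : ℕ) :
    ‖((n.factorial : ℂ))⁻¹ * fd K n‖ ≤ (n.factorial : ℝ)⁻¹ * (had n * |mass w| ^ n) := by
  rw [norm_inv_factorial_mul]
  gcongr
  exact norm_fd_le hw hK n

theorem norm_mnTerm_le (hw : IsWeight w) (hK : IsKernel w K) (hr : IsRow w p r) (n : ℕ) (y : ℝ) :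
    ‖((n.factorial : ℂ))⁻¹ * mn r K n y‖ ≤
      (n.factorial : ℝ)⁻¹ * (had (n + 1) * |mass w| ^ n) * (p * w y) := by
  rw [norm_inv_factorial_mul, mul_assoc]
  gcongr
  exact norm_mn_le hw hK hr n y

theorem summable_fd (hw : IsWeight w) (hK : IsKernel w K) :
    Summable fun n : ℕ => ((n.factorial : ℂ))⁻¹ * fd K n :=
  Summable.of_norm_bounded (summable_had (mass w)) fun n => norm_fdTerm_le hw hK n

theorem summable_mn (hw : IsWeight w) (hK : IsKernel w K) (hr : IsRow w p r) (y : ℝ) :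
    Summable fun n : ℕ => ((n.factorial : ℂ))⁻¹ * mn r K n y :=
  Summable.of_norm_bounded ((summable_had_succ (mass w)).mul_right _)
    fun n => norm_mnTerm_le hw hK hr n y

/-- The constant in the bound for the Fredholm minors. -/
noncomputable def minorConst (w : ℝ → ℝ) : ℝ :=
  ∑' n : ℕ, (n.factorial : ℝ)⁻¹ * (had (n + 1) * |mass w| ^ n)

theorem norm_rowMinor_le (hw : IsWeight w) (hK : IsKernel w K) (hr : IsRow w p r) (y : ℝ) :
    ‖rowMinor r K y‖ ≤ minorConst w * (p * w y) := by
  rw [minorConst, ← tsum_mul_right]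
  exact tsum_of_norm_bounded ((summable_had_succ (mass w)).mul_right _).hasSum
    fun n => norm_mnTerm_le hw hK hr n y

theorem minorConst_nonneg (w : ℝ → ℝ) : 0 ≤ minorConst w :=
  tsum_nonneg fun n => by have := had_nonneg (n + 1); positivity

section Limits

variable {ι : Type*} {l : Filter ι} [l.IsCountablyGenerated] {Ks : ι → ℝ → ℝ → ℂ}
  {rs : ι → ℝ → ℂ} {ys : ι → ℝ} {y W : ℝ}

/-- Dominated convergence is used twice, in each integral and then in the series; since all kernels
share one weight, pointwise convergence suffices. -/
theorem tendsto_fredholmDet (hw : IsWeight w) (hKs : ∀ᶠ i in l, IsKernel w (Ks i))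
    (hlim : ∀ a b, Tendsto (fun i => Ks i a b) l (𝓝 (K a b))) :
    Tendsto (fun i => fredholmDet (Ks i)) l (𝓝 (fredholmDet K)) := by
  refine tendsto_tsum_of_dominated_convergence (summable_had (mass w)) (fun n => ?_) ?_
  · refine Tendsto.const_mul _ ?_
    refine tendsto_integral_filter_of_dominated_convergence
      (fun ξ => had n * ∏ i, (w (ξ i) * w (ξ i))) ?_ ?_ ((hw.integrable_prod n).const_mul _) ?_
    · exact hKs.mono fun i hi => (continuous_det_kerMat hi n).aestronglyMeasurable
    · exact hKs.mono fun i hi => Eventually.of_forall fun ξ => norm_det_kerMat_le hw hi ξ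
    · refine Eventually.of_forall fun ξ => ?_
      have : Tendsto (fun i => kerMat (Ks i) ξ ξ) l (𝓝 (kerMat K ξ ξ)) :=
        tendsto_pi_nhds.2 fun a => tendsto_pi_nhds.2 fun b => hlim _ _
      exact ((continuous_id.matrix_det).tendsto _).comp this
  · exact hKs.mono fun i hi n => norm_fdTerm_le hw hi n

/-- The column point may move together with the kernel and the row. With `tendsto_rowMinor` this
covers both joint continuity in the spectral variables and limits in a parameter. -/
theorem tendsto_mn (hw : IsWeight w) (hKs : ∀ᶠ i in l, IsKernel w (Ks i))
    (hrs : ∀ᶠ i in l, IsRow w p (rs i)) (hW : ∀ᶠ i in l, w (ys i) ≤ W)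
    (hK : ∀ a b, Tendsto (fun i => Ks i a b) l (𝓝 (K a b)))
    (hKy : ∀ a, Tendsto (fun i => Ks i a (ys i)) l (𝓝 (K a y)))
    (hr : ∀ a, Tendsto (fun i => rs i a) l (𝓝 (r a)))
    (hry : Tendsto (fun i => rs i (ys i)) l (𝓝 (r y))) (n : ℕ) :
    Tendsto (fun i => mn (rs i) (Ks i) n (ys i)) l (𝓝 (mn r K n y)) := by
  refine tendsto_integral_filter_of_dominated_convergence
      (fun ξ => had (n + 1) * (p * W) * ∏ i, (w (ξ i) * w (ξ i))) ?_ ?_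
      ((hw.integrable_prod n).const_mul _) ?_
  · filter_upwards [hKs, hrs] with i hi hi' using
      (continuous_det_bord_right hi hi' n _).aestronglyMeasurable
  · filter_upwards [hKs, hrs, hW] with i hi hi' hi2
    refine Eventually.of_forall fun ξ => (norm_det_bord_le hw hi hi' _ ξ).trans ?_
    have h0 : 0 ≤ p := hi'.nonneg hw
    have h1 := had_nonneg (n + 1)
    have h2 : 0 ≤ ∏ i, (w (ξ i) * w (ξ i)) :=
      Finset.prod_nonneg fun i _ => mul_nonneg (hw.pos _).le (hw.pos _).le
    gcongr
  · refine Eventually.of_forall fun ξ => ?_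
    have : Tendsto (fun i => bord (rs i) (Ks i) (ys i) ξ) l (𝓝 (bord r K y ξ)) := by
      refine tendsto_pi_nhds.2 fun a => tendsto_pi_nhds.2 fun b => ?_
      refine Fin.cases ?_ (fun k => ?_) a <;> refine Fin.cases ?_ (fun k' => ?_) b
      · simpa [bord] using hry
      · simpa [bord] using hr _
      · simpa [bord] using hKy _
      · simpa [bord] using hK _ _
    exact ((continuous_id.matrix_det).tendsto _).comp this

theorem tendsto_rowMinor (hw : IsWeight w) (hKs : ∀ᶠ i in l, IsKernel w (Ks i))
    (hrs : ∀ᶠ i in l, IsRow w p (rs i)) (hW : ∀ᶠ i in l, w (ys i) ≤ W)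
    (hK : ∀ a b, Tendsto (fun i => Ks i a b) l (𝓝 (K a b)))
    (hKy : ∀ a, Tendsto (fun i => Ks i a (ys i)) l (𝓝 (K a y)))
    (hr : ∀ a, Tendsto (fun i => rs i a) l (𝓝 (r a)))
    (hry : Tendsto (fun i => rs i (ys i)) l (𝓝 (r y))) :
    Tendsto (fun i => rowMinor (rs i) (Ks i) (ys i)) l (𝓝 (rowMinor r K y)) := by
  refine tendsto_tsum_of_dominated_convergence ((summable_had_succ (mass w)).mul_right (p * W))
    (fun n => (tendsto_mn hw hKs hrs hW hK hKy hr hry n).const_mul _) ?_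
  filter_upwards [hKs, hrs, hW] with i hi hi' hi2 n
  refine (norm_mnTerm_le hw hi hi' n _).trans ?_
  have h0 : 0 ≤ p := hi'.nonneg hw
  have h1 := had_nonneg (n + 1)
  gcongr

end Limits

theorem continuous_mn (hw : IsWeight w) (hK : IsKernel w K) (hL : IsKernel w L) (n : ℕ) :
    Continuous fun q : ℝ × ℝ => mn (L q.1) K n q.2 := by
  refine continuous_iff_continuousAt.2 fun q => ?_
  have hev : ∀ v : ℝ × ℝ → ℝ, Continuous v → ∀ᶠ i in 𝓝 q, w (v i) ≤ w (v q) + 1 := fun v hv =>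
    ((hw.cont.comp hv).tendsto q).eventually_le_const (by simp)
  refine tendsto_mn (p := w q.1 + 1) hw (Eventually.of_forall fun _ => hK) ?_
    (hev _ continuous_snd) (fun a b => tendsto_const_nhds) (fun a => ?_) (fun a => ?_) ?_ n
  · filter_upwards [hev _ continuous_fst] with i hi
    exact ⟨(hL.row _).cont, fun b => (hL.bound _ b).trans
      (mul_le_mul_of_nonneg_right hi (hw.pos b).le)⟩
  · exact (hK.cont.comp (continuous_const.prodMk continuous_snd)).tendsto q
  · exact (hL.cont.comp (continuous_fst.prodMk continuous_const)).tendsto q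
  · exact hL.cont.tendsto q

theorem continuous_rowMinor (hw : IsWeight w) (hK : IsKernel w K) (hL : IsKernel w L) :
    Continuous fun q : ℝ × ℝ => rowMinor (L q.1) K q.2 := by
  refine continuous_iff_continuousAt.2 fun q => ?_
  have hev : ∀ v : ℝ × ℝ → ℝ, Continuous v → ∀ᶠ i in 𝓝 q, w (v i) ≤ w (v q) + 1 := fun v hv =>
    ((hw.cont.comp hv).tendsto q).eventually_le_const (by simp)
  refine tendsto_rowMinor (p := w q.1 + 1) hw (Eventually.of_forall fun _ => hK) ?_
    (hev _ continuous_snd) (fun a b => tendsto_const_nhds) (fun a => ?_) (fun a => ?_) ?_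
  · filter_upwards [hev _ continuous_fst] with i hi
    exact ⟨(hL.row _).cont, fun b => (hL.bound _ b).trans
      (mul_le_mul_of_nonneg_right hi (hw.pos b).le)⟩
  · exact (hK.cont.comp (continuous_const.prodMk continuous_snd)).tendsto q
  · exact (hL.cont.comp (continuous_fst.prodMk continuous_const)).tendsto q
  · exact hL.cont.tendsto q

/-- Transposing the bordered matrix exchanges its first row with its first column. -/
theorem rowMinor_symm (hsymm : ∀ a b, K a b = K b a) (x y : ℝ) :
    rowMinor (K x) K y = rowMinor (K y) K x := by
  unfold rowMinor mn
  congr 1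
  ext n
  congr 2
  ext ξ
  rw [← Matrix.det_transpose]
  congr 1
  ext i j
  refine Fin.cases ?_ (fun k => ?_) i <;> refine Fin.cases ?_ (fun k' => ?_) j <;>
    simp only [bord, Matrix.transpose_apply, Matrix.of_apply, Fin.cons_zero, Fin.cons_succ] <;>
    exact hsymm _ _

end FredholmTheory

/-! ### Fredholm's recursion and the derivative of the determinant -/

namespace FredholmTheory

open ImpenetrableAnyons (fredholmDet)

variable {w : ℝ → ℝ} {K L : ℝ → ℝ → ℂ} {r : ℝ → ℂ} {p : ℝ}

theorem integral_eq_integral_insertNth {n : ℕ} (i : Fin (n + 1)) {F : (Fin (n + 1) → ℝ) → ℂ}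
    (hF : Integrable F) : ∫ ξ, F ξ = ∫ z : ℝ, ∫ ζ : Fin n → ℝ, F (i.insertNth z ζ) := by
  have hmp := (volume_preserving_piFinSuccAbove (fun _ : Fin (n + 1) => ℝ) i).symm
  rw [← hmp.integral_comp (MeasurableEquiv.measurableEmbedding _)]
  have hF' := (hmp.integrable_comp_emb (MeasurableEquiv.measurableEmbedding _)).2 hF
  exact integral_prod _ hF'

/-- Once the column of the `k`-th point `z` is struck out, the columns stand at `y, ζ` and the rows
at `z, ζ`, with the row of `z` in place `k`. Moving it to the top is a cycle of sign `(-1)^k`. -/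
theorem det_kerMat_cons_succAbove {n : ℕ} (k : Fin (n + 1)) (y z : ℝ) (ζ : Fin n → ℝ) :
    (kerMat K (k.insertNth z ζ)
      (fun j => (Fin.cons y (k.insertNth z ζ : Fin (n + 1) → ℝ) : Fin (n + 2) → ℝ)
        (k.succ.succAbove j))).det = (-1) ^ (k : ℕ) * (bord (K z) K y ζ).det := by
  have h : kerMat K (k.insertNth z ζ)
      (fun j => (Fin.cons y (k.insertNth z ζ : Fin (n + 1) → ℝ) : Fin (n + 2) → ℝ)
        (k.succ.succAbove j)) = (bord (K z) K y ζ).submatrix k.cycleRange id := by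
    ext i j
    have hc : (fun j => (Fin.cons y (k.insertNth z ζ : Fin (n + 1) → ℝ) : Fin (n + 2) → ℝ)
        (k.succ.succAbove j)) = Fin.cons y ζ := by
      ext j
      refine Fin.cases ?_ (fun l => ?_) j
      · simp
      · simp
    rw [hc, Matrix.submatrix_apply, ← Fin.cons_comp_cycleRange]
    have hb : ∀ c d, bord (K z) K y ζ c d =
        K ((Fin.cons z ζ : Fin (n + 1) → ℝ) c) ((Fin.cons y ζ : Fin (n + 1) → ℝ) d) := by
      intro c d
      refine Fin.cases ?_ (fun l => ?_) c <;> simp [bord]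
    rw [hb]
    rfl
  rw [h, Matrix.det_permute, Fin.sign_cycleRange]
  simp

theorem mn_zero (y : ℝ) : mn r K 0 y = r y := by
  have : ∀ ξ : Fin 0 → ℝ, (bord r K y ξ).det = r y := by
    intro ξ
    rw [Matrix.det_fin_one]
    simp [bord]
  simp_rw [mn, this]
  simp [measureReal_def, volume_pi]

theorem det_bord_eq {n : ℕ} (y : ℝ) (ξ : Fin (n + 1) → ℝ) :
    (bord r K y ξ).det = r y * (kerMat K ξ ξ).det + ∑ k : Fin (n + 1), (-1) ^ ((k : ℕ) + 1) *
      r (ξ k) * (kerMat K ξ fun j => (Fin.cons y ξ : Fin (n + 2) → ℝ) (k.succ.succAbove j)).det := by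
  rw [Matrix.det_succ_row_zero, Fin.sum_univ_succ]
  congr 1
  · simp only [bord, Fin.val_zero, pow_zero, one_mul, Matrix.of_apply, Fin.cons_zero]
    rfl

/-- The cofactor sign `(-1)^(k+1)` meets the sign `(-1)^k` of moving row `k` to the top, so every
column contributes the same integral. -/
theorem integral_kerMat_cons_succAbove (hw : IsWeight w) (hK : IsKernel w K) (hr : IsRow w p r)
    (n : ℕ) (y : ℝ) (k : Fin (n + 1)) :
    Integrable (fun ξ : Fin (n + 1) → ℝ => (-1) ^ ((k : ℕ) + 1) * r (ξ k) *
      (kerMat K ξ fun j => (Fin.cons y ξ : Fin (n + 2) → ℝ) (k.succ.succAbove j)).det) ∧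
    ∫ ξ : Fin (n + 1) → ℝ, (-1) ^ ((k : ℕ) + 1) * r (ξ k) *
      (kerMat K ξ fun j => (Fin.cons y ξ : Fin (n + 2) → ℝ) (k.succ.succAbove j)).det =
      -∫ z, r z * mn (K z) K n y := by
  have hint : Integrable (fun ξ : Fin (n + 1) → ℝ => (-1) ^ ((k : ℕ) + 1) * r (ξ k) *
      (kerMat K ξ fun j => (Fin.cons y ξ : Fin (n + 2) → ℝ) (k.succ.succAbove j)).det) := by
    refine ((hw.integrable_prod (n + 1)).const_mul (had (n + 1) * (p * w y))).mono' ?_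
      (Eventually.of_forall fun ξ => ?_)
    · refine Continuous.aestronglyMeasurable ?_
      refine (continuous_const.mul (hr.cont.comp' (continuous_apply k))).mul
        (Continuous.matrix_det (continuous_matrix fun i j => ?_))
      have h1 : Continuous fun ξ : Fin (n + 1) → ℝ =>
          (Fin.cons y ξ : Fin (n + 2) → ℝ) (k.succ.succAbove j) :=
        (continuous_cons (n + 1) (k.succ.succAbove j)).comp'
          (f := fun ξ : Fin (n + 1) → ℝ => (y, ξ)) (continuous_const.prodMk continuous_id)
      exact hK.cont.comp' (f := fun ξ : Fin (n + 1) → ℝ =>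
        (ξ i, (Fin.cons y ξ : Fin (n + 2) → ℝ) (k.succ.succAbove j)))
        ((continuous_apply i).prodMk h1)
    · have hd := Matrix.norm_det_le_of_norm_le_mul
        (kerMat K ξ fun j => (Fin.cons y ξ : Fin (n + 2) → ℝ) (k.succ.succAbove j))
        (fun i => w (ξ i)) (fun j => w ((Fin.cons y ξ : Fin (n + 2) → ℝ) (k.succ.succAbove j)))
        (fun i => (hw.pos _).le) (fun i => (hw.pos _).le) fun i j => hK.bound _ _
      -- Striking out the column of `ξ k` loses one factor `w (ξ k)`; the bound for `r (ξ k)`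
      -- restores it.
      have hprod : w (ξ k) * ∏ j, w ((Fin.cons y ξ : Fin (n + 2) → ℝ) (k.succ.succAbove j)) =
          w y * ∏ i, w (ξ i) := by
        have h2 := Fin.prod_univ_succAbove
          (fun j => w ((Fin.cons y ξ : Fin (n + 2) → ℝ) j)) k.succ
        rw [Fin.prod_univ_succ] at h2
        simpa using h2.symm
      rw [norm_mul, norm_mul, norm_pow, norm_neg, norm_one, one_pow, one_mul]
      calc ‖r (ξ k)‖ * _ ≤ (p * w (ξ k)) * (had (n + 1) * ((∏ i, w (ξ i)) *
            ∏ j, w ((Fin.cons y ξ : Fin (n + 2) → ℝ) (k.succ.succAbove j)))) := by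
            refine mul_le_mul (hr.bound _) hd (norm_nonneg _) ?_
            exact mul_nonneg (hr.nonneg hw) (hw.pos _).le
        _ = p * had (n + 1) * (∏ i, w (ξ i)) * (w (ξ k) *
            ∏ j, w ((Fin.cons y ξ : Fin (n + 2) → ℝ) (k.succ.succAbove j))) := by ring
        _ = _ := by rw [hprod, Finset.prod_mul_distrib]; ring
  refine ⟨hint, ?_⟩
  rw [integral_eq_integral_insertNth k hint, ← integral_neg]
  congr 1
  ext z
  rw [mn, ← integral_const_mul, ← integral_neg]
  congr 1
  ext ζ
  rw [det_kerMat_cons_succAbove, Fin.insertNth_apply_same]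
  have : ((-1 : ℂ) ^ (k : ℕ)) * (-1) ^ (k : ℕ) = 1 := by
    rw [← mul_pow]; simp
  rw [pow_succ]
  linear_combination (-r z * (bord (K z) K y ζ).det) * this

/-- Laplace expansion along the bordering row: the entry at `y` gives the first term, and the other
`n + 1` entries contribute equally. -/
theorem mn_succ (hw : IsWeight w) (hK : IsKernel w K) (hr : IsRow w p r) (n : ℕ) (y : ℝ) :
    mn r K (n + 1) y = r y * fd K (n + 1) - (n + 1) * ∫ z, r z * mn (K z) K n y := by
  rw [mn, fd]
  simp_rw [det_bord_eq]
  rw [integral_add ((integrable_det_kerMat hw hK _).const_mul _)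
    (integrable_finsetSum _ fun k _ => (integral_kerMat_cons_succAbove hw hK hr n y k).1),
    integral_finsetSum _ fun k _ => (integral_kerMat_cons_succAbove hw hK hr n y k).1,
    integral_const_mul]
  simp_rw [(integral_kerMat_cons_succAbove hw hK hr n y _).2]
  simp
  ring

theorem continuous_mn_left (hw : IsWeight w) (hK : IsKernel w K) (n : ℕ) (y : ℝ) :
    Continuous fun z => mn (K z) K n y :=
  (continuous_mn hw hK hK n).comp' (continuous_id.prodMk continuous_const)

/-- The sum over the Fredholm series may be exchanged with the integration against a row. -/
theorem hasSum_integral_mn (hw : IsWeight w) (hK : IsKernel w K) (hr : IsRow w p r) (y : ℝ) :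
    HasSum (fun n : ℕ => ((n.factorial : ℂ))⁻¹ * ∫ z, r z * mn (K z) K n y)
      (∫ z, r z * rowMinor (K z) K y) := by
  have hfun : (fun n : ℕ => ((n.factorial : ℂ))⁻¹ * ∫ z, r z * mn (K z) K n y) =
      fun n : ℕ => ∫ z, r z * (((n.factorial : ℂ))⁻¹ * mn (K z) K n y) := by
    ext n
    rw [← integral_const_mul]
    congr 1
    ext z
    ring
  rw [hfun]
  refine hasSum_integral_of_dominated_convergence (μ := volume)
    (F := fun (n : ℕ) z => r z * (((n.factorial : ℂ))⁻¹ * mn (K z) K n y))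
    (f := fun z => r z * rowMinor (K z) K y)
    (fun (n : ℕ) z => (n.factorial : ℝ)⁻¹ * (had (n + 1) * |mass w| ^ n) *
      (p * w y * (w z * w z))) (fun n => ?_)
    (fun n => Eventually.of_forall fun z => ?_) (Eventually.of_forall fun z => ?_) ?_
    (Eventually.of_forall fun z => ?_)
  · exact (hr.cont.mul (continuous_const.mul (continuous_mn_left hw hK n y))).aestronglyMeasurable
  · rw [norm_mul]
    calc _ ≤ (p * w z) * ((n.factorial : ℝ)⁻¹ * (had (n + 1) * |mass w| ^ n) * (w z * w y)) :=
          mul_le_mul (hr.bound z) (norm_mnTerm_le hw hK (hK.row z) n y) (norm_nonneg _)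
            (mul_nonneg (hr.nonneg hw) (hw.pos _).le)
      _ = _ := by ring
  · exact (summable_had_succ (mass w)).mul_right _
  · simp_rw [tsum_mul_right]
    exact (hw.int.const_mul _).const_mul _
  · exact (summable_mn hw hK (hK.row z) y).hasSum.mul_left _

/-- Divided by `(n + 1)!`, the recursion `mn_succ` loses its factor `n + 1` and can be summed term
by term. After division by the determinant this is the resolvent equation. -/
theorem rowMinor_eq (hw : IsWeight w) (hK : IsKernel w K) (hr : IsRow w p r) (y : ℝ) :
    rowMinor r K y = r y * fredholmDet K - ∫ z, r z * rowMinor (K z) K y := by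
  have h1 := (hasSum_integral_mn hw hK hr y)
  have h2 := (summable_mn hw hK hr y)
  have h3 := (summable_fd hw hK)
  rw [← h1.tsum_eq, rowMinor, fredholmDet_eq, h2.tsum_eq_zero_add, h3.tsum_eq_zero_add, mn_zero]
  have hterm : ∀ n : ℕ, (((n + 1).factorial : ℂ))⁻¹ * mn r K (n + 1) y =
      r y * ((((n + 1).factorial : ℂ))⁻¹ * fd K (n + 1)) -
        ((n.factorial : ℂ))⁻¹ * ∫ z, r z * mn (K z) K n y := by
    intro n
    have hf : (n.factorial : ℂ) ≠ 0 := by exact_mod_cast n.factorial_ne_zero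
    have hn : ((n : ℂ) + 1) ≠ 0 := by exact_mod_cast n.succ_ne_zero
    rw [mn_succ hw hK hr, Nat.factorial_succ]
    push_cast
    field_simp
  simp_rw [hterm]
  rw [(((summable_nat_add_iff 1).2 h3).mul_left (r y)).tsum_sub h1.summable, tsum_mul_left]
  have : fd K 0 = 1 := by simp [fd, measureReal_def, volume_pi]
  rw [this]
  simp
  ring

/-- Index `i` is cycled to the front in rows and columns alike, so no sign appears. -/
theorem det_updateRow_insertNth {n : ℕ} (i : Fin (n + 1)) (z : ℝ) (ζ : Fin n → ℝ) :
    ((kerMat K (i.insertNth z ζ : Fin (n + 1) → ℝ) (i.insertNth z ζ)).updateRow i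
      (fun j => L z ((i.insertNth z ζ : Fin (n + 1) → ℝ) j))).det = (bord (L z) K z ζ).det := by
  rw [← Matrix.det_submatrix_equiv_self i.cycleRange (bord (L z) K z ζ)]
  congr 1
  ext a b
  have hins : ∀ c, (i.insertNth z ζ : Fin (n + 1) → ℝ) c =
      (Fin.cons z ζ : Fin (n + 1) → ℝ) (i.cycleRange c) := fun c => by
    rw [← Fin.cons_comp_cycleRange]; rfl
  rw [Matrix.submatrix_apply]
  by_cases ha : a = i
  · subst ha
    rw [Matrix.updateRow_self, Fin.cycleRange_self, hins]
    simp [bord]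
  · rw [Matrix.updateRow_ne ha, kerMat, Matrix.of_apply, hins, hins]
    have : i.cycleRange a ≠ 0 := fun h => ha (i.cycleRange.injective (by rw [h, Fin.cycleRange_self]))
    obtain ⟨c, hc⟩ := Fin.exists_succ_eq.2 this
    rw [← hc]
    simp [bord]

theorem integral_det_updateRow (hw : IsWeight w) (hK : IsKernel w K) (hL : IsKernel w L) (n : ℕ)
    (i : Fin n) :
    Integrable fun ξ : Fin n → ℝ =>
      ((kerMat K ξ ξ).updateRow i fun j => L (ξ i) (ξ j)).det := by
  refine ((hw.integrable_prod n).const_mul (had n)).mono' ?_ (Eventually.of_forall fun ξ => ?_)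
  · refine (Continuous.matrix_det ?_).aestronglyMeasurable
    refine continuous_matrix fun a b => ?_
    by_cases h : a = i
    · subst h
      simp only [Matrix.updateRow_self]
      exact hL.cont.comp' (f := fun ξ : Fin n → ℝ => (ξ a, ξ b))
        ((continuous_apply a).prodMk (continuous_apply b))
    · simp only [Matrix.updateRow_ne h]
      exact hK.cont.comp' (f := fun ξ : Fin n → ℝ => (ξ a, ξ b))
        ((continuous_apply a).prodMk (continuous_apply b))
  · rw [Finset.prod_mul_distrib]
    refine Matrix.norm_det_le_of_norm_le_mul _ _ _ (fun i => (hw.pos _).le)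
      (fun i => (hw.pos _).le) fun a b => ?_
    by_cases h : a = i
    · subst h
      rw [Matrix.updateRow_self]
      exact hL.bound _ _
    · rw [Matrix.updateRow_ne h]
      exact hK.bound _ _

/-- The integration variables play symmetric roles, hence each row contributes equally; the factor
`n + 1` later turns `1 / (n + 1)!` into `1 / n!`. -/
theorem integral_sum_det_updateRow (hw : IsWeight w) (hK : IsKernel w K) (hL : IsKernel w L)
    (n : ℕ) :
    ∫ ξ : Fin (n + 1) → ℝ, ∑ i, ((kerMat K ξ ξ).updateRow i fun j => L (ξ i) (ξ j)).det =
      (n + 1) * ∫ z, mn (L z) K n z := by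
  rw [integral_finsetSum _ fun i _ => integral_det_updateRow hw hK hL (n + 1) i]
  have : ∀ i : Fin (n + 1), ∫ ξ : Fin (n + 1) → ℝ,
      ((kerMat K ξ ξ).updateRow i fun j => L (ξ i) (ξ j)).det = ∫ z, mn (L z) K n z := by
    intro i
    rw [integral_eq_integral_insertNth i (integral_det_updateRow hw hK hL (n + 1) i)]
    congr 1
    ext z
    rw [mn]
    congr 1
    ext ζ
    rw [Fin.insertNth_apply_same, det_updateRow_insertNth]
  simp_rw [this]
  simp

/-- The logarithmic derivative of a Fredholm determinant, in terms of the minors. -/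
theorem hasDerivAt_fredholmDet {Ks : ℝ → ℝ → ℝ → ℂ} {s : ℝ} (hw : IsWeight w)
    (hKs : ∀ᶠ r in 𝓝 s, IsKernel w (Ks r)) (hL : IsKernel w L)
    (hlip : ∀ᶠ r in 𝓝 s, ∀ a b, ‖Ks r a b - Ks s a b‖ ≤ |r - s| * (w a * w b))
    (hd : ∀ a b, HasDerivAt (fun r => Ks r a b) (L a b) s) :
    HasDerivAt (fun r => fredholmDet (Ks r)) (∫ z, rowMinor (L z) (Ks s) z) s := by
  have hK := hKs.self_of_nhds
  have hlipdet : ∀ᶠ r in 𝓝 s, ∀ (n : ℕ) (ξ : Fin n → ℝ),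
      ‖(kerMat (Ks r) ξ ξ).det - (kerMat (Ks s) ξ ξ).det‖ ≤
        |r - s| * (n * had n * ∏ i, (w (ξ i) * w (ξ i))) := by
    filter_upwards [hKs, hlip] with r h1 h2 n ξ
    rw [Finset.prod_mul_distrib]
    exact Matrix.norm_det_sub_det_le _ _ _ _ _ (fun i => hw.pos _) (fun i => hw.pos _)
      (abs_nonneg _) (fun i j => h1.bound _ _) (fun i j => hK.bound _ _) fun i j => h2 _ _
  have hfd : ∀ n, HasDerivAt (fun r => fd (Ks r) n) (∫ ξ : Fin n → ℝ,
      ∑ i, ((kerMat (Ks s) ξ ξ).updateRow i fun j => L (ξ i) (ξ j)).det) s := by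
    intro n
    refine hasDerivAt_integral_of_dominated_lip
      (bound := fun ξ => n * had n * ∏ i, (w (ξ i) * w (ξ i)))
      (hKs.mono fun r hr => (continuous_det_kerMat hr n).aestronglyMeasurable)
      (integrable_det_kerMat hw hK n) (hlipdet.mono fun r hr => hr n)
      ((hw.integrable_prod n).const_mul _) fun ξ => ?_
    exact Matrix.hasDerivAt_det (A := fun r => kerMat (Ks r) ξ ξ) (A' := kerMat L ξ ξ)
      fun i j => hd _ _
  have hser := hasDerivAt_tsum_of_lip
    (f := fun (n : ℕ) r => ((n.factorial : ℂ))⁻¹ * fd (Ks r) n)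
    (b := fun n : ℕ => (n.factorial : ℝ)⁻¹ * (n * had n * mass w ^ n))
    (summable_had_mul _) (hKs.mono fun r hr => summable_fd hw hr) ?_
    (fun n => (hfd n).const_mul _)
  · have hval : ∫ z, rowMinor (L z) (Ks s) z = ∑' n : ℕ, ((n.factorial : ℂ))⁻¹ *
        ∫ ξ : Fin n → ℝ, ∑ i, ((kerMat (Ks s) ξ ξ).updateRow i fun j => L (ξ i) (ξ j)).det := by
      have hz : ∀ n : ℕ, ((n.factorial : ℂ))⁻¹ * ∫ z, mn (L z) (Ks s) n z =
          (((n + 1).factorial : ℂ))⁻¹ * ∫ ξ : Fin (n + 1) → ℝ, ∑ i, ((kerMat (Ks s) ξ ξ).updateRow i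
            fun j => L (ξ i) (ξ j)).det := by
        intro n
        have hf : (n.factorial : ℂ) ≠ 0 := by exact_mod_cast n.factorial_ne_zero
        have hn : ((n : ℂ) + 1) ≠ 0 := by exact_mod_cast n.succ_ne_zero
        rw [integral_sum_det_updateRow hw hK hL, Nat.factorial_succ]
        push_cast
        field_simp
      have hsum : HasSum (fun n : ℕ => ∫ z, ((n.factorial : ℂ))⁻¹ * mn (L z) (Ks s) n z)
          (∫ z, rowMinor (L z) (Ks s) z) := by
        refine hasSum_integral_of_dominated_convergence
          (fun (n : ℕ) z => (n.factorial : ℝ)⁻¹ * (had (n + 1) * |mass w| ^ n) * (w z * w z))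
          (fun n => ?_) (fun n => Eventually.of_forall fun z => norm_mnTerm_le hw hK (hL.row z) n z)
          (Eventually.of_forall fun z => (summable_had_succ (mass w)).mul_right _) ?_
          (Eventually.of_forall fun z => (summable_mn hw hK (hL.row z) z).hasSum)
        · exact (continuous_const.mul ((continuous_mn hw hK hL n).comp'
            (continuous_id.prodMk continuous_id))).aestronglyMeasurable
        · simp_rw [tsum_mul_right]
          exact hw.int.const_mul _
      simp_rw [integral_const_mul, hz] at hsum
      -- The empty determinant is constant, so the differentiated series effectively starts at `n =
      -- 1`, in agreement with the shift in `hz`.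
      have h0 : ((Nat.factorial 0 : ℂ))⁻¹ * ∫ ξ : Fin 0 → ℝ, ∑ i : Fin 0,
          ((kerMat (Ks s) ξ ξ).updateRow i fun j => L (ξ i) (ξ j)).det = 0 := by simp
      have := (hasSum_nat_add_iff' (f := fun n : ℕ => ((n.factorial : ℂ))⁻¹ * ∫ ξ : Fin n → ℝ,
        ∑ i, ((kerMat (Ks s) ξ ξ).updateRow i fun j => L (ξ i) (ξ j)).det)
        (g := ∫ z, rowMinor (L z) (Ks s) z) 1).1 (by
          rw [Finset.sum_range_one, h0, sub_zero]; exact hsum)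
      exact this.tsum_eq.symm
    rw [hval]
    exact hser
  · filter_upwards [hlipdet, hKs] with r hr hr2 n
    rw [← mul_sub, norm_inv_factorial_mul, mul_left_comm]
    gcongr
    rw [fd, fd, ← integral_sub (integrable_det_kerMat hw hr2 n) (integrable_det_kerMat hw hK n)]
    refine (norm_integral_le_of_norm_le (((hw.integrable_prod n).const_mul (n * had n)).const_mul
      |r - s|) (Eventually.of_forall fun ξ => hr n ξ)).trans (le_of_eq ?_)
    rw [integral_const_mul, integral_const_mul, IsWeight.integral_prod, mass]

end FredholmTheory

/-! ### The resolvent, the inverse of 1 + K, and kernels of integrable form -/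

namespace FredholmTheory

open ImpenetrableAnyons (fredholmDet)

variable {w : ℝ → ℝ} {K R L : ℝ → ℝ → ℂ} {f g h u v : ℝ → ℂ}

/-- A continuous kernel dominated by a multiple of the weight. -/
def IsBddKernel (w : ℝ → ℝ) (K : ℝ → ℝ → ℂ) : Prop :=
  Continuous (fun p : ℝ × ℝ => K p.1 p.2) ∧ ∃ c, 0 ≤ c ∧ ∀ a b, ‖K a b‖ ≤ c * (w a * w b)

/-- A continuous function dominated by a multiple of the weight. -/
def IsBdd (w : ℝ → ℝ) (g : ℝ → ℂ) : Prop :=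
  Continuous g ∧ ∃ c, 0 ≤ c ∧ ∀ a, ‖g a‖ ≤ c * w a

/-- A measurable function integrable against the weight. -/
def IsAdm (w : ℝ → ℝ) (g : ℝ → ℂ) : Prop :=
  AEStronglyMeasurable g volume ∧ Integrable fun a => w a * ‖g a‖

/-- The integral operator with kernel `K`. -/
noncomputable def op (K : ℝ → ℝ → ℂ) (g : ℝ → ℂ) (x : ℝ) : ℂ := ∫ y, K x y * g y

/-- The resolvent kernel of `K`. -/
noncomputable def res (K : ℝ → ℝ → ℂ) (x y : ℝ) : ℂ := rowMinor (K x) K y / fredholmDet K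

/-- The inverse of `1 + K`. -/
noncomputable def inv (K : ℝ → ℝ → ℂ) (g : ℝ → ℂ) (x : ℝ) : ℂ := g x - op (res K) g x

theorem IsKernel.isBdd (hK : IsKernel w K) : IsBddKernel w K :=
  ⟨hK.cont, 1, zero_le_one, fun a b => by simpa using hK.bound a b⟩

theorem IsBdd.adm (hw : IsWeight w) (hg : IsBdd w g) : IsAdm w g := by
  obtain ⟨h1, c, -, h2⟩ := hg
  refine ⟨h1.aestronglyMeasurable, (hw.int.const_mul c).mono'
    (hw.cont.mul h1.norm).aestronglyMeasurable (Eventually.of_forall fun a => ?_)⟩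
  rw [Real.norm_of_nonneg (mul_nonneg (hw.pos a).le (norm_nonneg _))]
  have := mul_le_mul_of_nonneg_left (h2 a) (hw.pos a).le
  linarith

theorem IsBdd.add (hf : IsBdd w f) (hg : IsBdd w g) : IsBdd w fun x => f x + g x := by
  obtain ⟨h1, c, hc, h2⟩ := hf
  obtain ⟨h3, d, hd, h4⟩ := hg
  refine ⟨h1.add h3, c + d, add_nonneg hc hd, fun a => (norm_add_le _ _).trans ?_⟩
  linarith [h2 a, h4 a]

theorem IsBdd.const_mul (c : ℂ) (hf : IsBdd w f) : IsBdd w fun x => c * f x := by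
  obtain ⟨h1, d, hd, h2⟩ := hf
  refine ⟨continuous_const.mul h1, ‖c‖ * d, mul_nonneg (norm_nonneg _) hd, fun a => ?_⟩
  rw [norm_mul, mul_assoc]
  exact mul_le_mul_of_nonneg_left (h2 a) (norm_nonneg _)

theorem IsBdd.sub (hf : IsBdd w f) (hg : IsBdd w g) : IsBdd w fun x => f x - g x := by
  simpa [sub_eq_add_neg] using hf.add (hg.const_mul (-1))

theorem IsAdm.add (hf : IsAdm w f) (hg : IsAdm w g) (hw : IsWeight w) :
    IsAdm w fun x => f x + g x := by
  refine ⟨hf.1.add hg.1, (hf.2.add hg.2).mono'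
    (hw.cont.aestronglyMeasurable.mul (hf.1.add hg.1).norm) (Eventually.of_forall fun a => ?_)⟩
  rw [Real.norm_of_nonneg (mul_nonneg (hw.pos a).le (norm_nonneg _))]
  have := mul_le_mul_of_nonneg_left (norm_add_le (f a) (g a)) (hw.pos a).le
  simp only [Pi.add_apply]
  linarith

theorem IsAdm.const_mul (c : ℂ) (hf : IsAdm w f) : IsAdm w fun x => c * f x := by
  refine ⟨aestronglyMeasurable_const.mul hf.1, (hf.2.const_mul ‖c‖).congr
    (Eventually.of_forall fun a => ?_)⟩
  simp only [norm_mul]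
  ring

theorem IsAdm.sub (hf : IsAdm w f) (hg : IsAdm w g) (hw : IsWeight w) :
    IsAdm w fun x => f x - g x := by
  simpa [sub_eq_add_neg] using hf.add (hg.const_mul (-1)) hw

theorem IsBddKernel.row (hK : IsBddKernel w K) (hw : IsWeight w) (x : ℝ) : IsBdd w (K x) := by
  obtain ⟨h1, c, hc, h2⟩ := hK
  refine ⟨h1.comp (continuous_const.prodMk continuous_id), c * w x,
    mul_nonneg hc (hw.pos x).le, fun a => (h2 x a).trans (le_of_eq (by ring))⟩

theorem IsBddKernel.col (hK : IsBddKernel w K) (hw : IsWeight w) (y : ℝ) :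
    IsBdd w (fun x => K x y) := by
  obtain ⟨h1, c, hc, h2⟩ := hK
  refine ⟨h1.comp (continuous_id.prodMk continuous_const), c * w y,
    mul_nonneg hc (hw.pos y).le, fun a => (h2 a y).trans (le_of_eq (by ring))⟩

theorem IsBdd.integrable_mul (hf : IsBdd w f) (hg : IsAdm w g) :
    Integrable fun x => f x * g x := by
  obtain ⟨h1, c, hc, h2⟩ := hf
  refine (hg.2.const_mul c).mono' (h1.aestronglyMeasurable.mul hg.1)
    (Eventually.of_forall fun a => ?_)
  rw [norm_mul, ← mul_assoc]
  exact mul_le_mul_of_nonneg_right (h2 a) (norm_nonneg _)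

theorem IsBddKernel.integrable (hK : IsBddKernel w K) (hw : IsWeight w) (hg : IsAdm w g) (x : ℝ) :
    Integrable fun y => K x y * g y :=
  (hK.row hw x).integrable_mul hg

theorem IsBddKernel.op_bdd (hK : IsBddKernel w K) (hw : IsWeight w) (hg : IsAdm w g) :
    IsBdd w (op K g) := by
  obtain ⟨h1, c, hc, h2⟩ := hK
  have hK : IsBddKernel w K := ⟨h1, c, hc, h2⟩
  refine ⟨continuous_iff_continuousAt.2 fun x => ?_, c * ∫ a, w a * ‖g a‖, ?_, fun x => ?_⟩
  · have hev : ∀ᶠ i in 𝓝 x, w i ≤ w x + 1 := (hw.cont.tendsto x).eventually_le_const (by simp)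
    refine tendsto_integral_filter_of_dominated_convergence
      (fun y => c * (w x + 1) * (w y * ‖g y‖))
      (Eventually.of_forall fun i => (hK.integrable hw hg i).aestronglyMeasurable) ?_
      (hg.2.const_mul _) (Eventually.of_forall fun y => ?_)
    · filter_upwards [hev] with i hi
      refine Eventually.of_forall fun y => ?_
      rw [norm_mul]
      calc ‖K i y‖ * ‖g y‖ ≤ (c * (w i * w y)) * ‖g y‖ := by gcongr; exact h2 _ _
        _ ≤ (c * ((w x + 1) * w y)) * ‖g y‖ := by
          have := (hw.pos y).le
          gcongr
        _ = _ := by ring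
    · exact ((h1.comp (continuous_id.prodMk continuous_const)).mul continuous_const).tendsto x
  · exact mul_nonneg hc (integral_nonneg fun a => mul_nonneg (hw.pos a).le (norm_nonneg _))
  · refine (norm_integral_le_of_norm_le (hg.2.const_mul (c * w x))
      (Eventually.of_forall fun y => ?_)).trans (le_of_eq ?_)
    · rw [norm_mul]
      calc ‖K x y‖ * ‖g y‖ ≤ (c * (w x * w y)) * ‖g y‖ := by gcongr; exact h2 _ _
        _ = _ := by ring
    · rw [integral_const_mul]; ring

theorem op_add (hK : IsBddKernel w K) (hw : IsWeight w) (hf : IsAdm w f) (hg : IsAdm w g) (x : ℝ) :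
    op K (fun y => f y + g y) x = op K f x + op K g x := by
  rw [op, op, op, ← integral_add (hK.integrable hw hf x) (hK.integrable hw hg x)]
  congr 1; ext y; ring

theorem op_sub (hK : IsBddKernel w K) (hw : IsWeight w) (hf : IsAdm w f) (hg : IsAdm w g) (x : ℝ) :
    op K (fun y => f y - g y) x = op K f x - op K g x := by
  rw [op, op, op, ← integral_sub (hK.integrable hw hf x) (hK.integrable hw hg x)]
  congr 1; ext y; ring

theorem op_const_mul (c : ℂ) (x : ℝ) : op K (fun y => c * g y) x = c * op K g x := by
  rw [op, op, ← integral_const_mul]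
  congr 1; ext y; ring

/-- Exchange of the order of integration in a bilinear form. -/
theorem integral_mul_op (hK : IsBddKernel w K) (hf : IsAdm w f)
    (hg : IsAdm w g) : ∫ x, f x * op K g x = ∫ y, (∫ x, f x * K x y) * g y := by
  have hint : Integrable (fun q : ℝ × ℝ => f q.1 * K q.1 q.2 * g q.2) (volume.prod volume) := by
    obtain ⟨h1, c, hc, h2⟩ := hK
    refine ((hf.2.mul_prod hg.2).const_mul c).mono' ?_ (Eventually.of_forall fun q => ?_)
    · exact ((hf.1.comp_fst).mul h1.aestronglyMeasurable).mul hg.1.comp_snd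
    · rw [norm_mul, norm_mul]
      calc ‖f q.1‖ * ‖K q.1 q.2‖ * ‖g q.2‖ ≤ ‖f q.1‖ * (c * (w q.1 * w q.2)) * ‖g q.2‖ := by
            gcongr; exact h2 _ _
        _ = _ := by ring
  have := integral_integral_swap (f := fun x y => f x * K x y * g y) hint
  simp only [op]
  calc ∫ x, f x * ∫ y, K x y * g y = ∫ x, ∫ y, f x * K x y * g y := by
        congr 1; ext x; rw [← integral_const_mul]; congr 1; ext y; ring
    _ = ∫ y, ∫ x, f x * K x y * g y := this
    _ = _ := by congr 1; ext y; rw [← integral_mul_const]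

theorem integral_mul_op_symm (hK : IsBddKernel w K) (hs : ∀ a b, K a b = K b a)
    (hf : IsAdm w f) (hg : IsAdm w g) : ∫ x, f x * op K g x = ∫ x, op K f x * g x := by
  rw [integral_mul_op hK hf hg]
  congr 1; ext y
  congr 1
  rw [op]
  congr 1; ext x; rw [hs y x, mul_comm]

theorem op_op (hK : IsBddKernel w K) (hR : IsBddKernel w R) (hw : IsWeight w) (hg : IsAdm w g)
    (x : ℝ) : op K (op R g) x = ∫ y, (∫ z, K x z * R z y) * g y :=
  integral_mul_op hR ((hK.row hw x).adm hw) hg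

theorem integral_linear_combination (hf : Integrable f) (hg : Integrable g) (hh : Integrable h)
    (a b c : ℂ) : ∫ z, (a * f z - (b * g z - c * h z)) =
      a * (∫ z, f z) - (b * (∫ z, g z) - c * ∫ z, h z) := by
  have h1 : Integrable fun z => b * g z - c * h z := (hg.const_mul b).sub (hh.const_mul c)
  rw [integral_sub (hf.const_mul a) h1, integral_sub (hg.const_mul b) (hh.const_mul c),
    integral_const_mul, integral_const_mul, integral_const_mul]

/-- The hypotheses under which `1 + K` is inverted. -/
structure IsRegular (w : ℝ → ℝ) (K : ℝ → ℝ → ℂ) : Prop where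
  weight : IsWeight w
  kernel : IsKernel w K
  symm : ∀ a b, K a b = K b a
  det_ne : fredholmDet K ≠ 0

namespace IsRegular

variable (H : IsRegular w K)
include H

theorem res_symm (a b : ℝ) : res K a b = res K b a := by
  rw [res, res, rowMinor_symm H.symm]

theorem norm_res_le (a b : ℝ) :
    ‖res K a b‖ ≤ minorConst w / ‖fredholmDet K‖ * (w a * w b) := by
  rw [res, norm_div, div_mul_eq_mul_div]
  gcongr
  exact norm_rowMinor_le H.weight H.kernel (H.kernel.row a) b

theorem res_bdd : IsBddKernel w (res K) :=
  ⟨(continuous_rowMinor H.weight H.kernel H.kernel).div_const _, _,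
    div_nonneg (minorConst_nonneg w) (norm_nonneg _), H.norm_res_le⟩

/-- The minor with an arbitrary first row, in terms of the resolvent. -/
theorem rowMinor_div {r : ℝ → ℂ} {p : ℝ} (hr : IsRow w p r) (y : ℝ) :
    rowMinor r K y / fredholmDet K = r y - ∫ z, r z * res K z y := by
  rw [rowMinor_eq H.weight H.kernel hr, sub_div, mul_div_cancel_right₀ _ H.det_ne,
    ← integral_div]
  congr 2; ext z; rw [res]; ring

theorem res_eq (x y : ℝ) : res K x y = K x y - ∫ z, K x z * res K z y :=
  H.rowMinor_div (H.kernel.row x) y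

/-- The mirror image of `res_eq`, by the symmetry of the kernel and of its resolvent. `res_eq` makes
`1 - R` a right inverse of `1 + K`, this one makes it a left inverse. -/
theorem res_eq' (x y : ℝ) : res K x y = K x y - ∫ z, res K x z * K z y := by
  rw [H.res_symm, H.res_eq, H.symm y x]
  congr 2; ext z; rw [H.symm y z, H.res_symm z x, mul_comm]

theorem op_res_adm (hg : IsAdm w g) : IsBdd w (op (res K) g) := H.res_bdd.op_bdd H.weight hg

theorem inv_adm (hg : IsAdm w g) : IsAdm w (inv K g) :=
  hg.sub ((H.op_res_adm hg).adm H.weight) H.weight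

theorem inv_bdd (hg : IsBdd w g) : IsBdd w (inv K g) := hg.sub (H.op_res_adm (hg.adm H.weight))

theorem inv_add (hf : IsAdm w f) (hg : IsAdm w g) (x : ℝ) :
    inv K (fun y => f y + g y) x = inv K f x + inv K g x := by
  rw [inv, inv, inv, op_add H.res_bdd H.weight hf hg]; ring

theorem inv_sub (hf : IsAdm w f) (hg : IsAdm w g) (x : ℝ) :
    inv K (fun y => f y - g y) x = inv K f x - inv K g x := by
  rw [inv, inv, inv, op_sub H.res_bdd H.weight hf hg]; ring

omit H in
theorem inv_const_mul (c : ℂ) (x : ℝ) : inv K (fun y => c * g y) x = c * inv K g x := by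
  rw [inv, inv, op_const_mul]; ring

theorem inv_add_op_inv (hg : IsAdm w g) (x : ℝ) : inv K g x + op K (inv K g) x = g x := by
  have hK := H.kernel.isBdd
  have h1 : op K (inv K g) x = op K g x - op K (op (res K) g) x :=
    op_sub hK H.weight hg ((H.op_res_adm hg).adm H.weight) x
  have h2 : op (res K) g x = op K g x - op K (op (res K) g) x := by
    rw [op_op hK H.res_bdd H.weight hg, op, op, ← integral_sub (hK.integrable H.weight hg x)]
    · congr 1; ext y; rw [H.res_eq]; ring
    · have : Integrable fun y => K x y * g y - res K x y * g y :=
        (hK.integrable H.weight hg x).sub (H.res_bdd.integrable H.weight hg x)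
      refine this.congr (Eventually.of_forall fun y => ?_)
      simp only
      rw [H.res_eq]; ring
  rw [h1, inv, ← h2]; ring

theorem inv_add_op (hg : IsAdm w g) (x : ℝ) : inv K (fun y => g y + op K g y) x = g x := by
  have hK := H.kernel.isBdd
  have h0 : IsAdm w (op K g) := (hK.op_bdd H.weight hg).adm H.weight
  have h2 : op (res K) g x = op K g x - op (res K) (op K g) x := by
    rw [op_op H.res_bdd hK H.weight hg, op, op, ← integral_sub (hK.integrable H.weight hg x)]
    · congr 1; ext y; rw [H.res_eq']; ring
    · have : Integrable fun y => K x y * g y - res K x y * g y :=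
        (hK.integrable H.weight hg x).sub (H.res_bdd.integrable H.weight hg x)
      refine this.congr (Eventually.of_forall fun y => ?_)
      simp only
      rw [H.res_eq']; ring
  rw [inv, op_add H.res_bdd H.weight hg h0, h2]; ring

/-- Uniqueness for the integral equation. -/
theorem eq_inv (hg : IsAdm w g) (he : ∀ x, g x + op K g x = h x) (x : ℝ) : g x = inv K h x := by
  rw [← funext he]
  exact (H.inv_add_op hg x).symm

/-- The resolvent kernel is symmetric, so `(1 + K)⁻¹` can be moved from one factor to the other. -/
theorem integral_mul_inv (hf : IsBdd w f) (hg : IsAdm w g) :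
    ∫ x, f x * inv K g x = ∫ x, inv K f x * g x := by
  have hf' := hf.adm H.weight
  have h1 := integral_mul_op_symm H.res_bdd H.res_symm hf' hg
  have i1 := hf.integrable_mul hg
  have i2 := hf.integrable_mul ((H.op_res_adm hg).adm H.weight)
  have i3 := (H.op_res_adm hf').integrable_mul hg
  calc ∫ x, f x * inv K g x = ∫ x, (f x * g x - f x * op (res K) g x) := by
        congr 1; ext x; rw [inv]; ring
    _ = ∫ x, (f x * g x - op (res K) f x * g x) := by
        rw [integral_sub i1 i2, integral_sub i1 i3, h1]
    _ = _ := by congr 1; ext x; rw [inv]; ring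

/-- The inverse applied to `x u`, for a kernel of integrable form. -/
theorem inv_id_mul (hu : IsBdd w u) (hv : IsBdd w v)
    (hcom : ∀ a b : ℝ, ((a : ℂ) - b) * K a b = u a * v b - v a * u b) (hg : IsBdd w g)
    (hxg : IsAdm w fun x => (x : ℂ) * inv K g x) (x : ℝ) :
    inv K (fun y => (y : ℂ) * g y) x = (x : ℂ) * inv K g x +
      inv K u x * (∫ z, v z * inv K g z) - inv K v x * ∫ z, u z * inv K g z := by
  have hK := H.kernel.isBdd
  have hu' := hu.adm H.weight
  have hv' := hv.adm H.weight
  have hG := (H.inv_bdd hg).adm H.weight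
  have hU := (H.inv_adm hu').const_mul (∫ z, v z * inv K g z)
  have hV := (H.inv_adm hv').const_mul (∫ z, u z * inv K g z)
  -- By uniqueness it is enough to apply `1 + K` to the claimed answer. The commutator of
  -- multiplication by the variable with `K` has rank two by `hcom`, and its two terms are cancelled
  -- by the multiples of `inv K u` and `inv K v`.
  have key : ∀ y : ℝ, ((y : ℂ) * inv K g y + (∫ z, v z * inv K g z) * inv K u y -
      (∫ z, u z * inv K g z) * inv K v y) + op K (fun y => (y : ℂ) * inv K g y +
      (∫ z, v z * inv K g z) * inv K u y - (∫ z, u z * inv K g z) * inv K v y) y =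
      (y : ℂ) * g y := by
    intro y
    rw [op_sub hK H.weight (hxg.add hU H.weight) hV, op_add hK H.weight hxg hU,
      op_const_mul, op_const_mul]
    have h1 : op K (fun y => (y : ℂ) * inv K g y) y = (y : ℂ) * op K (inv K g) y -
        (u y * (∫ z, v z * inv K g z) - v y * ∫ z, u z * inv K g z) := by
      rw [op, op, ← integral_linear_combination (hK.integrable H.weight hG y)
        (hv.integrable_mul hG) (hu.integrable_mul hG)]
      congr 1; ext z
      linear_combination (-inv K g z) * hcom y z
    rw [h1]
    linear_combination (y : ℂ) * H.inv_add_op_inv (hg.adm H.weight) y +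
      (∫ z, v z * inv K g z) * H.inv_add_op_inv hu' y -
      (∫ z, u z * inv K g z) * H.inv_add_op_inv hv' y
  have := H.eq_inv ((hxg.add hU H.weight).sub hV H.weight) key x
  rw [← this]
  ring

/-- The resolvent of a kernel of integrable form is of integrable form. -/
theorem sub_mul_res (hw1 : Integrable fun a => |a| * (w a * w a)) (hu : IsBdd w u) (hv : IsBdd w v)
    (hcom : ∀ a b : ℝ, ((a : ℂ) - b) * K a b = u a * v b - v a * u b) (a b : ℝ) :
    ((a : ℂ) - b) * res K a b = inv K u a * inv K v b - inv K v a * inv K u b := by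
  have hK := H.kernel.isBdd
  have hcol := H.res_bdd.col H.weight b
  have hcol' := hcol.adm H.weight
  have hu' := hu.adm H.weight
  have hv' := hv.adm H.weight
  -- The factor `z - b` is unbounded, which is why the first moment of the squared weight is needed.
  have hadm : IsAdm w fun z => ((z : ℂ) - b) * res K z b := by
    obtain ⟨h1, c, hc, h2⟩ := hcol
    have hcont : Continuous fun z : ℝ => ((z : ℂ) - b) * res K z b :=
      (Complex.continuous_ofReal.sub continuous_const).mul h1
    refine ⟨hcont.aestronglyMeasurable, ((hw1.add (H.weight.int.const_mul |b|)).const_mul c).mono'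
      (H.weight.cont.mul hcont.norm).aestronglyMeasurable (Eventually.of_forall fun z => ?_)⟩
    have h3 := (H.weight.pos z).le
    rw [Real.norm_of_nonneg (mul_nonneg h3 (norm_nonneg _)), norm_mul]
    have h4 : ‖(z : ℂ) - b‖ ≤ |z| + |b| := by
      refine (norm_sub_le _ _).trans ?_
      simp
    calc w z * (‖(z : ℂ) - b‖ * ‖res K z b‖) ≤ w z * ((|z| + |b|) * (c * w z)) := by
          gcongr; exact h2 z
      _ = _ := by simp only [Pi.add_apply]; ring
  have hpair : ∀ k : ℝ → ℂ, inv K k b = k b - ∫ z, k z * res K z b := fun k => by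
    rw [inv, op]
    congr 2; ext z; rw [H.res_symm b z, mul_comm]
  -- In operator form `(1 + K)[x, R] = [x, K](1 - R)`, read in the column `b`, where `[x, K]` has
  -- kernel `u ⊗ v - v ⊗ u`.
  have key : ∀ x : ℝ, ((x : ℂ) - b) * res K x b + op K (fun z => ((z : ℂ) - b) * res K z b) x =
      inv K v b * u x - inv K u b * v x := by
    intro x
    have h1 : op K (fun z => ((z : ℂ) - b) * res K z b) x =
        ((x : ℂ) - b) * (∫ z, K x z * res K z b) -
        (u x * (∫ z, v z * res K z b) - v x * ∫ z, u z * res K z b) := by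
      rw [op, ← integral_linear_combination (hK.integrable H.weight hcol' x)
        (hv.integrable_mul hcol') (hu.integrable_mul hcol')]
      congr 1; ext z
      linear_combination (-res K z b) * hcom x z
    rw [h1, hpair, hpair]
    linear_combination ((x : ℂ) - b) * H.res_eq x b + hcom x b
  have := H.eq_inv hadm key a
  rw [this, H.inv_sub (hu'.const_mul _) (hv'.const_mul _), inv_const_mul, inv_const_mul]
  ring

end IsRegular

end FredholmTheory

/-! ### Differentiability in a parameter -/

namespace FredholmTheory

open ImpenetrableAnyons (fredholmDet)

variable {w : ℝ → ℝ} {Ks : ℝ → ℝ → ℝ → ℂ} {L : ℝ → ℝ → ℂ} {s : ℝ} {g h : ℝ → ℝ → ℂ} {g' h' : ℝ → ℂ}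

/-- A family of functions which is differentiable at the parameter `s`, with domination. -/
structure DiffFam (w : ℝ → ℝ) (g : ℝ → ℝ → ℂ) (g' : ℝ → ℂ) (s : ℝ) : Prop where
  cont : ∀ᶠ r in 𝓝 s, Continuous (g r)
  bdd : ∃ c, 0 ≤ c ∧ ∀ x, ‖g s x‖ ≤ c * w x
  lip : ∃ c, 0 ≤ c ∧ ∀ᶠ r in 𝓝 s, ∀ x, ‖g r x - g s x‖ ≤ |r - s| * (c * w x)
  deriv : ∀ x, HasDerivAt (fun r => g r x) (g' x) s

/-- A family of kernels which is differentiable at the parameter `s`, with domination. -/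
structure DiffKer (w : ℝ → ℝ) (Ks : ℝ → ℝ → ℝ → ℂ) (L : ℝ → ℝ → ℂ) (s : ℝ) : Prop where
  kernel : ∀ᶠ r in 𝓝 s, IsKernel w (Ks r)
  symm : ∀ᶠ r in 𝓝 s, ∀ a b, Ks r a b = Ks r b a
  kernel' : IsKernel w L
  lip : ∀ᶠ r in 𝓝 s, ∀ a b, ‖Ks r a b - Ks s a b‖ ≤ |r - s| * (w a * w b)
  deriv : ∀ a b, HasDerivAt (fun r => Ks r a b) (L a b) s

theorem abs_sub_le_one_eventually (s : ℝ) : ∀ᶠ r in 𝓝 s, |r - s| ≤ 1 := by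
  have : Tendsto (fun r => |r - s|) (𝓝 s) (𝓝 0) := by
    have : Continuous fun r => |r - s| := by fun_prop
    simpa using this.tendsto s
  exact this.eventually_le_const zero_lt_one

theorem DiffFam.isBdd (hg : DiffFam w g g' s) : IsBdd w (g s) := ⟨hg.cont.self_of_nhds, hg.bdd⟩

theorem DiffFam.bdd_eventually (hw : IsWeight w) (hg : DiffFam w g g' s) :
    ∃ c, 0 ≤ c ∧ ∀ᶠ r in 𝓝 s, ∀ x, ‖g r x‖ ≤ c * w x := by
  obtain ⟨c, hc, h1⟩ := hg.bdd
  obtain ⟨d, hd, h2⟩ := hg.lip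
  refine ⟨c + d, add_nonneg hc hd, ?_⟩
  filter_upwards [h2, abs_sub_le_one_eventually s] with r hr hr1 x
  have h3 : |r - s| * (d * w x) ≤ 1 * (d * w x) :=
    mul_le_mul_of_nonneg_right hr1 (mul_nonneg hd (hw.pos x).le)
  calc ‖g r x‖ = ‖(g r x - g s x) + g s x‖ := by simp
    _ ≤ ‖g r x - g s x‖ + ‖g s x‖ := norm_add_le _ _
    _ ≤ _ := by linarith [hr x, h1 x]

theorem DiffFam.hasDerivAt_integral_mul (hw : IsWeight w) (hg : DiffFam w g g' s)
    (hh : DiffFam w h h' s) :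
    HasDerivAt (fun r => ∫ x, g r x * h r x) (∫ x, (g' x * h s x + g s x * h' x)) s := by
  obtain ⟨c1, hc1, b1⟩ := hg.bdd
  obtain ⟨c2, hc2, l1⟩ := hg.lip
  obtain ⟨c3, hc3, b2⟩ := hh.bdd_eventually hw
  obtain ⟨c4, hc4, l2⟩ := hh.lip
  refine hasDerivAt_integral_of_dominated_lip
    (bound := fun x => (c2 * c3 + c1 * c4) * (w x * w x)) ?_ ?_ ?_ (hw.int.const_mul _) ?_
  · filter_upwards [hg.cont, hh.cont] with r h1 h2 using (h1.mul h2).aestronglyMeasurable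
  · exact hg.isBdd.integrable_mul (hh.isBdd.adm hw)
  · filter_upwards [b2, l1, l2] with r h1 h2 h3 x
    have hx := (hw.pos x).le
    calc ‖g r x * h r x - g s x * h s x‖
        = ‖(g r x - g s x) * h r x + g s x * (h r x - h s x)‖ := by ring_nf
      _ ≤ ‖g r x - g s x‖ * ‖h r x‖ + ‖g s x‖ * ‖h r x - h s x‖ := by
        rw [← norm_mul, ← norm_mul]; exact norm_add_le _ _
      _ ≤ (|r - s| * (c2 * w x)) * (c3 * w x) + (c1 * w x) * (|r - s| * (c4 * w x)) := by
        refine add_le_add ?_ ?_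
        · exact mul_le_mul (h2 x) (h1 x) (norm_nonneg _) (by positivity)
        · exact mul_le_mul (b1 x) (h3 x) (norm_nonneg _) (by positivity)
      _ = _ := by ring
  · exact fun x => (hg.deriv x).mul (hh.deriv x)

/-- The determinant is continuous along the family, so it stays away from zero near `s`. -/
theorem DiffKer.regular (hw : IsWeight w) (hK : DiffKer w Ks L s) (hdet : fredholmDet (Ks s) ≠ 0) :
    ∀ᶠ r in 𝓝 s, IsRegular w (Ks r) := by
  have hlim : Tendsto (fun r => fredholmDet (Ks r)) (𝓝 s) (𝓝 (fredholmDet (Ks s))) :=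
    tendsto_fredholmDet hw hK.kernel fun a b => (hK.deriv a b).continuousAt
  filter_upwards [hK.kernel, hK.symm, hlim.eventually_ne hdet] with r h1 h2 h3
  exact ⟨hw, h1, h2, h3⟩

theorem DiffKer.tendsto_res (hw : IsWeight w) (hK : DiffKer w Ks L s)
    (hdet : fredholmDet (Ks s) ≠ 0) (a b : ℝ) :
    Tendsto (fun r => res (Ks r) a b) (𝓝 s) (𝓝 (res (Ks s) a b)) := by
  have hlim : Tendsto (fun r => fredholmDet (Ks r)) (𝓝 s) (𝓝 (fredholmDet (Ks s))) :=
    tendsto_fredholmDet hw hK.kernel fun a b => (hK.deriv a b).continuousAt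
  refine Tendsto.div ?_ hlim hdet
  exact tendsto_rowMinor (p := w a) (W := w b) hw hK.kernel (hK.kernel.mono fun r hr => hr.row a)
    (Eventually.of_forall fun _ => le_rfl) (fun a b => (hK.deriv a b).continuousAt)
    (fun a => (hK.deriv a b).continuousAt) (fun b => (hK.deriv a b).continuousAt)
    (hK.deriv a b).continuousAt

theorem DiffKer.res_bound (hw : IsWeight w) (hK : DiffKer w Ks L s)
    (hdet : fredholmDet (Ks s) ≠ 0) :
    ∃ c, 0 ≤ c ∧ ∀ᶠ r in 𝓝 s, ∀ a b, ‖res (Ks r) a b‖ ≤ c * (w a * w b) := by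
  have hlim : Tendsto (fun r => fredholmDet (Ks r)) (𝓝 s) (𝓝 (fredholmDet (Ks s))) :=
    tendsto_fredholmDet hw hK.kernel fun a b => (hK.deriv a b).continuousAt
  have hpos : 0 < ‖fredholmDet (Ks s)‖ := norm_pos_iff.2 hdet
  refine ⟨minorConst w / (‖fredholmDet (Ks s)‖ / 2), div_nonneg (minorConst_nonneg w)
    (by positivity), ?_⟩
  filter_upwards [hK.regular hw hdet, hlim.norm.eventually_const_le (half_lt_self hpos)]
    with r h1 h2 a b
  refine (h1.norm_res_le a b).trans ?_
  have h3 := minorConst_nonneg w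
  have h4 := (hw.pos a).le
  have h5 := (hw.pos b).le
  gcongr

/-- Solutions of the integral equation inherit differentiability in a parameter. -/
theorem DiffFam.inv (hw : IsWeight w) (hK : DiffKer w Ks L s) (hdet : fredholmDet (Ks s) ≠ 0)
    (hg : DiffFam w g g' s) :
    DiffFam w (fun r => inv (Ks r) (g r))
      (inv (Ks s) fun x => g' x - op L (inv (Ks s) (g s)) x) s := by
  have hreg := hK.regular hw hdet
  have H := hreg.self_of_nhds
  obtain ⟨cR, hcR, hR⟩ := hK.res_bound hw hdet
  obtain ⟨cl, hcl, hl⟩ := hg.lip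
  set φ := FredholmTheory.inv (Ks s) (g s) with hφ
  have hφb : IsBdd w φ := H.inv_bdd hg.isBdd
  have hφa : IsAdm w φ := hφb.adm hw
  set I := ∫ y, w y * ‖φ y‖ with hI
  have hI0 : 0 ≤ I := integral_nonneg fun a => mul_nonneg (hw.pos a).le (norm_nonneg _)
  -- the scaled increment of the right-hand side
  set q : ℝ → ℝ → ℂ := fun r x => slope (fun r => g r x) s r -
    ∫ y, slope (fun r => Ks r x y) s r * φ y with hq
  set C := cl + I with hC
  have hC0 : 0 ≤ C := add_nonneg hcl hI0
  -- The difference quotient of the solutions itself solves the integral equation with kernel `Ks r`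
  -- and right-hand side `q r`. Hence it equals `(1 + K_r)⁻¹ (q r)`, and only a bound and a limit
  -- for `q r` remain to be found.
  have hev : ∀ᶠ r in 𝓝[≠] s, Continuous (q r) ∧ (∀ x, ‖q r x‖ ≤ C * w x) ∧
      (∀ x, FredholmTheory.inv (Ks r) (q r) x =
        slope (fun r => FredholmTheory.inv (Ks r) (g r) x) s r) := by
    filter_upwards [nhdsWithin_le_nhds hreg, nhdsWithin_le_nhds hl, nhdsWithin_le_nhds hg.cont,
      nhdsWithin_le_nhds hK.lip, self_mem_nhdsWithin] with r h1 h2 h3 h4 hne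
    have h0 : 0 < |r - s| := abs_pos.2 (sub_ne_zero.2 hne)
    have hrs : ((r - s : ℝ) : ℂ) ≠ 0 := by exact_mod_cast sub_ne_zero.2 hne
    have hsl : ∀ x y, ‖slope (fun r => Ks r x y) s r‖ ≤ w x * w y := fun x y => by
      rw [slope_def_module, norm_smul, norm_inv, Real.norm_eq_abs, inv_mul_le_iff₀ h0]
      exact h4 x y
    have hKr := h1.kernel.isBdd
    have hKs' := H.kernel.isBdd
    have hqop : ∀ x, q r x = ((r - s : ℝ) : ℂ)⁻¹ *
        (g r x - g s x - (op (Ks r) φ x - op (Ks s) φ x)) := by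
      intro x
      have : ∫ y, slope (fun r => Ks r x y) s r * φ y =
          ((r - s : ℝ) : ℂ)⁻¹ * (op (Ks r) φ x - op (Ks s) φ x) := by
        rw [op, op, ← integral_sub (hKr.integrable hw hφa x) (hKs'.integrable hw hφa x),
          ← integral_const_mul]
        congr 1; ext y
        rw [slope_def_module, Complex.real_smul]
        push_cast; ring
      rw [hq]
      simp only
      rw [this, slope_def_module, Complex.real_smul]
      push_cast; ring
    have hcont : Continuous (q r) := by
      rw [funext hqop]
      exact continuous_const.mul ((h3.sub hg.cont.self_of_nhds).sub
        ((hKr.op_bdd hw hφa).1.sub (hKs'.op_bdd hw hφa).1))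
    have hbd : ∀ x, ‖q r x‖ ≤ C * w x := by
      intro x
      have e1 : ‖slope (fun r => g r x) s r‖ ≤ cl * w x := by
        rw [slope_def_module, norm_smul, norm_inv, Real.norm_eq_abs, inv_mul_le_iff₀ h0]
        exact h2 x
      have e2 : ‖∫ y, slope (fun r => Ks r x y) s r * φ y‖ ≤ w x * I := by
        rw [hI, ← integral_const_mul]
        refine norm_integral_le_of_norm_le (hφa.2.const_mul _) (Eventually.of_forall fun y => ?_)
        rw [norm_mul, ← mul_assoc]
        exact mul_le_mul_of_nonneg_right (hsl x y) (norm_nonneg _)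
      refine (norm_sub_le _ _).trans ?_
      rw [hC]
      linarith
    refine ⟨hcont, hbd, fun x => ?_⟩
    have hqb : IsBdd w (q r) := ⟨hcont, C, hC0, hbd⟩
    have hgr : IsBdd w (g r) := by
      have h5 : IsBdd w fun x => g r x - g s x :=
        ⟨h3.sub hg.cont.self_of_nhds, |r - s| * cl, by positivity, fun x => by
          rw [mul_assoc]; exact h2 x⟩
      simpa using h5.add hg.isBdd
    have hψ := (h1.inv_bdd hgr).adm hw
    set ψ := FredholmTheory.inv (Ks r) (g r) with hψdef
    have hkey : ∀ x, ((r - s : ℝ) : ℂ)⁻¹ * (ψ x - φ x) +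
        op (Ks r) (fun y => ((r - s : ℝ) : ℂ)⁻¹ * (ψ y - φ y)) x = q r x := by
      intro x
      rw [op_const_mul, op_sub hKr hw hψ hφa, hqop, ← h1.inv_add_op_inv (hgr.adm hw) x,
        ← H.inv_add_op_inv (hg.isBdd.adm hw) x]
      ring
    rw [← h1.eq_inv ((hψ.sub hφa hw).const_mul _) hkey x, slope_def_module, Complex.real_smul]
    push_cast
    ring
  refine ⟨?_, ?_, ?_, fun x => ?_⟩
  · obtain ⟨c, hc, hb⟩ := hg.bdd_eventually hw
    filter_upwards [hreg, hg.cont, hb] with r h1 h2 h3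
    exact (h1.inv_bdd ⟨h2, c, hc, h3⟩).1
  · exact hφb.2
  · refine ⟨C + cR * C * mass w, by have := mass_nonneg hw; positivity, ?_⟩
    have hev' := eventually_nhdsWithin_iff.1 hev
    filter_upwards [hev', hR] with r h1 h2 x
    by_cases hne : r = s
    · subst hne; simp
    obtain ⟨h3, h4, h5⟩ := h1 hne
    have e1 : ‖op (res (Ks r)) (q r) x‖ ≤ cR * C * mass w * w x := by
      rw [mass, mul_assoc, mul_comm _ (w x), ← mul_assoc, ← integral_const_mul]
      refine norm_integral_le_of_norm_le (hw.int.const_mul _) (Eventually.of_forall fun y => ?_)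
      rw [norm_mul]
      calc _ ≤ (cR * (w x * w y)) * (C * w y) :=
            mul_le_mul (h2 x y) (h4 y) (norm_nonneg _)
              (by have := hw.pos x; have := hw.pos y; positivity)
        _ = _ := by ring
    have e2 : ‖slope (fun r => FredholmTheory.inv (Ks r) (g r) x) s r‖ ≤
        (C + cR * C * mass w) * w x := by
      rw [← h5 x, FredholmTheory.inv]
      refine (norm_sub_le _ _).trans ?_
      linarith [h4 x]
    have h0 : 0 < |r - s| := abs_pos.2 (sub_ne_zero.2 hne)
    rwa [slope_def_module, norm_smul, norm_inv, Real.norm_eq_abs, inv_mul_le_iff₀ h0] at e2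
  · rw [hasDerivAt_iff_tendsto_slope]
    have hqlim : ∀ x, Tendsto (fun r => q r x) (𝓝[≠] s) (𝓝 (g' x - op L φ x)) := by
      intro x
      refine (hasDerivAt_iff_tendsto_slope.1 (hg.deriv x)).sub ?_
      refine tendsto_integral_filter_of_dominated_convergence (fun y => w x * (w y * ‖φ y‖))
        ?_ ?_ (hφa.2.const_mul _) (Eventually.of_forall fun y => ?_)
      · filter_upwards [nhdsWithin_le_nhds hK.kernel] with r hr
        refine AEStronglyMeasurable.mul ?_ hφa.1
        simp only [slope_def_module]
        exact (((hr.row x).cont.sub (H.kernel.row x).cont).const_smul _).aestronglyMeasurable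
      · filter_upwards [nhdsWithin_le_nhds hK.lip, self_mem_nhdsWithin] with r hr hne
        refine Eventually.of_forall fun y => ?_
        have h0 : 0 < |r - s| := abs_pos.2 (sub_ne_zero.2 hne)
        rw [norm_mul, ← mul_assoc]
        refine mul_le_mul_of_nonneg_right ?_ (norm_nonneg _)
        rw [slope_def_module, norm_smul, norm_inv, Real.norm_eq_abs, inv_mul_le_iff₀ h0]
        exact hr x y
      · exact (hasDerivAt_iff_tendsto_slope.1 (hK.deriv x y)).mul_const _
    -- Since `(1 + K_r)⁻¹ (q r) = q r - R_r (q r)`, the limit follows from pointwise convergence of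
    -- the resolvents under a common bound near `s`.
    refine Tendsto.congr' (hev.mono fun r hr => hr.2.2 x) ?_
    refine (hqlim x).sub ?_
    refine tendsto_integral_filter_of_dominated_convergence (fun y => cR * C * w x * (w y * w y))
      ?_ ?_ (hw.int.const_mul _) (Eventually.of_forall fun y => ?_)
    · filter_upwards [nhdsWithin_le_nhds hreg, hev] with r h1 h2
      exact ((h1.res_bdd.row hw x).1.mul h2.1).aestronglyMeasurable
    · filter_upwards [nhdsWithin_le_nhds hR, hev] with r h1 h2
      refine Eventually.of_forall fun y => ?_
      rw [norm_mul]
      calc _ ≤ (cR * (w x * w y)) * (C * w y) :=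
            mul_le_mul (h1 x y) (h2.2.1 y) (norm_nonneg _)
              (by have := hw.pos x; have := hw.pos y; positivity)
        _ = _ := by ring
    · exact ((hK.tendsto_res hw hdet x y).mono_left nhdsWithin_le_nhds).mul (hqlim y)

/-- The logarithmic derivative of a Fredholm determinant, in terms of the resolvent. -/
theorem DiffKer.hasDerivAt_fredholmDet (hw : IsWeight w) (hK : DiffKer w Ks L s)
    (hdet : fredholmDet (Ks s) ≠ 0) :
    HasDerivAt (fun r => fredholmDet (Ks r))
      (fredholmDet (Ks s) * ∫ x, (L x x - ∫ y, L x y * res (Ks s) y x)) s := by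
  have H := (hK.regular hw hdet).self_of_nhds
  have := FredholmTheory.hasDerivAt_fredholmDet hw hK.kernel hK.kernel' hK.lip hK.deriv
  convert this using 1
  rw [← integral_const_mul]
  congr 1; ext x
  rw [← H.rowMinor_div (hK.kernel'.row x), mul_div_cancel₀ _ hdet]

end FredholmTheory

/-! ### Fresnel integrals -/

namespace ImpenetrableAnyons

/-- Dirichlet's test for improper integrals with the weight `1 / (μ - ξ)`. -/
theorem exists_tendsto_integral_div {h : ℝ → ℂ} (hh : Continuous h) {ξ c M : ℝ} (hc : ξ < c)
    (hM : ∀ b, c ≤ b → ‖∫ μ in c..b, h μ‖ ≤ M) :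
    ∃ L, Tendsto (fun b => ∫ μ in c..b, h μ / ((μ : ℂ) - ξ)) atTop (𝓝 L) := by
  set Φ : ℝ → ℂ := fun b => ∫ μ in c..b, h μ with hΦ
  have hΦd : ∀ b, HasDerivAt Φ (h b) b := fun b =>
    intervalIntegral.integral_hasDerivAt_right (hh.intervalIntegrable _ _)
      (hh.stronglyMeasurableAtFilter _ _) hh.continuousAt
  have hΦc : Continuous Φ := continuous_iff_continuousAt.2 fun b => (hΦd b).continuousAt
  have hne : ∀ μ, c ≤ μ → ((μ : ℂ) - ξ) ≠ 0 := fun μ hμ => by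
    have : μ - ξ ≠ 0 := by linarith
    exact_mod_cast this
  have hud : ∀ μ, c ≤ μ → HasDerivAt (fun μ : ℝ => ((μ : ℂ) - ξ)⁻¹)
      (-1 / ((μ : ℂ) - ξ) ^ 2) μ := fun μ hμ => by
    exact (((hasDerivAt_id (μ : ℂ)).sub_const (ξ : ℂ)).fun_inv (hne μ hμ)).comp_ofReal
  have hcont2 : ContinuousOn (fun μ : ℝ => -1 / ((μ : ℂ) - ξ) ^ 2) (Set.Ici c) := by
    refine ContinuousOn.div continuousOn_const (Continuous.continuousOn (by fun_prop)) fun μ hμ => pow_ne_zero _ (hne μ hμ)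
  -- Integration by parts trades `1 / (μ - ξ)` for the integrable `1 / (μ - ξ)²`, because the
  -- primitive `Φ` is bounded by `M`.
  have hibp : ∀ b, c ≤ b → ∫ μ in c..b, h μ / ((μ : ℂ) - ξ) =
      Φ b * ((b : ℂ) - ξ)⁻¹ + ∫ μ in c..b, Φ μ / ((μ : ℂ) - ξ) ^ 2 := by
    intro b hb
    have := intervalIntegral.integral_mul_deriv_eq_deriv_mul (a := c) (b := b)
      (u := fun μ : ℝ => ((μ : ℂ) - ξ)⁻¹) (u' := fun μ : ℝ => -1 / ((μ : ℂ) - ξ) ^ 2)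
      (v := Φ) (v' := h) (fun μ hμ => hud μ (by rw [Set.uIcc_of_le hb] at hμ; exact hμ.1))
      (fun μ _ => hΦd μ)
      (ContinuousOn.intervalIntegrable (hcont2.mono (by
        rw [Set.uIcc_of_le hb]; exact Set.Icc_subset_Ici_self)))
      (hh.intervalIntegrable _ _)
    have h0 : Φ c = 0 := by simp [hΦ]
    rw [h0, mul_zero, sub_zero] at this
    calc _ = ∫ μ in c..b, ((μ : ℂ) - ξ)⁻¹ * h μ := by
          congr 1; ext μ; rw [div_eq_mul_inv, mul_comm]
      _ = _ := by
        rw [this, mul_comm, sub_eq_add_neg, ← intervalIntegral.integral_neg]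
        congr 2; ext μ; ring
  have hint : IntegrableOn (fun μ : ℝ => Φ μ / ((μ : ℂ) - ξ) ^ 2) (Set.Ioi c) := by
    have h1 : IntegrableOn (fun μ : ℝ => (μ + -ξ) ^ (-2 : ℝ)) (Set.Ioi c) :=
      integrableOn_add_rpow_Ioi_of_lt (by norm_num) (by linarith)
    refine (h1.const_mul M).mono' ?_ ?_
    · refine ContinuousOn.aestronglyMeasurable ?_ measurableSet_Ioi
      refine hΦc.continuousOn.div (Continuous.continuousOn (by fun_prop)) fun μ hμ => pow_ne_zero _ (hne μ (le_of_lt hμ))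
    · refine (ae_restrict_iff' measurableSet_Ioi).2 (Eventually.of_forall fun μ hμ => ?_)
      have hpos : 0 < μ - ξ := by have : c < μ := hμ; linarith
      have h2 : ‖(μ : ℂ) - ξ‖ = μ - ξ := by
        rw [← Complex.ofReal_sub, Complex.norm_real, Real.norm_of_nonneg hpos.le]
      rw [norm_div, norm_pow, h2, ← sub_eq_add_neg, Real.rpow_neg hpos.le, Real.rpow_two,
        div_eq_mul_inv]
      exact mul_le_mul_of_nonneg_right (hM μ (le_of_lt hμ)) (by positivity)
  have hlim1 : Tendsto (fun b : ℝ => Φ b * ((b : ℂ) - ξ)⁻¹) atTop (𝓝 0) := by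
    have h1 : Tendsto (fun b : ℝ => M * (b - ξ)⁻¹) atTop (𝓝 0) := by
      have : Tendsto (fun b : ℝ => b - ξ) atTop atTop := tendsto_atTop_add_const_right _ _ tendsto_id
      simpa using (tendsto_inv_atTop_zero.comp this).const_mul M
    refine squeeze_zero_norm' ?_ h1
    filter_upwards [eventually_ge_atTop c] with b hb
    have hpos : 0 < b - ξ := by linarith
    have h2 : ‖(b : ℂ) - ξ‖ = b - ξ := by
      rw [← Complex.ofReal_sub, Complex.norm_real, Real.norm_of_nonneg hpos.le]
    rw [norm_mul, norm_inv, h2]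
    exact mul_le_mul_of_nonneg_right (hM b hb) (by positivity)
  refine ⟨_, Tendsto.congr' ?_ (hlim1.add (intervalIntegral_tendsto_integral_Ioi c hint tendsto_id))⟩
  filter_upwards [eventually_ge_atTop c] with b hb
  exact (hibp b hb).symm

theorem continuous_osc (x t : ℝ) : Continuous (osc x t) := by
  unfold osc; fun_prop

theorem norm_osc (x t μ : ℝ) : ‖osc x t μ‖ = 1 := by
  have : -2 * Complex.I * t * (μ : ℂ) ^ 2 - 2 * Complex.I * x * μ =
      ((-2 * t * μ ^ 2 - 2 * x * μ : ℝ) : ℂ) * Complex.I := by push_cast; ring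
  rw [osc, this, Complex.norm_exp_ofReal_mul_I]

theorem osc_zero_neg (t μ : ℝ) : osc 0 t (-μ) = osc 0 t μ := by
  simp [osc]

theorem hasDerivAt_osc (x t μ : ℝ) :
    HasDerivAt (osc x t) (-(2 * Complex.I * ((2 * t * μ + x : ℝ) : ℂ)) * osc x t μ) μ := by
  have h1 : HasDerivAt (fun μ : ℝ => (μ : ℂ)) 1 μ := Complex.ofRealCLM.hasDerivAt
  have h2 : HasDerivAt (fun μ : ℝ => -2 * Complex.I * t * (μ : ℂ) ^ 2 - 2 * Complex.I * x * μ)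
      (-2 * Complex.I * t * (2 * (μ : ℂ) * 1) - 2 * Complex.I * x * 1) μ := by
    refine ((?_ : HasDerivAt _ _ _).const_mul _).sub (h1.const_mul _)
    simpa using h1.fun_pow 2
  refine h2.cexp.congr_deriv ?_
  rw [osc]; push_cast; ring

/-- Completion of the square. -/
theorem osc_eq (x : ℝ) {t : ℝ} (ht : t ≠ 0) (μ : ℝ) :
    osc x t μ = Complex.exp (Complex.I * x ^ 2 / (2 * t)) * osc 0 t (μ + x / (2 * t)) := by
  have ht' : (t : ℂ) ≠ 0 := by exact_mod_cast ht
  rw [osc, osc, ← Complex.exp_add]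
  congr 1
  push_cast
  field_simp
  ring

/-- Away from zero the integrand is `μ · osc 0 t μ` divided by `μ`, and `μ · osc 0 t μ` has the
bounded primitive `osc 0 t μ / (-4it)`, so Dirichlet's test applies on `[1, ∞)`. -/
theorem exists_tendsto_integral_osc_zero {t : ℝ} (ht : t ≠ 0) :
    ∃ L, Tendsto (fun b => ∫ μ in (0 : ℝ)..b, osc 0 t μ) atTop (𝓝 L) := by
  have ht' : (t : ℂ) ≠ 0 := by exact_mod_cast ht
  have hd : ∀ μ : ℝ, HasDerivAt (fun μ => osc 0 t μ / (-(4 * Complex.I * t))) (μ * osc 0 t μ) μ := by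
    intro μ
    refine ((hasDerivAt_osc 0 t μ).div_const (-(4 * Complex.I * t))).congr_deriv ?_
    rw [div_eq_iff (by simp [ht'])]
    push_cast
    ring
  have hcont : Continuous fun μ : ℝ => (μ : ℂ) * osc 0 t μ :=
    Complex.continuous_ofReal.mul (continuous_osc 0 t)
  obtain ⟨L, hL⟩ := exists_tendsto_integral_div (h := fun μ : ℝ => (μ : ℂ) * osc 0 t μ) hcont
    (ξ := 0) (c := 1) (M := 2 * ‖(-(4 * Complex.I * (t : ℂ)))‖⁻¹) zero_lt_one fun b _ => by
      rw [intervalIntegral.integral_eq_sub_of_hasDerivAt (fun μ _ => hd μ)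
        (hcont.intervalIntegrable _ _), ← sub_div, norm_div, div_eq_mul_inv]
      refine mul_le_mul_of_nonneg_right ((norm_sub_le _ _).trans ?_) (by positivity)
      rw [norm_osc, norm_osc]; norm_num
  refine ⟨(∫ μ in (0 : ℝ)..1, osc 0 t μ) + L, Tendsto.congr' ?_ (hL.const_add _)⟩
  filter_upwards [eventually_ge_atTop 1] with b hb
  have h1 : ∫ μ in (1 : ℝ)..b, (μ : ℂ) * osc 0 t μ / ((μ : ℂ) - (0 : ℝ)) =
      ∫ μ in (1 : ℝ)..b, osc 0 t μ := by
    refine intervalIntegral.integral_congr fun μ hμ => ?_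
    rw [Set.uIcc_of_le hb] at hμ
    have : (μ : ℂ) ≠ 0 := by
      have : μ ≠ 0 := by linarith [hμ.1]
      exact_mod_cast this
    simp only [Complex.ofReal_zero, sub_zero]
    field_simp
  rw [h1]
  exact intervalIntegral.integral_add_adjacent_intervals
    ((continuous_osc 0 t).intervalIntegrable _ _) ((continuous_osc 0 t).intervalIntegrable _ _)

theorem integral_osc_zero_neg (t b : ℝ) :
    ∫ μ in (-b)..(0 : ℝ), osc 0 t μ = ∫ μ in (0 : ℝ)..b, osc 0 t μ := by
  have := intervalIntegral.integral_comp_neg (a := 0) (b := b) (fun μ => osc 0 t μ)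
  simp_rw [osc_zero_neg, neg_zero] at this
  exact this.symm

theorem tendsto_integral_osc_zero {t : ℝ} (ht : t ≠ 0) :
    Tendsto (fun p : ℝ × ℝ => ∫ μ in p.1..p.2, osc 0 t μ) (atBot ×ˢ atTop) (𝓝 (G 0 t)) := by
  obtain ⟨L, hL⟩ := exists_tendsto_integral_osc_zero ht
  have h1 : Tendsto (fun a => ∫ μ in a..(0 : ℝ), osc 0 t μ) atBot (𝓝 L) := by
    refine (hL.comp tendsto_neg_atBot_atTop).congr fun a => ?_
    simp only [Function.comp]
    rw [← integral_osc_zero_neg, neg_neg]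
  have h2 : Tendsto (fun p : ℝ × ℝ => ∫ μ in p.1..p.2, osc 0 t μ) (atBot ×ˢ atTop) (𝓝 (L + L)) := by
    refine ((h1.comp tendsto_fst).add (hL.comp tendsto_snd)).congr fun p => ?_
    exact intervalIntegral.integral_add_adjacent_intervals
      ((continuous_osc 0 t).intervalIntegrable _ _) ((continuous_osc 0 t).intervalIntegrable _ _)
  rwa [G, improperIntegral, h2.limUnder_eq]

theorem integral_osc_eq (x : ℝ) {t : ℝ} (ht : t ≠ 0) (a b : ℝ) :
    ∫ μ in a..b, osc x t μ = Complex.exp (Complex.I * x ^ 2 / (2 * t)) *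
      ∫ μ in (a + x / (2 * t))..(b + x / (2 * t)), osc 0 t μ := by
  rw [← intervalIntegral.integral_comp_add_right, ← intervalIntegral.integral_const_mul]
  congr 1; ext μ; exact osc_eq x ht μ

theorem tendsto_integral_osc_aux (x : ℝ) {t : ℝ} (ht : t ≠ 0) :
    Tendsto (fun p : ℝ × ℝ => ∫ μ in p.1..p.2, osc x t μ) (atBot ×ˢ atTop)
      (𝓝 (Complex.exp (Complex.I * x ^ 2 / (2 * t)) * G 0 t)) := by
  simp_rw [integral_osc_eq x ht]
  refine Tendsto.const_mul _ ?_
  have h : Tendsto (fun p : ℝ × ℝ => (p.1 + x / (2 * t), p.2 + x / (2 * t))) (atBot ×ˢ atTop)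
      (atBot ×ˢ atTop) :=
    (tendsto_atBot_add_const_right _ _ tendsto_fst).prodMk
      (tendsto_atTop_add_const_right _ _ tendsto_snd)
  have := (tendsto_integral_osc_zero ht).comp h
  exact this

/-- Completing the square translates the interval of integration; as the endpoints tend to infinity
independently, the translation is harmless. -/
theorem G_eq (x : ℝ) {t : ℝ} (ht : t ≠ 0) :
    G x t = Complex.exp (Complex.I * x ^ 2 / (2 * t)) * G 0 t :=
  (tendsto_integral_osc_aux x ht).limUnder_eq

theorem tendsto_integral_osc (x : ℝ) {t : ℝ} (ht : t ≠ 0) :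
    Tendsto (fun p : ℝ × ℝ => ∫ μ in p.1..p.2, osc x t μ) (atBot ×ˢ atTop) (𝓝 (G x t)) := by
  rw [G_eq x ht]
  exact tendsto_integral_osc_aux x ht

/-- The Fresnel integrals over bounded intervals are uniformly bounded, also in `x`. -/
theorem exists_norm_integral_osc_le {t : ℝ} (ht : t ≠ 0) :
    ∃ M, ∀ x a b : ℝ, ‖∫ μ in a..b, osc x t μ‖ ≤ M := by
  obtain ⟨L, hL⟩ := exists_tendsto_integral_osc_zero ht
  obtain ⟨R, hR⟩ := eventually_atTop.1 (hL.norm.eventually_le_const (lt_add_one ‖L‖))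
  have h0 : ∀ b, 0 ≤ b → ‖∫ μ in (0 : ℝ)..b, osc 0 t μ‖ ≤ ‖L‖ + 1 + |R| := by
    intro b hb
    rcases le_total R b with h | h
    · linarith [hR b h, abs_nonneg R]
    · have := intervalIntegral.norm_integral_le_of_norm_le_const (a := 0) (b := b) (C := 1)
        (f := osc 0 t) fun μ _ => (norm_osc 0 t μ).le
      rw [sub_zero, abs_of_nonneg hb, one_mul] at this
      linarith [norm_nonneg L, le_abs_self R]
  have h1 : ∀ b, ‖∫ μ in (0 : ℝ)..b, osc 0 t μ‖ ≤ ‖L‖ + 1 + |R| := by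
    intro b
    rcases le_total 0 b with h | h
    · exact h0 b h
    · rw [intervalIntegral.integral_symm, norm_neg, ← neg_neg b, integral_osc_zero_neg]
      exact h0 _ (neg_nonneg.2 h)
  refine ⟨2 * (‖L‖ + 1 + |R|), fun x a b => ?_⟩
  have hexp : ‖Complex.exp (Complex.I * x ^ 2 / (2 * t))‖ = 1 := by
    have : Complex.I * x ^ 2 / (2 * t) = ((x ^ 2 / (2 * t) : ℝ) : ℂ) * Complex.I := by
      push_cast; ring
    rw [this, Complex.norm_exp_ofReal_mul_I]
  rw [integral_osc_eq x ht, norm_mul, hexp, one_mul,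
    ← intervalIntegral.integral_interval_sub_left (a := 0)
      ((continuous_osc 0 t).intervalIntegrable _ _) ((continuous_osc 0 t).intervalIntegrable _ _)]
  refine (norm_sub_le _ _).trans ?_
  linarith [h1 (b + x / (2 * t)), h1 (a + x / (2 * t))]

/-- The entire function `∫_0^1 e^{2izv²} dv`, restricted to the real line. -/
noncomputable def fresnelH (z : ℝ) : ℂ := ∫ v in (0 : ℝ)..1, Complex.exp (2 * Complex.I * z * v ^ 2)

theorem exists_tendsto_integral_osc_div (x ξ ε : ℝ) {t : ℝ} (ht : t ≠ 0) (hε : 0 < ε) :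
    ∃ L, Tendsto (fun b => ∫ μ in (ξ + ε)..b, osc x t μ / ((μ : ℂ) - ξ)) atTop (𝓝 L) := by
  obtain ⟨M, hM⟩ := exists_norm_integral_osc_le ht
  exact exists_tendsto_integral_div (continuous_osc x t) (by linarith) fun b _ => hM x _ _

theorem exists_tendsto_integral_osc_div' (x ξ ε : ℝ) {t : ℝ} (ht : t ≠ 0) (hε : 0 < ε) :
    ∃ L, Tendsto (fun a => ∫ μ in a..(ξ - ε), osc x t μ / ((μ : ℂ) - ξ)) atBot (𝓝 L) := by
  obtain ⟨L, hL⟩ := exists_tendsto_integral_osc_div (-x) (-ξ) ε ht hε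
  refine ⟨-L, (hL.neg.comp tendsto_neg_atBot_atTop).congr fun a => ?_⟩
  have := intervalIntegral.integral_comp_neg (a := -ξ + ε) (b := -a)
    (fun μ : ℝ => osc x t μ / ((μ : ℂ) - ξ))
  rw [neg_neg, neg_add, neg_neg, ← sub_eq_add_neg] at this
  rw [← this]
  simp only [Function.comp]
  rw [← intervalIntegral.integral_neg]
  congr 1; ext μ
  have h1 : osc (-x) t μ = osc x t (-μ) := by
    rw [osc, osc]; congr 1; push_cast; ring
  rw [h1, ← div_neg]
  congr 1; push_cast; ring

end ImpenetrableAnyons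

/-! ### The closed form of the principal value -/

namespace ImpenetrableAnyons

/-- The truncated integrand of the principal value. -/
noncomputable def pvIntegrand (x t ξ ε μ : ℝ) : ℂ :=
  if ε < |μ - ξ| then osc x t μ / ((μ : ℂ) - (ξ : ℂ)) else 0

theorem intervalIntegrable_pvIntegrand (x t ξ : ℝ) {ε : ℝ} (hε : 0 < ε) (a b : ℝ) :
    IntervalIntegrable (pvIntegrand x t ξ ε) volume a b := by
  rw [intervalIntegrable_iff]
  refine Measure.integrableOn_of_bounded (M := ε⁻¹) (by simp [Set.uIoc]) ?_ ?_
  · refine (Measurable.ite ?_ ?_ measurable_const).aestronglyMeasurable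
    · exact measurableSet_lt measurable_const (by fun_prop)
    · exact (continuous_osc x t).measurable.div (by fun_prop)
  · refine Eventually.of_forall fun μ => ?_
    rw [pvIntegrand]
    split_ifs with h
    · rw [norm_div, norm_osc, ← Complex.ofReal_sub, Complex.norm_real, Real.norm_eq_abs, one_div]
      exact inv_anti₀ hε h.le
    · simpa using hε.le

theorem integral_pvIntegrand_right (x t ξ : ℝ) {ε b : ℝ} (hε : 0 < ε) (hb : ξ + ε ≤ b) :
    ∫ μ in (ξ + ε)..b, pvIntegrand x t ξ ε μ = ∫ μ in (ξ + ε)..b, osc x t μ / ((μ : ℂ) - ξ) := by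
  refine intervalIntegral.integral_congr_Ioo_of_le hb fun μ hμ => ?_
  have : ε < |μ - ξ| := by
    rw [abs_of_pos] <;> linarith [hμ.1]
  simp only [pvIntegrand, this, if_true]

theorem integral_pvIntegrand_left (x t ξ : ℝ) {ε a : ℝ} (hε : 0 < ε) (ha : a ≤ ξ - ε) :
    ∫ μ in a..(ξ - ε), pvIntegrand x t ξ ε μ = ∫ μ in a..(ξ - ε), osc x t μ / ((μ : ℂ) - ξ) := by
  refine intervalIntegral.integral_congr_Ioo_of_le ha fun μ hμ => ?_
  have : ε < |μ - ξ| := by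
    rw [abs_of_neg] <;> linarith [hμ.2]
  simp only [pvIntegrand, this, if_true]

theorem integral_pvIntegrand_mid (x t ξ : ℝ) {ε : ℝ} (hε : 0 < ε) :
    ∫ μ in (ξ - ε)..(ξ + ε), pvIntegrand x t ξ ε μ = 0 := by
  rw [← intervalIntegral.integral_zero (a := ξ - ε) (b := ξ + ε) (μ := volume)]
  refine intervalIntegral.integral_congr_Ioo_of_le (by linarith) fun μ hμ => ?_
  have : ¬ε < |μ - ξ| := by
    rw [not_lt, abs_le]
    constructor <;> linarith [hμ.1, hμ.2]
  simp only [pvIntegrand, this, if_false]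

theorem integral_pvIntegrand_split (x t ξ : ℝ) {ε a b : ℝ} (hε : 0 < ε) (ha : a ≤ ξ - ε)
    (hb : ξ + ε ≤ b) : ∫ μ in a..b, pvIntegrand x t ξ ε μ =
      (∫ μ in a..(ξ - ε), osc x t μ / ((μ : ℂ) - ξ)) +
        ∫ μ in (ξ + ε)..b, osc x t μ / ((μ : ℂ) - ξ) := by
  have hi := intervalIntegrable_pvIntegrand x t ξ hε
  rw [← integral_pvIntegrand_left x t ξ hε ha, ← integral_pvIntegrand_right x t ξ hε hb,
    ← intervalIntegral.integral_add_adjacent_intervals (hi a (ξ - ε)) (hi _ b),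
    ← intervalIntegral.integral_add_adjacent_intervals (hi (ξ - ε) (ξ + ε)) (hi _ b),
    integral_pvIntegrand_mid x t ξ hε, zero_add]

theorem exists_tendsto_integral_pvIntegrand (x ξ : ℝ) {t ε : ℝ} (ht : t ≠ 0) (hε : 0 < ε) :
    ∃ L, Tendsto (fun p : ℝ × ℝ => ∫ μ in p.1..p.2, pvIntegrand x t ξ ε μ) (atBot ×ˢ atTop)
      (𝓝 L) := by
  obtain ⟨L1, h1⟩ := exists_tendsto_integral_osc_div x ξ ε ht hε
  obtain ⟨L2, h2⟩ := exists_tendsto_integral_osc_div' x ξ ε ht hε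
  refine ⟨L2 + L1, Tendsto.congr' ?_ ((h2.comp tendsto_fst).add (h1.comp tendsto_snd))⟩
  filter_upwards [(eventually_le_atBot (ξ - ε)).prod_mk (eventually_ge_atTop (ξ + ε))]
    with p hp
  exact (integral_pvIntegrand_split x t ξ hε hp.1 hp.2).symm

/-- The symmetrised integrand of the principal value, continuous at `0`. -/
noncomputable def pvSymm (x t ξ s : ℝ) : ℂ :=
  ∫ v in (0 : ℝ)..1, -4 * Complex.I * ((2 * t * ξ + x : ℝ) : ℂ) * osc x t ξ *
    (osc 0 t s * Complex.cos (2 * ((2 * t * ξ + x : ℝ) : ℂ) * v * s))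

theorem osc_add (x t ξ s : ℝ) : osc x t (ξ + s) = osc x t ξ * osc 0 t s *
    Complex.exp (-(2 * ((2 * t * ξ + x : ℝ) : ℂ) * s * Complex.I)) := by
  rw [osc, osc, osc, ← Complex.exp_add, ← Complex.exp_add]
  congr 1; push_cast; ring

/-- The difference of the two values is a multiple of `sin (2 y s)`, and `sin (2 y s) / s = ∫₀¹ 2 y
cos (2 y v s) dv` removes the singularity at `s = 0`. -/
theorem pvSymm_eq (x t ξ : ℝ) {s : ℝ} (hs : s ≠ 0) :
    pvSymm x t ξ s = (osc x t (ξ + s) - osc x t (ξ - s)) / s := by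
  have hs' : (s : ℂ) ≠ 0 := by exact_mod_cast hs
  set y : ℂ := ((2 * t * ξ + x : ℝ) : ℂ) with hy
  have hsin : ∫ v in (0 : ℝ)..1, Complex.cos (2 * y * v * s) * (2 * y * s) =
      Complex.sin (2 * y * s) := by
    have hd : ∀ v : ℝ, HasDerivAt (fun v : ℝ => Complex.sin (2 * y * v * s))
        (Complex.cos (2 * y * v * s) * (2 * y * s)) v := fun v => by
      have h1 : HasDerivAt (fun v : ℂ => 2 * y * v * s) (2 * y * s) (v : ℂ) := by
        simpa using ((hasDerivAt_id (v : ℂ)).const_mul (2 * y)).mul_const (s : ℂ)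
      exact h1.csin.comp_ofReal
    rw [intervalIntegral.integral_eq_sub_of_hasDerivAt (fun v _ => hd v)
      (Continuous.intervalIntegrable (by fun_prop) _ _)]
    simp
  have h1 : pvSymm x t ξ s = -2 * Complex.I * osc x t ξ * osc 0 t s / s *
      ∫ v in (0 : ℝ)..1, Complex.cos (2 * y * v * s) * (2 * y * s) := by
    rw [pvSymm, ← intervalIntegral.integral_const_mul]
    congr 1; ext v
    rw [← hy]
    field_simp
    ring
  rw [h1, hsin, sub_eq_add_neg ξ s, osc_add, osc_add, osc_zero_neg, ← hy, Complex.sin]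
  have e1 : -(2 * y * ((-s : ℝ) : ℂ) * Complex.I) = 2 * y * s * Complex.I := by push_cast; ring
  have e2 : -(2 * y * (s : ℂ) * Complex.I) = -(2 * y * s) * Complex.I := by ring
  rw [e1, e2]
  linear_combination (-(osc x t ξ * osc 0 t s / s) *
    (Complex.exp (-(2 * y * s) * Complex.I) - Complex.exp (2 * y * s * Complex.I))) * Complex.I_sq

theorem continuous_pvSymm_aux (x t ξ : ℝ) : Continuous fun q : ℝ × ℝ =>
    -4 * Complex.I * ((2 * t * ξ + x : ℝ) : ℂ) * osc x t ξ *
      (osc 0 t q.1 * Complex.cos (2 * ((2 * t * ξ + x : ℝ) : ℂ) * q.2 * q.1)) := by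
  have := (continuous_osc 0 t).comp' (continuous_fst (X := ℝ) (Y := ℝ))
  fun_prop

theorem continuous_pvSymm (x t ξ : ℝ) : Continuous (pvSymm x t ξ) :=
  intervalIntegral.continuous_parametric_intervalIntegral_of_continuous'
    (continuous_pvSymm_aux x t ξ) 0 1

theorem integral_pvSymm_eq (x t ξ : ℝ) {ε R : ℝ} (hε : 0 < ε) (hR : ε ≤ R) :
    ∫ s in ε..R, pvSymm x t ξ s = (∫ μ in (ξ - R)..(ξ - ε), osc x t μ / ((μ : ℂ) - ξ)) +
      ∫ μ in (ξ + ε)..(ξ + R), osc x t μ / ((μ : ℂ) - ξ) := by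
  rw [← intervalIntegral.integral_comp_add_left (fun μ : ℝ => osc x t μ / ((μ : ℂ) - ξ)),
    ← intervalIntegral.integral_comp_sub_left (fun μ : ℝ => osc x t μ / ((μ : ℂ) - ξ)),
    ← intervalIntegral.integral_add]
  · refine intervalIntegral.integral_congr fun s hs => ?_
    rw [Set.uIcc_of_le hR] at hs
    have hs0 : s ≠ 0 := by linarith [hs.1]
    have hs' : (s : ℂ) ≠ 0 := by exact_mod_cast hs0
    simp only [pvSymm_eq x t ξ hs0]
    push_cast
    rw [show (ξ : ℂ) - s - ξ = -s by ring, show (ξ : ℂ) + s - ξ = s by ring]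
    field_simp
    ring
  · refine ContinuousOn.intervalIntegrable ?_
    rw [Set.uIcc_of_le hR]
    refine ContinuousOn.div ((continuous_osc x t).comp' (by fun_prop)).continuousOn
      (by fun_prop) fun s hs => ?_
    have : s ≠ 0 := by linarith [hs.1]
    have hs' : (s : ℂ) ≠ 0 := by exact_mod_cast this
    push_cast
    rw [show (ξ : ℂ) - s - ξ = -s by ring]
    exact neg_ne_zero.2 hs'
  · refine ContinuousOn.intervalIntegrable ?_
    rw [Set.uIcc_of_le hR]
    refine ContinuousOn.div ((continuous_osc x t).comp' (by fun_prop)).continuousOn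
      (by fun_prop) fun s hs => ?_
    have : s ≠ 0 := by linarith [hs.1]
    have hs' : (s : ℂ) ≠ 0 := by exact_mod_cast this
    push_cast
    rw [show (ξ : ℂ) + s - ξ = s by ring]
    exact hs'

/-- The cosine is the even part of `e^{-2iyvs}`, so the integral over half of the symmetric interval
becomes a Fresnel integral with `y v` in the role of `x`. -/
theorem integral_osc_zero_mul_cos (t y v R : ℝ) :
    ∫ s in (0 : ℝ)..R, osc 0 t s * Complex.cos (2 * y * v * s) =
      1 / 2 * ∫ s in (-R)..R, osc (y * v) t s := by
  have hi : ∀ a b, IntervalIntegrable (osc (y * v) t) volume a b := fun a b =>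
    (continuous_osc _ _).intervalIntegrable _ _
  have hneg := intervalIntegral.integral_comp_neg (a := 0) (b := R) (osc (y * v) t)
  rw [neg_zero] at hneg
  rw [← intervalIntegral.integral_add_adjacent_intervals (hi (-R) 0) (hi 0 R), ← hneg,
    ← intervalIntegral.integral_add (((continuous_osc _ _).comp'
      continuous_neg).intervalIntegrable _ _) (hi _ _), ← intervalIntegral.integral_const_mul]
  congr 1; ext s
  have h := osc_add (y * v) t 0 s
  have h' := osc_add (y * v) t 0 (-s)
  rw [zero_add] at h h'
  have h0 : osc (y * v) t 0 = 1 := by simp [osc]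
  rw [h, h', osc_zero_neg, h0, Complex.cos]
  have e1 : -(2 * ((2 * t * 0 + y * v : ℝ) : ℂ) * ((-s : ℝ) : ℂ) * Complex.I) =
    2 * y * v * s * Complex.I := by push_cast; ring
  have e2 : -(2 * ((2 * t * 0 + y * v : ℝ) : ℂ) * (s : ℂ) * Complex.I) =
    -(2 * y * v * s) * Complex.I := by push_cast; ring
  rw [e1, e2]
  ring

/-- The closed form of the principal value. -/
noncomputable def pvClosed (x t ξ : ℝ) : ℂ :=
  -2 * Complex.I * G 0 t * osc x t ξ * ((2 * t * ξ + x : ℝ) : ℂ) *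
    fresnelH ((2 * t * ξ + x) ^ 2 / (4 * t))

/-- After an exchange of the integrals the inner ones tend to `G (y v) t`, dominated by a bound for
Fresnel integrals that is uniform in `x`. Completing the square there leaves `∫₀¹ e^{i y² v² / (2t)}
dv`, which is `fresnelH` at `y² / (4t)`. -/
theorem tendsto_integral_pvSymm (x ξ : ℝ) {t : ℝ} (ht : t ≠ 0) :
    Tendsto (fun R => ∫ s in (0 : ℝ)..R, pvSymm x t ξ s) atTop (𝓝 (pvClosed x t ξ)) := by
  obtain ⟨M, hM⟩ := exists_norm_integral_osc_le ht
  have ht' : (t : ℂ) ≠ 0 := by exact_mod_cast ht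
  set y : ℝ := 2 * t * ξ + x with hy
  have hswap : ∀ R, ∫ s in (0 : ℝ)..R, pvSymm x t ξ s = ∫ v in (0 : ℝ)..1,
      -4 * Complex.I * (y : ℂ) * osc x t ξ * (1 / 2 * ∫ s in (-R)..R, osc (y * v) t s) := by
    intro R
    simp only [pvSymm]
    rw [intervalIntegral_intervalIntegral_swap]
    · congr 1; ext v
      rw [intervalIntegral.integral_const_mul, ← hy, integral_osc_zero_mul_cos]
    · exact ((continuous_pvSymm_aux x t ξ).continuousOn.integrableOn_compact (μ := volume)
        ((isCompact_uIcc (a := (0 : ℝ)) (b := R)).prod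
          (isCompact_uIcc (a := (0 : ℝ)) (b := 1)))).mono_set
        (Set.prod_mono Set.uIoc_subset_uIcc Set.uIoc_subset_uIcc)
  simp_rw [hswap]
  have hlim : pvClosed x t ξ = ∫ v in (0 : ℝ)..1,
      -4 * Complex.I * (y : ℂ) * osc x t ξ * (1 / 2 * G (y * v) t) := by
    rw [pvClosed, fresnelH, ← intervalIntegral.integral_const_mul]
    congr 1; ext v
    rw [G_eq (y * v) ht]
    have : 2 * Complex.I * ((y ^ 2 / (4 * t) : ℝ) : ℂ) * (v : ℂ) ^ 2 =
        Complex.I * ((y * v : ℝ) : ℂ) ^ 2 / (2 * t) := by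
      push_cast; field_simp; ring
    rw [← hy, this]
    ring
  rw [hlim]
  have hR : Tendsto (fun R : ℝ => (-R, R)) atTop (atBot ×ˢ atTop) :=
    tendsto_neg_atTop_atBot.prodMk tendsto_id
  refine intervalIntegral.tendsto_integral_filter_of_dominated_convergence
    (fun _ => ‖-4 * Complex.I * (y : ℂ) * osc x t ξ‖ * (1 / 2 * M)) ?_ ?_
    intervalIntegrable_const ?_
  · refine Eventually.of_forall fun R => Continuous.aestronglyMeasurable ?_
    refine continuous_const.mul (continuous_const.mul ?_)
    refine intervalIntegral.continuous_parametric_intervalIntegral_of_continuous' ?_ _ _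
    unfold Function.uncurry osc
    fun_prop
  · refine Eventually.of_forall fun R => Eventually.of_forall fun v _ => ?_
    rw [norm_mul, norm_mul (1 / 2 : ℂ)]
    have : ‖(1 / 2 : ℂ)‖ = 1 / 2 := by norm_num
    rw [this]
    gcongr
    exact hM _ _ _
  · refine Eventually.of_forall fun v _ => ?_
    exact (((tendsto_integral_osc (y * v) ht).comp hR).const_mul _).const_mul _

/-- The truncated integral converges with independent endpoints, so it may be computed over
intervals symmetric about `ξ`, where it is the integral of `pvSymm` over `[ε, R]`. By continuity of
`pvSymm` the missing part over `[0, ε]` disappears as `ε → 0`. -/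
theorem principalValue_osc (x ξ : ℝ) {t : ℝ} (ht : t ≠ 0) :
    principalValue (osc x t) ξ = pvClosed x t ξ := by
  have hi : ∀ a b, IntervalIntegrable (pvSymm x t ξ) volume a b := fun a b =>
    (continuous_pvSymm x t ξ).intervalIntegrable _ _
  have hε : ∀ ε, 0 < ε → improperIntegral (pvIntegrand x t ξ ε) =
      pvClosed x t ξ - ∫ s in (0 : ℝ)..ε, pvSymm x t ξ s := by
    intro ε hε
    obtain ⟨L, hL⟩ := exists_tendsto_integral_pvIntegrand x ξ ht hε
    have hR : Tendsto (fun R : ℝ => (ξ - R, ξ + R)) atTop (atBot ×ˢ atTop) :=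
      ((tendsto_neg_atTop_atBot.comp tendsto_id |> tendsto_atBot_add_const_left _ ξ).congr
        fun R => by simp [sub_eq_add_neg]).prodMk (tendsto_atTop_add_const_left _ _ tendsto_id)
    rw [improperIntegral, hL.limUnder_eq]
    refine tendsto_nhds_unique (hL.comp hR) ?_
    refine Tendsto.congr' ?_ ((tendsto_integral_pvSymm x ξ ht).sub_const _)
    filter_upwards [eventually_ge_atTop ε] with R hR
    simp only [Function.comp]
    rw [integral_pvIntegrand_split x t ξ hε (by linarith) (by linarith),
      ← integral_pvSymm_eq x t ξ hε hR, intervalIntegral.integral_interval_sub_left (hi _ _) (hi _ _)]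
  have h0 : Tendsto (fun ε => pvClosed x t ξ - ∫ s in (0 : ℝ)..ε, pvSymm x t ξ s) (𝓝[>] 0)
      (𝓝 (pvClosed x t ξ)) := by
    have : Continuous fun ε => ∫ s in (0 : ℝ)..ε, pvSymm x t ξ s :=
      intervalIntegral.continuous_primitive hi 0
    have h1 := ((this.tendsto 0).const_sub (pvClosed x t ξ)).mono_left
      (nhdsWithin_le_nhds (s := Set.Ioi (0 : ℝ)))
    simpa using h1
  refine Tendsto.limUnder_eq (Tendsto.congr' ?_ h0)
  filter_upwards [self_mem_nhdsWithin] with ε h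
  exact (hε ε h).symm

end ImpenetrableAnyons

/-! ### The linear system satisfied by e₊ and e₋ -/

namespace ImpenetrableAnyons

/-- Rescaling the variable gives the dependence on `t` without evaluating the Fresnel integral; the
sign condition keeps `t` and `t₀` on the same side of zero. -/
theorem G_zero_scale {t t₀ : ℝ} (ht₀ : t₀ ≠ 0) (h : 0 < t / t₀) :
    G 0 t = ((Real.sqrt (t / t₀))⁻¹ : ℝ) * G 0 t₀ := by
  set k := Real.sqrt (t / t₀) with hk
  have hk0 : 0 < k := Real.sqrt_pos.2 h
  have hk2 : t₀ * k ^ 2 = t := by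
    rw [hk, Real.sq_sqrt h.le]; field_simp
  have hosc : ∀ s, osc 0 t s = osc 0 t₀ (k * s) := fun s => by
    rw [osc, osc, ← hk2]; congr 1; push_cast; ring
  have hint : ∀ p : ℝ × ℝ, ∫ μ in p.1..p.2, osc 0 t μ =
      ((k⁻¹ : ℝ) : ℂ) * ∫ μ in (k * p.1)..(k * p.2), osc 0 t₀ μ := fun p => by
    simp_rw [hosc]
    rw [intervalIntegral.integral_comp_mul_left _ hk0.ne', Complex.real_smul]
  have hlim : Tendsto (fun p : ℝ × ℝ => (k * p.1, k * p.2)) (atBot ×ˢ atTop) (atBot ×ˢ atTop) :=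
    (tendsto_fst.const_mul_atBot hk0).prodMk (tendsto_snd.const_mul_atTop hk0)
  have h1 := ((tendsto_integral_osc_zero ht₀).comp hlim).const_mul ((k⁻¹ : ℝ) : ℂ)
  rw [G, improperIntegral]
  refine Tendsto.limUnder_eq (h1.congr fun p => ?_)
  exact (hint p).symm

theorem hasDerivAt_G_zero {t : ℝ} (ht : t ≠ 0) :
    HasDerivAt (fun t => G 0 t) (-G 0 t / (2 * t)) t := by
  have hpos : ∀ᶠ r in 𝓝 t, 0 < r / t := by
    have : Tendsto (fun r => r / t) (𝓝 t) (𝓝 (t / t)) := by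
      have : Continuous fun r => r / t := by fun_prop
      exact this.tendsto t
    rw [div_self ht] at this
    exact this.eventually_const_lt zero_lt_one
  have h1 : HasDerivAt (fun r : ℝ => (Real.sqrt (r / t))⁻¹) (-1 / (2 * t)) t := by
    have h2 : HasDerivAt (fun r : ℝ => r / t) (1 / t) t := (hasDerivAt_id t).div_const t
    have h3 := (h2.sqrt (by rw [div_self ht]; exact one_ne_zero)).fun_inv
      (by rw [div_self ht]; simp)
    refine h3.congr_deriv ?_
    rw [div_self ht]
    simp
    field_simp
  have h2 := (h1.ofReal_comp.mul_const (G 0 t)).congr_of_eventuallyEq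
    (hpos.mono fun r hr => G_zero_scale ht hr)
  refine h2.congr_deriv ?_
  push_cast
  ring

/-- The derivative of `fresnelH`. -/
noncomputable def fresnelH' (z : ℝ) : ℂ :=
  ∫ v in (0 : ℝ)..1, 2 * Complex.I * v ^ 2 * Complex.exp (2 * Complex.I * z * v ^ 2)

theorem norm_exp_two_I (z v : ℝ) : ‖Complex.exp (2 * Complex.I * z * v ^ 2)‖ = 1 := by
  have : 2 * Complex.I * z * (v : ℂ) ^ 2 = ((2 * z * v ^ 2 : ℝ) : ℂ) * Complex.I := by
    push_cast; ring
  rw [this, Complex.norm_exp_ofReal_mul_I]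

theorem norm_fresnelH_le (z : ℝ) : ‖fresnelH z‖ ≤ 1 := by
  have := intervalIntegral.norm_integral_le_of_norm_le_const (a := 0) (b := 1) (C := 1)
    (f := fun v : ℝ => Complex.exp (2 * Complex.I * z * v ^ 2))
    fun v _ => (norm_exp_two_I z v).le
  rw [fresnelH]
  simpa using this

theorem hasDerivAt_fresnelH (z : ℝ) : HasDerivAt fresnelH (fresnelH' z) z := by
  have := (intervalIntegral.hasDerivAt_integral_of_dominated_loc_of_deriv_le (μ := volume)
    (F := fun (z v : ℝ) => Complex.exp (2 * Complex.I * z * v ^ 2))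
    (F' := fun (z v : ℝ) => 2 * Complex.I * v ^ 2 * Complex.exp (2 * Complex.I * z * v ^ 2))
    (a := 0) (b := 1) (x₀ := z) (s := Set.univ) (bound := fun _ => 2) univ_mem
    (Eventually.of_forall fun z => Continuous.aestronglyMeasurable (by fun_prop))
    (Continuous.intervalIntegrable (by fun_prop) _ _)
    (Continuous.aestronglyMeasurable (by fun_prop)) (Eventually.of_forall fun v hv z _ => ?_)
    intervalIntegrable_const (Eventually.of_forall fun v hv z _ => ?_)).2
  · exact this
  · rw [norm_mul, norm_exp_two_I, mul_one]
    rw [Set.uIoc_of_le zero_le_one] at hv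
    have : ‖2 * Complex.I * (v : ℂ) ^ 2‖ = 2 * v ^ 2 := by
      simp
    rw [this]
    nlinarith [hv.1, hv.2]
  · have h1 : HasDerivAt (fun z : ℂ => 2 * Complex.I * z * (v : ℂ) ^ 2)
        (2 * Complex.I * (v : ℂ) ^ 2) (z : ℂ) := by
      simpa using ((hasDerivAt_id (z : ℂ)).const_mul (2 * Complex.I)).mul_const ((v : ℂ) ^ 2)
    exact h1.cexp.comp_ofReal.congr_deriv (by ring)

/-- The `v`-derivative of `v e^{2izv²}` is integrated over `[0, 1]`. -/
theorem fresnelH_ode (z : ℝ) :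
    2 * z * fresnelH' z = Complex.exp (2 * Complex.I * z) - fresnelH z := by
  have hd : ∀ v : ℝ, HasDerivAt (fun v : ℝ => (v : ℂ) * Complex.exp (2 * Complex.I * z * v ^ 2))
      (Complex.exp (2 * Complex.I * z * v ^ 2) +
        2 * z * (2 * Complex.I * v ^ 2 * Complex.exp (2 * Complex.I * z * v ^ 2))) v := fun v => by
    have h1 : HasDerivAt (fun v : ℂ => 2 * Complex.I * z * v ^ 2)
        (2 * Complex.I * z * (2 * v)) (v : ℂ) := by
      simpa using ((hasDerivAt_id (v : ℂ)).fun_pow 2).const_mul (2 * Complex.I * z)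
    have h2 := ((hasDerivAt_id (v : ℂ)).fun_mul h1.cexp).comp_ofReal
    refine h2.congr_deriv ?_
    simp only [id]
    ring
  have := intervalIntegral.integral_eq_sub_of_hasDerivAt (a := 0) (b := 1) (fun v _ => hd v)
    (Continuous.intervalIntegrable (by fun_prop) _ _)
  rw [intervalIntegral.integral_add (Continuous.intervalIntegrable (by fun_prop) _ _)
    (Continuous.intervalIntegrable (by fun_prop) _ _), intervalIntegral.integral_const_mul] at this
  rw [fresnelH', fresnelH, eq_sub_iff_add_eq, add_comm, this]
  simp

/-- Half of the hole weight: the logarithmic derivative of `√ϑ` in `β`. -/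
noncomputable def hole (β ξ : ℝ) : ℝ := (1 - fermiWeight β ξ) / 2

theorem fermiWeight_pos (β ξ : ℝ) : 0 < fermiWeight β ξ := by
  rw [fermiWeight]; positivity

theorem fermiWeight_le_one (β ξ : ℝ) : fermiWeight β ξ ≤ 1 := by
  rw [fermiWeight, div_le_one (by positivity)]
  linarith [Real.exp_pos (ξ ^ 2 - β)]

theorem abs_hole_le (β ξ : ℝ) : |hole β ξ| ≤ 1 := by
  rw [hole, abs_le]
  constructor <;> linarith [fermiWeight_pos β ξ, fermiWeight_le_one β ξ]

section Curves

variable {X T Bt Z : ℝ → ℝ} {x' t' β' ξ' r : ℝ}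

theorem hasDerivAt_sqrt_fermiWeight (hB : HasDerivAt Bt β' r) (hZ : HasDerivAt Z ξ' r) :
    HasDerivAt (fun r => Real.sqrt (fermiWeight (Bt r) (Z r)))
      ((β' - 2 * Z r * ξ') * hole (Bt r) (Z r) * Real.sqrt (fermiWeight (Bt r) (Z r))) r := by
  have h1 : HasDerivAt (fun r => fermiWeight (Bt r) (Z r))
      ((β' - 2 * Z r * ξ') * (fermiWeight (Bt r) (Z r) * (1 - fermiWeight (Bt r) (Z r)))) r := by
    have h2 := ((((hZ.fun_pow 2).fun_sub hB).exp.const_add 1).fun_inv (by positivity))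
    have h3 : (fun r => fermiWeight (Bt r) (Z r)) =
        fun r => (1 + Real.exp (Z r ^ 2 - Bt r))⁻¹ := by
      ext r; rw [fermiWeight, one_div]
    rw [h3]
    refine h2.congr_deriv ?_
    have h4 := Real.exp_pos (Z r ^ 2 - Bt r)
    rw [fermiWeight]
    field_simp
    ring
  have hp := fermiWeight_pos (Bt r) (Z r)
  refine (h1.sqrt hp.ne').congr_deriv ?_
  have hs := Real.sqrt_pos.2 hp
  rw [div_eq_iff (by positivity), hole]
  have h5 := Real.sq_sqrt hp.le
  linear_combination (-(β' - 2 * Z r * ξ') * (1 - fermiWeight (Bt r) (Z r))) * h5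

theorem hasDerivAt_osc_curve (hX : HasDerivAt X x' r) (hT : HasDerivAt T t' r)
    (hZ : HasDerivAt Z ξ' r) : HasDerivAt (fun r => osc (X r) (T r) (Z r))
      (-2 * Complex.I * ((t' * Z r ^ 2 + 2 * T r * Z r * ξ' + x' * Z r + X r * ξ' : ℝ) : ℂ) *
        osc (X r) (T r) (Z r)) r := by
  have h1 : HasDerivAt (fun r => T r * Z r ^ 2 + X r * Z r)
      (t' * Z r ^ 2 + 2 * T r * Z r * ξ' + x' * Z r + X r * ξ') r :=
    ((hT.fun_mul (hZ.fun_pow 2)).fun_add (hX.fun_mul hZ)).congr_deriv (by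
      simp only [Nat.add_one_sub_one, pow_one, Nat.cast_ofNat]; ring)
  have h2 := (h1.ofReal_comp.const_mul (-2 * Complex.I)).cexp
  have h3 : (fun r => osc (X r) (T r) (Z r)) =
      fun r => Complex.exp (-2 * Complex.I * ((T r * Z r ^ 2 + X r * Z r : ℝ) : ℂ)) := by
    ext r; rw [osc]; congr 1; push_cast; ring
  rw [h3]
  refine h2.congr_deriv ?_
  rw [show osc (X r) (T r) (Z r) = _ from congrFun h3 r]
  ring

/-- The phase `e^{itξ² + ixξ}`. -/
noncomputable def phase (x t ξ : ℝ) : ℂ :=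
  Complex.exp (Complex.I * t * (ξ : ℂ) ^ 2 + Complex.I * x * ξ)

theorem hasDerivAt_phase (hX : HasDerivAt X x' r) (hT : HasDerivAt T t' r)
    (hZ : HasDerivAt Z ξ' r) : HasDerivAt (fun r => phase (X r) (T r) (Z r))
      (Complex.I * ((t' * Z r ^ 2 + 2 * T r * Z r * ξ' + x' * Z r + X r * ξ' : ℝ) : ℂ) *
        phase (X r) (T r) (Z r)) r := by
  have h1 : HasDerivAt (fun r => T r * Z r ^ 2 + X r * Z r)
      (t' * Z r ^ 2 + 2 * T r * Z r * ξ' + x' * Z r + X r * ξ') r :=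
    ((hT.fun_mul (hZ.fun_pow 2)).fun_add (hX.fun_mul hZ)).congr_deriv (by
      simp only [Nat.add_one_sub_one, pow_one, Nat.cast_ofNat]; ring)
  have h2 := (h1.ofReal_comp.const_mul Complex.I).cexp
  have h3 : (fun r => phase (X r) (T r) (Z r)) =
      fun r => Complex.exp (Complex.I * ((T r * Z r ^ 2 + X r * Z r : ℝ) : ℂ)) := by
    ext r; rw [phase]; congr 1; push_cast; ring
  rw [h3]
  refine h2.congr_deriv ?_
  rw [show phase (X r) (T r) (Z r) = _ from congrFun h3 r]
  ring

/-- The factor `osc` produces the phase term. In the rest, `fresnelH_ode` eliminates `fresnelH'`;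
the terms with `fresnelH` cancel, and the remaining exponential combines with `osc` into the phase
that turns `G 0 (T r)` into `G (X r) (T r)`. -/
theorem hasDerivAt_pvClosed (hX : HasDerivAt X x' r) (hT : HasDerivAt T t' r)
    (hZ : HasDerivAt Z ξ' r) (ht : T r ≠ 0) :
    HasDerivAt (fun r => pvClosed (X r) (T r) (Z r))
      (-2 * Complex.I * ((t' * Z r ^ 2 + 2 * T r * Z r * ξ' + x' * Z r + X r * ξ' : ℝ) : ℂ) *
        pvClosed (X r) (T r) (Z r) - 2 * Complex.I * G (X r) (T r) *
        ((2 * T r * ξ' + x' + t' * (Z r - X r / (2 * T r)) : ℝ) : ℂ)) r := by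
  have hG := (hasDerivAt_G_zero ht).scomp r hT
  have ho := hasDerivAt_osc_curve hX hT hZ
  have hy : HasDerivAt (fun r => 2 * T r * Z r + X r) (2 * t' * Z r + 2 * T r * ξ' + x') r :=
    ((hT.const_mul 2).fun_mul hZ).fun_add hX
  have hz : HasDerivAt (fun r => (2 * T r * Z r + X r) ^ 2 / (4 * T r))
      ((2 * (2 * T r * Z r + X r) * (2 * t' * Z r + 2 * T r * ξ' + x') * (4 * T r) -
        (2 * T r * Z r + X r) ^ 2 * (4 * t')) / (4 * T r) ^ 2) r :=
    ((hy.fun_pow 2).fun_div (hT.const_mul 4) (by simpa using ht)).congr_deriv (by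
      simp only [Nat.add_one_sub_one, pow_one, Nat.cast_ofNat])
  have hH := (hasDerivAt_fresnelH _).scomp r hz
  have h := (((hG.const_mul (-2 * Complex.I)).fun_mul ho).fun_mul hy.ofReal_comp).fun_mul hH
  refine h.congr_deriv ?_
  have hode := fresnelH_ode ((2 * T r * Z r + X r) ^ 2 / (4 * T r))
  have ht' : (T r : ℂ) ≠ 0 := by exact_mod_cast ht
  have hE : osc (X r) (T r) (Z r) *
      Complex.exp (2 * Complex.I * (((2 * T r * Z r + X r) ^ 2 / (4 * T r) : ℝ) : ℂ)) =
      Complex.exp (Complex.I * X r ^ 2 / (2 * T r)) := by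
    rw [osc, ← Complex.exp_add]
    congr 1; push_cast; field_simp; ring
  simp only [Function.comp, Complex.real_smul]
  rw [G_eq (X r) ht, ← hE, pvClosed]
  generalize osc (X r) (T r) (Z r) = o at *
  generalize fresnelH ((2 * T r * Z r + X r) ^ 2 / (4 * T r)) = H at *
  generalize fresnelH' ((2 * T r * Z r + X r) ^ 2 / (4 * T r)) = H' at *
  generalize Complex.exp (2 * Complex.I * (((2 * T r * Z r + X r) ^ 2 / (4 * T r) : ℝ) : ℂ)) = E at *
  push_cast at hode ⊢
  generalize (T r : ℂ) = t at *
  generalize (X r : ℂ) = x at *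
  generalize (Z r : ℂ) = ξ at *
  have hode2 : (2 * t * ξ + x) ^ 2 * H' = 2 * t * (E - H) := by
    rw [← hode]; field_simp; ring
  have h3 : (2 * (2 * t * ξ + x) * (2 * (t' : ℂ) * ξ + 2 * t * ξ' + x') * (4 * t) -
      (2 * t * ξ + x) ^ 2 * (4 * t')) / (4 * t) ^ 2 * H' * (2 * t * ξ + x) =
      ((2 * (t' : ℂ) * ξ + 2 * t * ξ' + x') - (2 * t * ξ + x) * t' / (2 * t)) * (E - H) := by
    have : ∀ A : ℂ, (2 * (2 * t * ξ + x) * A * (4 * t) -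
      (2 * t * ξ + x) ^ 2 * (4 * t')) / (4 * t) ^ 2 * H' * (2 * t * ξ + x) =
      (A - (2 * t * ξ + x) * t' / (2 * t)) * (((2 * t * ξ + x) ^ 2 * H') / (2 * t)) := by
      intro A; field_simp; ring
    rw [this, hode2]
    field_simp
  have h4 : t * t⁻¹ = 1 := mul_inv_cancel₀ ht'
  linear_combination (-2 * Complex.I * G 0 (T r) * o) * h3 +
    (2 * Complex.I * t' * G 0 (T r) * o * ξ * E) * h4

theorem eMinus_eq (x t β κ ξ : ℝ) : eMinus x t β κ ξ =
    (Real.cos (Real.pi * κ / 2) / Real.pi : ℝ) * (Real.sqrt (fermiWeight β ξ) : ℝ) *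
      phase x t ξ := by
  rw [eMinus, phase]; push_cast; ring

theorem ePlus_closed {x t : ℝ} (ht : t ≠ 0) (β κ ξ : ℝ) : ePlus x t β κ ξ =
    (Real.sqrt (fermiWeight β ξ) : ℝ) * phase x t ξ *
      ((Real.cos (Real.pi * κ / 2) / Real.pi : ℝ) * pvClosed x t ξ +
        (Real.sin (Real.pi * κ / 2) : ℝ) * osc x t ξ) := by
  have : (Real.pi : ℂ) ≠ 0 := by exact_mod_cast Real.pi_ne_zero
  rw [ePlus, phase, principalValue_osc x ξ ht]; push_cast; field_simp

theorem hasDerivAt_eMinus (κ : ℝ) (hX : HasDerivAt X x' r) (hT : HasDerivAt T t' r)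
    (hB : HasDerivAt Bt β' r) (hZ : HasDerivAt Z ξ' r) :
    HasDerivAt (fun r => eMinus (X r) (T r) (Bt r) κ (Z r))
      ((Complex.I * ((t' * Z r ^ 2 + 2 * T r * Z r * ξ' + x' * Z r + X r * ξ' : ℝ) : ℂ) +
        (((β' - 2 * Z r * ξ') * hole (Bt r) (Z r) : ℝ) : ℂ)) *
        eMinus (X r) (T r) (Bt r) κ (Z r)) r := by
  simp_rw [eMinus_eq]
  refine ((((hasDerivAt_sqrt_fermiWeight hB hZ).ofReal_comp.const_mul _).fun_mul
    (hasDerivAt_phase hX hT hZ))).congr_deriv ?_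
  push_cast
  ring

/-- The `sin` term of `e₊` obeys the homogeneous equation of the principal value, so the only
inhomogeneity is the one with `G`, and its prefactor is exactly `e₋`. This closes the system for the
pair. -/
theorem hasDerivAt_ePlus (κ : ℝ) (hX : HasDerivAt X x' r) (hT : HasDerivAt T t' r)
    (hB : HasDerivAt Bt β' r) (hZ : HasDerivAt Z ξ' r) (ht : T r ≠ 0) :
    HasDerivAt (fun r => ePlus (X r) (T r) (Bt r) κ (Z r))
      ((-Complex.I * ((t' * Z r ^ 2 + 2 * T r * Z r * ξ' + x' * Z r + X r * ξ' : ℝ) : ℂ) +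
        (((β' - 2 * Z r * ξ') * hole (Bt r) (Z r) : ℝ) : ℂ)) *
        ePlus (X r) (T r) (Bt r) κ (Z r) - 2 * Complex.I * G (X r) (T r) *
        ((2 * T r * ξ' + x' + t' * (Z r - X r / (2 * T r)) : ℝ) : ℂ) *
        eMinus (X r) (T r) (Bt r) κ (Z r)) r := by
  have hev : ∀ᶠ s in 𝓝 r, ePlus (X s) (T s) (Bt s) κ (Z s) =
      (Real.sqrt (fermiWeight (Bt s) (Z s)) : ℝ) * phase (X s) (T s) (Z s) *
      ((Real.cos (Real.pi * κ / 2) / Real.pi : ℝ) * pvClosed (X s) (T s) (Z s) +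
        (Real.sin (Real.pi * κ / 2) : ℝ) * osc (X s) (T s) (Z s)) := by
    filter_upwards [hT.continuousAt.eventually_ne ht] with s hs using ePlus_closed hs _ _ _
  have h := ((hasDerivAt_sqrt_fermiWeight hB hZ).ofReal_comp.fun_mul
    (hasDerivAt_phase hX hT hZ)).fun_mul
    (((hasDerivAt_pvClosed hX hT hZ ht).const_mul
      ((Real.cos (Real.pi * κ / 2) / Real.pi : ℝ) : ℂ)).fun_add
    ((hasDerivAt_osc_curve hX hT hZ).const_mul ((Real.sin (Real.pi * κ / 2) : ℝ) : ℂ)))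
  refine (h.congr_of_eventuallyEq hev).congr_deriv ?_
  rw [ePlus_closed ht, eMinus_eq]
  push_cast
  ring

end Curves

section Continuity

variable {Y : Type*} [TopologicalSpace Y] {X T Bt Z : Y → ℝ}

theorem continuous_G_zero (hT : Continuous T) (h0 : ∀ y, T y ≠ 0) :
    Continuous fun y => G 0 (T y) :=
  continuous_iff_continuousAt.2 fun y =>
    (hasDerivAt_G_zero (h0 y)).continuousAt.comp (f := T) hT.continuousAt

theorem continuous_G (hX : Continuous X) (hT : Continuous T) (h0 : ∀ y, T y ≠ 0) :
    Continuous fun y => G (X y) (T y) := by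
  have : (fun y => G (X y) (T y)) = fun y =>
      Complex.exp (Complex.I * (X y : ℂ) ^ 2 / (2 * (T y : ℂ))) * G 0 (T y) := by
    ext y; exact G_eq _ (h0 y)
  rw [this]
  refine (Complex.continuous_exp.comp' (Continuous.div (by fun_prop) (by fun_prop) fun y => ?_)).mul
    (continuous_G_zero hT h0)
  have := h0 y
  simpa using this

theorem continuous_fermiWeight (hB : Continuous Bt) (hZ : Continuous Z) :
    Continuous fun y => fermiWeight (Bt y) (Z y) := by
  unfold fermiWeight
  refine Continuous.div (by fun_prop) (by fun_prop) fun y => by positivity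

theorem continuous_hole (hB : Continuous Bt) (hZ : Continuous Z) :
    Continuous fun y => hole (Bt y) (Z y) := by
  have := continuous_fermiWeight hB hZ
  unfold hole
  fun_prop

theorem continuous_phase (hX : Continuous X) (hT : Continuous T) (hZ : Continuous Z) :
    Continuous fun y => phase (X y) (T y) (Z y) := by
  unfold phase; fun_prop

theorem continuous_eMinus (κ : ℝ) (hX : Continuous X) (hT : Continuous T) (hB : Continuous Bt)
    (hZ : Continuous Z) : Continuous fun y => eMinus (X y) (T y) (Bt y) κ (Z y) := by
  simp_rw [eMinus_eq]
  have h1 := (Real.continuous_sqrt.comp' (continuous_fermiWeight hB hZ))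
  exact (continuous_const.mul (Complex.continuous_ofReal.comp' h1)).mul (continuous_phase hX hT hZ)

theorem continuous_ePlus (κ : ℝ) (hX : Continuous X) (hT : Continuous T) (hB : Continuous Bt)
    (hZ : Continuous Z) (h0 : ∀ y, T y ≠ 0) :
    Continuous fun y => ePlus (X y) (T y) (Bt y) κ (Z y) := by
  have : (fun y => ePlus (X y) (T y) (Bt y) κ (Z y)) = fun y =>
      (Real.sqrt (fermiWeight (Bt y) (Z y)) : ℝ) * phase (X y) (T y) (Z y) *
      ((Real.cos (Real.pi * κ / 2) / Real.pi : ℝ) * pvClosed (X y) (T y) (Z y) +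
        (Real.sin (Real.pi * κ / 2) : ℝ) * osc (X y) (T y) (Z y)) := by
    ext y; exact ePlus_closed (h0 y) _ _ _
  rw [this]
  have h1 := (Real.continuous_sqrt.comp' (continuous_fermiWeight hB hZ))
  have h2 : Continuous fun y => osc (X y) (T y) (Z y) := by unfold osc; fun_prop
  have h3 : Continuous fresnelH :=
    continuous_iff_continuousAt.2 fun z => (hasDerivAt_fresnelH z).continuousAt
  have h4 : Continuous fun y => (2 * T y * Z y + X y) ^ 2 / (4 * T y) :=
    Continuous.div (by fun_prop) (by fun_prop) fun y => by simpa using h0 y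
  have h5 : Continuous fun y => pvClosed (X y) (T y) (Z y) := by
    unfold pvClosed
    exact (((continuous_const.mul (continuous_G_zero hT h0)).mul h2).mul (by fun_prop)).mul
      (h3.comp' h4)
  exact ((Complex.continuous_ofReal.comp' h1).mul (continuous_phase hX hT hZ)).mul
    ((continuous_const.mul h5).add (continuous_const.mul h2))

end Continuity

end ImpenetrableAnyons

/-! ### Decay of e₊ and e₋, and the derivative of the kernel -/

namespace ImpenetrableAnyons

/-- A quantitative form of the statement that the parameters lie in a compact set. -/
structure ParamBound (M x t β : ℝ) : Prop where
  ne : t ≠ 0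
  x_le : |x| ≤ M
  t_le : |t| ≤ M
  β_le : |β| ≤ M
  quot_le : |x / (2 * t)| ≤ M
  G_zero_le : ‖G 0 t‖ ≤ M
  G_le : ‖G x t‖ ≤ M

theorem exists_paramBound {Y : Type*} [TopologicalSpace Y] {X T Bt : Y → ℝ} {s : Y}
    (hX : Continuous X) (hT : Continuous T) (hB : Continuous Bt) (h0 : T s ≠ 0) :
    ∃ M, 0 < M ∧ ∀ᶠ r in 𝓝 s, ParamBound M (X r) (T r) (Bt r) := by
  have hlt : ∀ {u : Y → ℝ}, ContinuousAt u s → ∀ {M : ℝ}, |u s| < M → ∀ᶠ r in 𝓝 s, |u r| ≤ M :=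
    fun hu _ h => (hu.abs.eventually_lt_const h).mono fun _ h => le_of_lt h
  have hq : ContinuousAt (fun r => X r / (2 * T r)) s :=
    hX.continuousAt.div (by fun_prop) (by simpa using h0)
  have hG0 : ContinuousAt (fun r => G 0 (T r)) s :=
    (hasDerivAt_G_zero h0).continuousAt.comp (f := T) hT.continuousAt
  have hG : ContinuousAt (fun r => G (X r) (T r)) s := by
    have h1 : ContinuousAt (fun r => Complex.exp (Complex.I * (X r : ℂ) ^ 2 / (2 * (T r : ℂ)))) s := by
      refine Complex.continuous_exp.continuousAt.comp (f := fun r =>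
        Complex.I * (X r : ℂ) ^ 2 / (2 * (T r : ℂ))) (ContinuousAt.div ?_ ?_ (by simpa using h0))
      · exact Continuous.continuousAt (by fun_prop)
      · exact Continuous.continuousAt (by fun_prop)
    refine (h1.mul hG0).congr ?_
    filter_upwards [hT.continuousAt.eventually_ne h0] with r hr using (G_eq _ hr).symm
  set M := |X s| + |T s| + |Bt s| + |X s / (2 * T s)| + ‖G 0 (T s)‖ + ‖G (X s) (T s)‖ + 1 with hM
  have a1 := abs_nonneg (X s)
  have a2 := abs_nonneg (T s)
  have a3 := abs_nonneg (Bt s)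
  have a4 := abs_nonneg (X s / (2 * T s))
  have a5 := norm_nonneg (G 0 (T s))
  have a6 := norm_nonneg (G (X s) (T s))
  refine ⟨M, by linarith, ?_⟩
  filter_upwards [hT.continuousAt.eventually_ne h0, hlt hX.continuousAt (M := M) (by linarith),
    hlt hT.continuousAt (M := M) (by linarith), hlt hB.continuousAt (M := M) (by linarith),
    hlt hq (M := M) (by linarith), hG0.norm.eventually_lt_const (u := M) (by linarith),
    hG.norm.eventually_lt_const (u := M) (by linarith)] with r h1 h2 h3 h4 h5 h6 h7
  exact ⟨h1, h2, h3, h4, h5, h6.le, h7.le⟩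

theorem norm_phase (x t ξ : ℝ) : ‖phase x t ξ‖ = 1 := by
  have : Complex.I * t * (ξ : ℂ) ^ 2 + Complex.I * x * ξ =
      ((t * ξ ^ 2 + x * ξ : ℝ) : ℂ) * Complex.I := by push_cast; ring
  rw [phase, this, Complex.norm_exp_ofReal_mul_I]

/-- Gaussian decay is traded for `e^{-7|ξ|}` by means of `(|ξ| - 7)² ≥ 0`. The rate leaves room for
factors `e^{|ξ|}` that absorb polynomial growth: it becomes 6 for `e_±`, 5 for their derivatives and
for `V`, and 4 for the derivative of `V`. -/
theorem sqrt_fermiWeight_le {M β : ℝ} (hβ : |β| ≤ M) (ξ : ℝ) :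
    Real.sqrt (fermiWeight β ξ) ≤ Real.exp (M + 25) * Real.exp (-(7 * |ξ|)) := by
  rw [← Real.exp_add]
  refine Real.sqrt_le_iff.2 ⟨(Real.exp_pos _).le, ?_⟩
  have h1 : fermiWeight β ξ ≤ Real.exp (-(ξ ^ 2 - β)) := by
    rw [fermiWeight, Real.exp_neg, one_div]
    exact inv_anti₀ (Real.exp_pos _) (by linarith)
  refine h1.trans ?_
  rw [← Real.exp_nat_mul]
  refine Real.exp_le_exp.2 ?_
  have h2 := abs_le.1 hβ
  have h3 : 0 ≤ (|ξ| - 7) ^ 2 := sq_nonneg _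
  have h4 : |ξ| ^ 2 = ξ ^ 2 := sq_abs ξ
  push_cast
  linarith [h2.2, h2.1]

theorem norm_pvClosed_le {M x t β : ℝ} (h : ParamBound M x t β) (ξ : ℝ) :
    ‖pvClosed x t ξ‖ ≤ 2 * M * (2 * M + M) * Real.exp |ξ| := by
  have hM : 0 ≤ M := (abs_nonneg _).trans h.x_le
  have h1 : ‖((2 * t * ξ + x : ℝ) : ℂ)‖ ≤ (2 * M + M) * Real.exp |ξ| := by
    rw [Complex.norm_real, Real.norm_eq_abs]
    have h2 : |ξ| ≤ Real.exp |ξ| := by linarith [Real.add_one_le_exp |ξ|]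
    have h3 : 1 ≤ Real.exp |ξ| := Real.one_le_exp (abs_nonneg _)
    calc |2 * t * ξ + x| ≤ |2 * t * ξ| + |x| := abs_add_le _ _
      _ = 2 * |t| * |ξ| + |x| * 1 := by rw [abs_mul, abs_mul, abs_two, mul_one]
      _ ≤ 2 * M * Real.exp |ξ| + M * Real.exp |ξ| := by
        gcongr
        · exact h.t_le
        · exact h.x_le
      _ = _ := by ring
  rw [pvClosed, norm_mul, norm_mul, norm_mul, norm_mul, norm_osc, mul_one]
  have h2 : ‖(-2 * Complex.I : ℂ)‖ = 2 := by simp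
  rw [h2]
  calc _ ≤ 2 * M * ((2 * M + M) * Real.exp |ξ|) * 1 := by
        gcongr
        · exact h.G_zero_le
        · exact norm_fresnelH_le _
    _ = _ := by ring

/-- Exponential decay of `e₊` and `e₋`, uniformly for bounded parameters. -/
theorem exists_norm_e_le (M : ℝ) : ∃ C, 0 < C ∧ ∀ x t β, ParamBound M x t β → ∀ (l : PM) (κ ξ : ℝ),
    ‖e l x t β κ ξ‖ ≤ C * Real.exp (-(6 * |ξ|)) := by
  refine ⟨Real.exp (M + 25) * (|2 * M * (2 * M + M)| + 1), by positivity, ?_⟩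
  intro x t β h l κ ξ
  have hs := sqrt_fermiWeight_le h.β_le ξ
  have hcos : |Real.cos (Real.pi * κ / 2) / Real.pi| ≤ 1 := by
    rw [abs_div, abs_of_pos Real.pi_pos, div_le_one Real.pi_pos]
    linarith [Real.abs_cos_le_one (Real.pi * κ / 2), Real.pi_gt_three]
  have hsin := Real.abs_sin_le_one (Real.pi * κ / 2)
  have h3 : 1 ≤ Real.exp |ξ| := Real.one_le_exp (abs_nonneg _)
  have hexp : Real.exp (-(7 * |ξ|)) * Real.exp |ξ| = Real.exp (-(6 * |ξ|)) := by
    rw [← Real.exp_add]; congr 1; ring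
  have hA : 0 ≤ |2 * M * (2 * M + M)| := abs_nonneg _
  cases l
  · have hP : ‖((Real.cos (Real.pi * κ / 2) / Real.pi : ℝ) : ℂ) * pvClosed x t ξ +
        ((Real.sin (Real.pi * κ / 2) : ℝ) : ℂ) * osc x t ξ‖ ≤
        (|2 * M * (2 * M + M)| + 1) * Real.exp |ξ| := by
      refine (norm_add_le _ _).trans ?_
      rw [norm_mul, norm_mul, norm_osc, Complex.norm_real, Complex.norm_real, Real.norm_eq_abs,
        Real.norm_eq_abs, mul_one, add_mul, one_mul]
      refine add_le_add ?_ (hsin.trans h3)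
      calc _ ≤ 1 * (2 * M * (2 * M + M) * Real.exp |ξ|) := by
            gcongr
            exact norm_pvClosed_le h ξ
        _ ≤ _ := by
          rw [one_mul]
          gcongr
          exact le_abs_self _
    change ‖ePlus x t β κ ξ‖ ≤ _
    rw [ePlus_closed h.ne, norm_mul, norm_mul, norm_phase, mul_one, Complex.norm_real,
      Real.norm_of_nonneg (Real.sqrt_nonneg _), ← hexp]
    calc _ ≤ (Real.exp (M + 25) * Real.exp (-(7 * |ξ|))) *
          ((|2 * M * (2 * M + M)| + 1) * Real.exp |ξ|) :=
          mul_le_mul hs hP (norm_nonneg _) (by positivity)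
      _ = _ := by ring
  · change ‖eMinus x t β κ ξ‖ ≤ _
    rw [eMinus_eq, norm_mul, norm_mul, norm_phase, mul_one, Complex.norm_real, Complex.norm_real,
      Real.norm_of_nonneg (Real.sqrt_nonneg _), Real.norm_eq_abs, ← hexp]
    calc _ ≤ 1 * (Real.exp (M + 25) * Real.exp (-(7 * |ξ|))) :=
          mul_le_mul hcos hs (Real.sqrt_nonneg _) zero_le_one
      _ = (Real.exp (M + 25) * 1) * (Real.exp (-(7 * |ξ|)) * 1) := by ring
      _ ≤ _ := by
        gcongr
        linarith

/-- The derivative of `e₋` in the direction `(x', t', β', ξ')`. -/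
noncomputable def dMinus (x' t' β' ξ' x t β κ ξ : ℝ) : ℂ :=
  (Complex.I * ((t' * ξ ^ 2 + 2 * t * ξ * ξ' + x' * ξ + x * ξ' : ℝ) : ℂ) +
    (((β' - 2 * ξ * ξ') * hole β ξ : ℝ) : ℂ)) * eMinus x t β κ ξ

/-- The derivative of `e₊` in the direction `(x', t', β', ξ')`. -/
noncomputable def dPlus (x' t' β' ξ' x t β κ ξ : ℝ) : ℂ :=
  (-Complex.I * ((t' * ξ ^ 2 + 2 * t * ξ * ξ' + x' * ξ + x * ξ' : ℝ) : ℂ) +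
    (((β' - 2 * ξ * ξ') * hole β ξ : ℝ) : ℂ)) * ePlus x t β κ ξ -
    2 * Complex.I * G x t * ((2 * t * ξ' + x' + t' * (ξ - x / (2 * t)) : ℝ) : ℂ) *
      eMinus x t β κ ξ

/-- The derivatives of `e₊` and `e₋` in the direction `(x', t', β', ξ')`. -/
noncomputable def de : PM → ℝ → ℝ → ℝ → ℝ → ℝ → ℝ → ℝ → ℝ → ℝ → ℂ
  | PM.plus => dPlus
  | PM.minus => dMinus

/-- The derivative of `V` in the direction `(x', t', β', ξ')`, the last component being a
simultaneous shift of both arguments. -/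
noncomputable def dV (x' t' β' ξ' x t β κ a b : ℝ) : ℂ :=
  (((β' - 2 * a * ξ') * hole β a + (β' - 2 * b * ξ') * hole β b : ℝ) : ℂ) * V x t β κ a b -
    Complex.I * ((t' * (a + b) + 2 * t * ξ' + x' : ℝ) : ℂ) *
      (ePlus x t β κ a * eMinus x t β κ b + eMinus x t β κ a * ePlus x t β κ b) -
    2 * Complex.I * G x t * t' * (eMinus x t β κ a * eMinus x t β κ b)

theorem hasDerivAt_e {X T Bt Z : ℝ → ℝ} {x' t' β' ξ' r : ℝ} (l : PM) (κ : ℝ)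
    (hX : HasDerivAt X x' r) (hT : HasDerivAt T t' r) (hB : HasDerivAt Bt β' r)
    (hZ : HasDerivAt Z ξ' r) (ht : T r ≠ 0) :
    HasDerivAt (fun r => e l (X r) (T r) (Bt r) κ (Z r))
      (de l x' t' β' ξ' (X r) (T r) (Bt r) κ (Z r)) r := by
  cases l
  · exact hasDerivAt_ePlus κ hX hT hB hZ ht
  · exact hasDerivAt_eMinus κ hX hT hB hZ

theorem hasDerivAt_e_right (l : PM) {x t : ℝ} (ht : t ≠ 0) (β κ ξ : ℝ) :
    HasDerivAt (e l x t β κ) (de l 0 0 0 1 x t β κ ξ) ξ :=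
  hasDerivAt_e l κ (hasDerivAt_const ξ x) (hasDerivAt_const ξ t) (hasDerivAt_const ξ β)
    (hasDerivAt_id ξ) ht

/-- The diagonal value uses the linear system in the direction `ξ' = 1`. The terms with `hole`
cancel between the two products and the phase terms add up. -/
theorem V_diag {x t : ℝ} (ht : t ≠ 0) (β κ ξ : ℝ) :
    V x t β κ ξ ξ = -2 * Complex.I * ((2 * t * ξ + x : ℝ) : ℂ) *
      (ePlus x t β κ ξ * eMinus x t β κ ξ) -
      4 * Complex.I * t * G x t * (eMinus x t β κ ξ * eMinus x t β κ ξ) := by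
  have h1 : deriv (ePlus x t β κ) ξ = dPlus 0 0 0 1 x t β κ ξ :=
    (hasDerivAt_e_right PM.plus ht β κ ξ).deriv
  have h2 : deriv (eMinus x t β κ) ξ = dMinus 0 0 0 1 x t β κ ξ :=
    (hasDerivAt_e_right PM.minus ht β κ ξ).deriv
  rw [V, if_pos rfl, h1, h2, dPlus, dMinus]
  push_cast
  ring

theorem sub_mul_V (x t β κ a b : ℝ) : ((a : ℂ) - b) * V x t β κ a b =
    ePlus x t β κ a * eMinus x t β κ b - eMinus x t β κ a * ePlus x t β κ b := by
  rw [V]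
  split_ifs with h
  · subst h; ring
  · have : (a : ℂ) - b ≠ 0 := sub_ne_zero.2 (by exact_mod_cast h)
    field_simp

theorem V_symm (x t β κ a b : ℝ) : V x t β κ a b = V x t β κ b a := by
  by_cases h : a = b
  · rw [h]
  · have h1 : (a : ℂ) - b ≠ 0 := sub_ne_zero.2 (by exact_mod_cast h)
    refine mul_left_cancel₀ h1 ?_
    linear_combination sub_mul_V x t β κ a b + sub_mul_V x t β κ b a

theorem hasDerivAt_G_curve {X T : ℝ → ℝ} {x' t' r : ℝ} (hX : HasDerivAt X x' r)
    (hT : HasDerivAt T t' r) (ht : T r ≠ 0) :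
    HasDerivAt (fun r => G (X r) (T r))
      ((Complex.I * X r * x' / T r - Complex.I * X r ^ 2 * t' / (2 * T r ^ 2) - t' / (2 * T r)) *
        G (X r) (T r)) r := by
  have hev : ∀ᶠ s in 𝓝 r, G (X s) (T s) =
      Complex.exp (Complex.I * ((X s ^ 2 / (2 * T s) : ℝ) : ℂ)) * G 0 (T s) := by
    filter_upwards [hT.continuousAt.eventually_ne ht] with s hs
    rw [G_eq _ hs]; congr 2; push_cast; ring
  have h1 := (((hX.fun_pow 2).fun_div (hT.const_mul 2)
    (by simpa using ht)).ofReal_comp.const_mul Complex.I).cexp.fun_mul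
      ((hasDerivAt_G_zero ht).scomp r hT)
  refine (h1.congr_of_eventuallyEq hev).congr_deriv ?_
  have ht' : (T r : ℂ) ≠ 0 := by exact_mod_cast ht
  have := hev.self_of_nhds
  rw [this]
  simp only [Function.comp, Complex.real_smul]
  push_cast
  field_simp
  ring

/-- Shifting both arguments together keeps the denominator `a - b` constant. Off the diagonal the
phase terms of the numerator combine into the difference of a quadratic polynomial at the two
arguments, and the terms with `G` into that of a linear one; both are divisible by `a - b`. On the
diagonal `V_diag` is differentiated directly. -/
theorem hasDerivAt_V {X T Bt Z : ℝ → ℝ} {x' t' β' ξ' r : ℝ} (κ a b : ℝ)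
    (hX : HasDerivAt X x' r) (hT : HasDerivAt T t' r) (hB : HasDerivAt Bt β' r)
    (hZ : HasDerivAt Z ξ' r) (ht : T r ≠ 0) :
    HasDerivAt (fun r => V (X r) (T r) (Bt r) κ (a + Z r) (b + Z r))
      (dV x' t' β' ξ' (X r) (T r) (Bt r) κ (a + Z r) (b + Z r)) r := by
  have hpa := hasDerivAt_ePlus κ hX hT hB (hZ.const_add a) ht
  have hma := hasDerivAt_eMinus κ hX hT hB (hZ.const_add a)
  have ht' : (T r : ℂ) ≠ 0 := by exact_mod_cast ht
  by_cases hab : a = b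
  · subst hab
    have hy : HasDerivAt (fun r => 2 * T r * (a + Z r) + X r)
        (2 * t' * (a + Z r) + 2 * T r * ξ' + x') r :=
      ((hT.const_mul 2).fun_mul (hZ.const_add a)).fun_add hX
    have hev : ∀ᶠ s in 𝓝 r, V (X s) (T s) (Bt s) κ (a + Z s) (a + Z s) =
        -2 * Complex.I * ((2 * T s * (a + Z s) + X s : ℝ) : ℂ) *
      (ePlus (X s) (T s) (Bt s) κ (a + Z s) * eMinus (X s) (T s) (Bt s) κ (a + Z s)) -
      4 * Complex.I * T s * G (X s) (T s) * (eMinus (X s) (T s) (Bt s) κ (a + Z s) *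
        eMinus (X s) (T s) (Bt s) κ (a + Z s)) := by
      filter_upwards [hT.continuousAt.eventually_ne ht] with s hs using V_diag hs _ _ _
    have h := ((hy.ofReal_comp.const_mul (-2 * Complex.I)).fun_mul (hpa.fun_mul hma)).fun_sub
      (((hT.ofReal_comp.const_mul (4 * Complex.I)).fun_mul
        (hasDerivAt_G_curve hX hT ht)).fun_mul (hma.fun_mul hma))
    refine (h.congr_of_eventuallyEq hev).congr_deriv ?_
    rw [dV, hev.self_of_nhds]
    push_cast
    field_simp
    ring_nf
  · have hpb := hasDerivAt_ePlus κ hX hT hB (hZ.const_add b) ht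
    have hmb := hasDerivAt_eMinus κ hX hT hB (hZ.const_add b)
    have h1 : (a : ℂ) - b ≠ 0 := sub_ne_zero.2 (by exact_mod_cast hab)
    have hV : ∀ s, V (X s) (T s) (Bt s) κ (a + Z s) (b + Z s) =
        (ePlus (X s) (T s) (Bt s) κ (a + Z s) * eMinus (X s) (T s) (Bt s) κ (b + Z s) -
        eMinus (X s) (T s) (Bt s) κ (a + Z s) * ePlus (X s) (T s) (Bt s) κ (b + Z s)) /
          ((a : ℂ) - b) := by
      intro s
      rw [eq_div_iff h1, ← sub_mul_V]
      push_cast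
      ring
    simp_rw [hV]
    refine (((hpa.fun_mul hmb).fun_sub (hma.fun_mul hpb)).div_const _).congr_deriv ?_
    rw [dV, hV]
    push_cast
    field_simp
    ring

end ImpenetrableAnyons

/-! ### Joint continuity and decay of the kernel and its derivative -/

namespace ImpenetrableAnyons

theorem abs_le_exp_abs (ξ : ℝ) : |ξ| ≤ Real.exp |ξ| := by
  linarith [Real.add_one_le_exp |ξ|]

theorem sq_le_two_mul_exp_abs (ξ : ℝ) : |ξ| ^ 2 ≤ 2 * Real.exp |ξ| := by
  linarith [Real.quadratic_le_exp_of_nonneg (abs_nonneg ξ), abs_nonneg ξ]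

theorem exists_norm_de_le (M : ℝ) : ∃ C, 0 < C ∧ ∀ x t β, ParamBound M x t β →
    ∀ (l : PM) (x' t' β' ξ' κ ξ : ℝ), |x'| ≤ 1 → |t'| ≤ 1 → |β'| ≤ 1 → |ξ'| ≤ 1 →
    ‖de l x' t' β' ξ' x t β κ ξ‖ ≤ C * Real.exp (-(5 * |ξ|)) := by
  obtain ⟨C, hC, hb⟩ := exists_norm_e_le M
  refine ⟨((3 + 3 * |M|) + 3 + 2 * |M| * (2 + 3 * |M|)) * C, by positivity, ?_⟩
  intro x t β h l x' t' β' ξ' κ ξ hx ht hβ hξ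
  have hMM : M ≤ |M| := le_abs_self M
  have h0 : 1 ≤ Real.exp |ξ| := Real.one_le_exp (abs_nonneg _)
  have h1 := abs_le_exp_abs ξ
  have h2 := sq_le_two_mul_exp_abs ξ
  have hxM := h.x_le.trans hMM
  have htM := h.t_le.trans hMM
  have hqM := h.quot_le.trans hMM
  have hGM := h.G_le.trans hMM
  have hM : 0 ≤ |M| := abs_nonneg M
  have hexp : Real.exp (-(6 * |ξ|)) * Real.exp |ξ| = Real.exp (-(5 * |ξ|)) := by
    rw [← Real.exp_add]; congr 1; ring
  have p1 : |t' * ξ ^ 2 + 2 * t * ξ * ξ' + x' * ξ + x * ξ'| ≤ (3 + 3 * |M|) * Real.exp |ξ| := by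
    calc _ ≤ |t' * ξ ^ 2| + |2 * t * ξ * ξ'| + |x' * ξ| + |x * ξ'| :=
          (abs_add_le _ _).trans (by gcongr; exact abs_add_three _ _ _)
      _ = |t'| * |ξ| ^ 2 + 2 * |t| * |ξ| * |ξ'| + |x'| * |ξ| + |x| * |ξ'| := by
          simp only [abs_mul, abs_pow, abs_two]
      _ ≤ 1 * (2 * Real.exp |ξ|) + 2 * |M| * Real.exp |ξ| * 1 + 1 * Real.exp |ξ| + |M| * 1 := by
          gcongr
      _ ≤ (3 + 3 * |M|) * Real.exp |ξ| := by nlinarith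
  have p2 : |(β' - 2 * ξ * ξ') * hole β ξ| ≤ 3 * Real.exp |ξ| := by
    rw [abs_mul]
    calc _ ≤ (|β'| + |2 * ξ * ξ'|) * 1 :=
          mul_le_mul (abs_sub _ _) (abs_hole_le _ _) (abs_nonneg _) (by positivity)
      _ = |β'| + 2 * |ξ| * |ξ'| := by simp only [abs_mul, abs_two, mul_one]
      _ ≤ 1 + 2 * Real.exp |ξ| * 1 := by gcongr
      _ ≤ _ := by linarith
  have p3 : |2 * t * ξ' + x' + t' * (ξ - x / (2 * t))| ≤ (2 + 3 * |M|) * Real.exp |ξ| := by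
    calc _ ≤ |2 * t * ξ'| + |x'| + |t'| * (|ξ| + |x / (2 * t)|) := by
          refine (abs_add_three _ _ _).trans ?_
          rw [abs_mul t']
          gcongr
          exact abs_sub _ _
      _ = 2 * |t| * |ξ'| + |x'| + |t'| * (|ξ| + |x / (2 * t)|) := by simp only [abs_mul, abs_two]
      _ ≤ 2 * |M| * 1 + 1 + 1 * (Real.exp |ξ| + |M|) := by gcongr
      _ ≤ _ := by nlinarith
  have hC0 : 0 ≤ C * Real.exp (-(6 * |ξ|)) := by positivity
  have hcoef : ∀ z : ℂ, ‖z‖ = 1 → ‖z * ((t' * ξ ^ 2 + 2 * t * ξ * ξ' + x' * ξ + x * ξ' : ℝ) : ℂ) +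
      (((β' - 2 * ξ * ξ') * hole β ξ : ℝ) : ℂ)‖ ≤ ((3 + 3 * |M|) + 3) * Real.exp |ξ| := by
    intro z hz
    refine (norm_add_le _ _).trans ?_
    rw [norm_mul, hz, one_mul, Complex.norm_real, Complex.norm_real, Real.norm_eq_abs,
      Real.norm_eq_abs, add_mul]
    exact add_le_add p1 p2
  cases l
  · change ‖dPlus _ _ _ _ _ _ _ _ _‖ ≤ _
    rw [dPlus, ← hexp]
    refine (norm_sub_le _ _).trans ?_
    have b1 := mul_le_mul (hcoef (-Complex.I) (by simp)) (hb x t β h PM.plus κ ξ) (norm_nonneg _)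
      (by positivity)
    have b2 : ‖2 * Complex.I * G x t * ((2 * t * ξ' + x' + t' * (ξ - x / (2 * t)) : ℝ) : ℂ) *
        eMinus x t β κ ξ‖ ≤ 2 * |M| * ((2 + 3 * |M|) * Real.exp |ξ|) *
          (C * Real.exp (-(6 * |ξ|))) := by
      rw [norm_mul, norm_mul, norm_mul, norm_mul, Complex.norm_I, Complex.norm_real,
        Real.norm_eq_abs, mul_one]
      have : ‖(2 : ℂ)‖ = 2 := by simp
      rw [this]
      gcongr
      exact hb x t β h PM.minus κ ξ
    rw [norm_mul]
    refine (add_le_add b1 b2).trans (le_of_eq ?_)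
    ring
  · change ‖dMinus _ _ _ _ _ _ _ _ _‖ ≤ _
    rw [dMinus, ← hexp, norm_mul]
    refine (mul_le_mul (hcoef Complex.I (by simp)) (hb x t β h PM.minus κ ξ) (norm_nonneg _)
      (by positivity)).trans ?_
    have : 0 ≤ 2 * |M| * (2 + 3 * |M|) * Real.exp |ξ| * (C * Real.exp (-(6 * |ξ|))) := by positivity
    linarith

section Continuity

variable {Y : Type*} [TopologicalSpace Y] {X T Bt Z A A' : Y → ℝ}

theorem continuous_e (l : PM) (κ : ℝ) (hX : Continuous X) (hT : Continuous T) (hB : Continuous Bt)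
    (hZ : Continuous Z) (h0 : ∀ y, T y ≠ 0) :
    Continuous fun y => e l (X y) (T y) (Bt y) κ (Z y) := by
  cases l
  · exact continuous_ePlus κ hX hT hB hZ h0
  · exact continuous_eMinus κ hX hT hB hZ

theorem continuous_de_right (l : PM) (κ : ℝ) (hX : Continuous X) (hT : Continuous T)
    (hB : Continuous Bt) (hZ : Continuous Z) (h0 : ∀ y, T y ≠ 0) :
    Continuous fun y => de l 0 0 0 1 (X y) (T y) (Bt y) κ (Z y) := by
  have hp := continuous_ePlus κ hX hT hB hZ h0
  have hm := continuous_eMinus κ hX hT hB hZ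
  have hG := continuous_G hX hT h0
  have hh := continuous_hole hB hZ
  cases l
  · simp only [de, dPlus, zero_mul, add_zero]
    fun_prop
  · simp only [de, dMinus]
    fun_prop

/-- A divided difference is the average of the derivative over the segment. This form has no
denominator, hence gives joint continuity across the diagonal and bounds near it. -/
theorem V_eq_integral {x t : ℝ} (ht : t ≠ 0) (β κ a b : ℝ) : V x t β κ a b =
    eMinus x t β κ b * (∫ u in (0 : ℝ)..1, de PM.plus 0 0 0 1 x t β κ (b + u * (a - b))) -
    ePlus x t β κ b * ∫ u in (0 : ℝ)..1, de PM.minus 0 0 0 1 x t β κ (b + u * (a - b)) := by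
  have key : ∀ l, ((a : ℂ) - b) * ∫ u in (0 : ℝ)..1, de l 0 0 0 1 x t β κ (b + u * (a - b)) =
      e l x t β κ a - e l x t β κ b := by
    intro l
    have hline : ∀ u : ℝ, HasDerivAt (fun u : ℝ => b + u * (a - b)) (a - b) u := fun u => by
      simpa using ((hasDerivAt_id u).mul_const (a - b)).const_add b
    have h := intervalIntegral.integral_eq_sub_of_hasDerivAt (a := 0) (b := 1)
      (f := fun u : ℝ => e l x t β κ (b + u * (a - b)))
      (f' := fun u : ℝ => (a - b) • de l 0 0 0 1 x t β κ (b + u * (a - b)))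
      (fun u _ => (hasDerivAt_e_right l ht β κ _).scomp u (hline u))
      (((continuous_de_right l κ continuous_const continuous_const continuous_const
        (by fun_prop) fun _ => ht).const_smul (a - b)).intervalIntegrable _ _)
    rw [intervalIntegral.integral_smul] at h
    simpa using h
  by_cases hab : a = b
  · subst hab
    rw [V_diag ht]
    simp only [sub_self, mul_zero, add_zero, intervalIntegral.integral_const, sub_zero, one_smul,
      de, dPlus, dMinus]
    push_cast
    ring
  · have h1 : (a : ℂ) - b ≠ 0 := sub_ne_zero.2 (by exact_mod_cast hab)
    refine mul_left_cancel₀ h1 ?_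
    rw [sub_mul_V]
    have hp := key PM.plus
    have hm := key PM.minus
    simp only [e] at hp hm
    linear_combination (-eMinus x t β κ b) * hp + ePlus x t β κ b * hm

theorem continuous_V (κ : ℝ) (hX : Continuous X) (hT : Continuous T) (hB : Continuous Bt)
    (hA : Continuous A) (hA' : Continuous A') (h0 : ∀ y, T y ≠ 0) :
    Continuous fun y => V (X y) (T y) (Bt y) κ (A y) (A' y) := by
  simp_rw [fun y => V_eq_integral (x := X y) (h0 y) (Bt y) κ (A y) (A' y)]
  have hint : ∀ l, Continuous fun y =>
      ∫ u in (0 : ℝ)..1, de l 0 0 0 1 (X y) (T y) (Bt y) κ (A' y + u * (A y - A' y)) := by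
    intro l
    refine intervalIntegral.continuous_parametric_intervalIntegral_of_continuous' ?_ 0 1
    exact continuous_de_right (Y := Y × ℝ) l κ (by fun_prop) (by fun_prop) (by fun_prop)
      (by fun_prop) fun p => h0 p.1
  exact ((continuous_eMinus κ hX hT hB hA').mul (hint _)).sub
    ((continuous_ePlus κ hX hT hB hA' h0).mul (hint _))

theorem continuous_dV (x' t' β' ξ' κ : ℝ) (hX : Continuous X) (hT : Continuous T)
    (hB : Continuous Bt) (hA : Continuous A) (hA' : Continuous A') (h0 : ∀ y, T y ≠ 0) :
    Continuous fun y => dV x' t' β' ξ' (X y) (T y) (Bt y) κ (A y) (A' y) := by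
  have h1 := continuous_ePlus κ hX hT hB hA h0
  have h2 := continuous_eMinus κ hX hT hB hA
  have h3 := continuous_ePlus κ hX hT hB hA' h0
  have h4 := continuous_eMinus κ hX hT hB hA'
  have h5 := continuous_V κ hX hT hB hA hA' h0
  have h6 := continuous_G hX hT h0
  have h7 := continuous_hole hB hA
  have h8 := continuous_hole hB hA'
  simp only [dV]
  fun_prop

end Continuity

/-- For `|a - b| ≥ 1` the denominator only helps. For `|a - b| ≤ 1` the averaged derivative is
estimated; all points of the segment lie within distance one of `a`, which costs a factor `e⁵`. -/
theorem exists_norm_V_le (M : ℝ) : ∃ C, 0 < C ∧ ∀ x t β, ParamBound M x t β → ∀ κ a b : ℝ,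
    ‖V x t β κ a b‖ ≤ C * (Real.exp (-(5 * |a|)) * Real.exp (-(5 * |b|))) := by
  obtain ⟨C, hC, hb⟩ := exists_norm_e_le M
  obtain ⟨D, hD, hd⟩ := exists_norm_de_le M
  refine ⟨2 * C * C + 2 * C * (D * Real.exp 5), by positivity, ?_⟩
  intro x t β h κ a b
  have hmono : ∀ ξ : ℝ, Real.exp (-(6 * |ξ|)) ≤ Real.exp (-(5 * |ξ|)) := fun ξ =>
    Real.exp_le_exp.2 (by linarith [abs_nonneg ξ])
  have he : ∀ l ξ, ‖e l x t β κ ξ‖ ≤ C * Real.exp (-(5 * |ξ|)) := fun l ξ =>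
    (hb x t β h l κ ξ).trans (mul_le_mul_of_nonneg_left (hmono ξ) hC.le)
  have hpa := he PM.plus a
  have hma := he PM.minus a
  have hpb := he PM.plus b
  have hmb := he PM.minus b
  simp only [e] at hpa hma hpb hmb
  have hnn : 0 ≤ Real.exp (-(5 * |a|)) * Real.exp (-(5 * |b|)) := by positivity
  rcases le_total 1 |a - b| with hab | hab
  · have h1 : ‖((a : ℂ) - b) * V x t β κ a b‖ ≤
        2 * C * C * (Real.exp (-(5 * |a|)) * Real.exp (-(5 * |b|))) := by
      rw [sub_mul_V]
      refine (norm_sub_le _ _).trans ?_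
      rw [norm_mul, norm_mul]
      refine (add_le_add (mul_le_mul hpa hmb (norm_nonneg _) (by positivity))
        (mul_le_mul hma hpb (norm_nonneg _) (by positivity))).trans (le_of_eq ?_)
      ring
    rw [norm_mul, ← Complex.ofReal_sub, Complex.norm_real, Real.norm_eq_abs] at h1
    have h2 : ‖V x t β κ a b‖ ≤ |a - b| * ‖V x t β κ a b‖ :=
      le_mul_of_one_le_left (norm_nonneg _) hab
    refine (h2.trans h1).trans (mul_le_mul_of_nonneg_right ?_ hnn)
    have : 0 ≤ 2 * C * (D * Real.exp 5) := by positivity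
    linarith
  · have hint : ∀ l, ‖∫ u in (0 : ℝ)..1, de l 0 0 0 1 x t β κ (b + u * (a - b))‖ ≤
        D * Real.exp 5 * Real.exp (-(5 * |a|)) := by
      intro l
      have := intervalIntegral.norm_integral_le_of_norm_le_const (a := (0 : ℝ)) (b := 1)
        (f := fun u => de l 0 0 0 1 x t β κ (b + u * (a - b)))
        (C := D * Real.exp 5 * Real.exp (-(5 * |a|))) ?_
      · simpa using this
      · intro u hu
        rw [Set.uIoc_of_le zero_le_one] at hu
        refine (hd x t β h l 0 0 0 1 κ _ (by simp) (by simp) (by simp) (by simp)).trans ?_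
        rw [mul_assoc, ← Real.exp_add]
        gcongr
        have h1 : |a| ≤ |b + u * (a - b)| + |(1 - u) * (a - b)| := by
          have := abs_add_le (b + u * (a - b)) ((1 - u) * (a - b))
          rwa [show b + u * (a - b) + (1 - u) * (a - b) = a by ring] at this
        have h2 : |(1 - u) * (a - b)| ≤ 1 := by
          rw [abs_mul, abs_of_nonneg (by linarith [hu.2])]
          nlinarith [hu.1, hu.2, abs_nonneg (a - b)]
        linarith
    rw [V_eq_integral h.ne]
    refine (norm_sub_le _ _).trans ?_
    rw [norm_mul, norm_mul]
    refine (add_le_add (mul_le_mul hmb (hint _) (norm_nonneg _) (by positivity))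
        (mul_le_mul hpb (hint _) (norm_nonneg _) (by positivity))).trans ?_
    calc _ = 2 * C * (D * Real.exp 5) * (Real.exp (-(5 * |a|)) * Real.exp (-(5 * |b|))) := by ring
      _ ≤ _ := by
        refine mul_le_mul_of_nonneg_right ?_ hnn
        have : 0 ≤ 2 * C * C := by positivity
        linarith

theorem exists_norm_dV_le (M : ℝ) : ∃ C, 0 < C ∧ ∀ x t β, ParamBound M x t β →
    ∀ x' t' β' ξ' κ a b : ℝ, |x'| ≤ 1 → |t'| ≤ 1 → |β'| ≤ 1 → |ξ'| ≤ 1 →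
    ‖dV x' t' β' ξ' x t β κ a b‖ ≤ C * (Real.exp (-(4 * |a|)) * Real.exp (-(4 * |b|))) := by
  obtain ⟨C, hC, hb⟩ := exists_norm_e_le M
  obtain ⟨D, hD, hd⟩ := exists_norm_V_le M
  refine ⟨6 * D + (3 + 2 * |M|) * (2 * C * C) + 2 * |M| * (C * C), by positivity, ?_⟩
  intro x t β h x' t' β' ξ' κ a b hx ht hβ hξ
  have hmono : ∀ ξ : ℝ, Real.exp (-(6 * |ξ|)) ≤ Real.exp (-(5 * |ξ|)) := fun ξ =>
    Real.exp_le_exp.2 (by linarith [abs_nonneg ξ])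
  have he : ∀ l ξ, ‖e l x t β κ ξ‖ ≤ C * Real.exp (-(5 * |ξ|)) := fun l ξ =>
    (hb x t β h l κ ξ).trans (mul_le_mul_of_nonneg_left (hmono ξ) hC.le)
  have hpa := he PM.plus a
  have hma := he PM.minus a
  have hpb := he PM.plus b
  have hmb := he PM.minus b
  simp only [e] at hpa hma hpb hmb
  have hMM : M ≤ |M| := le_abs_self M
  have hM : 0 ≤ |M| := abs_nonneg M
  set E := Real.exp |a| * Real.exp |b| with hE
  set F := Real.exp (-(5 * |a|)) * Real.exp (-(5 * |b|)) with hF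
  have hF0 : 0 ≤ F := by positivity
  have hEF : E * F = Real.exp (-(4 * |a|)) * Real.exp (-(4 * |b|)) := by
    rw [hE, hF, ← Real.exp_add, ← Real.exp_add, ← Real.exp_add, ← Real.exp_add]; congr 1; ring
  have ha1 : 1 ≤ Real.exp |a| := Real.one_le_exp (abs_nonneg _)
  have hb1 : 1 ≤ Real.exp |b| := Real.one_le_exp (abs_nonneg _)
  have haE : Real.exp |a| ≤ E := le_mul_of_one_le_right (by positivity) hb1
  have hbE : Real.exp |b| ≤ E := le_mul_of_one_le_left (by positivity) ha1
  have h1E : 1 ≤ E := ha1.trans haE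
  have p : ∀ ξ, |(β' - 2 * ξ * ξ') * hole β ξ| ≤ 3 * Real.exp |ξ| := by
    intro ξ
    have h0 : 1 ≤ Real.exp |ξ| := Real.one_le_exp (abs_nonneg _)
    have h1 := abs_le_exp_abs ξ
    rw [abs_mul]
    calc _ ≤ (|β'| + |2 * ξ * ξ'|) * 1 :=
          mul_le_mul (abs_sub _ _) (abs_hole_le _ _) (abs_nonneg _) (by positivity)
      _ = |β'| + 2 * |ξ| * |ξ'| := by simp only [abs_mul, abs_two, mul_one]
      _ ≤ 1 + 2 * Real.exp |ξ| * 1 := by gcongr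
      _ ≤ _ := by linarith
  have t1 : ‖(((β' - 2 * a * ξ') * hole β a + (β' - 2 * b * ξ') * hole β b : ℝ) : ℂ) *
      V x t β κ a b‖ ≤ 6 * E * (D * F) := by
    rw [norm_mul, Complex.norm_real, Real.norm_eq_abs]
    refine mul_le_mul ?_ (hd x t β h κ a b) (norm_nonneg _) (by positivity)
    refine (abs_add_le _ _).trans ?_
    linarith [p a, p b]
  have t2 : ‖Complex.I * ((t' * (a + b) + 2 * t * ξ' + x' : ℝ) : ℂ) *
      (ePlus x t β κ a * eMinus x t β κ b + eMinus x t β κ a * ePlus x t β κ b)‖ ≤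
      (3 + 2 * |M|) * E * (2 * C * C * F) := by
    rw [norm_mul, norm_mul, Complex.norm_I, one_mul, Complex.norm_real, Real.norm_eq_abs]
    refine mul_le_mul ?_ ?_ (norm_nonneg _) (by positivity)
    · calc |t' * (a + b) + 2 * t * ξ' + x'| ≤ |t'| * (|a| + |b|) + 2 * |t| * |ξ'| + |x'| := by
            refine (abs_add_three _ _ _).trans ?_
            rw [abs_mul t', abs_mul _ ξ', abs_mul 2, abs_two]
            gcongr
            exact abs_add_le _ _
        _ ≤ 1 * (E + E) + 2 * |M| * 1 + 1 := by
            have g1 := (abs_le_exp_abs a).trans haE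
            have g2 := (abs_le_exp_abs b).trans hbE
            have g3 := h.t_le.trans hMM
            refine add_le_add (add_le_add (mul_le_mul ht (add_le_add g1 g2) ?_ zero_le_one)
              (mul_le_mul ?_ hξ (abs_nonneg _) ?_)) hx
            · positivity
            · linarith
            · positivity
        _ ≤ _ := by nlinarith
    · refine (norm_add_le _ _).trans ?_
      rw [norm_mul, norm_mul]
      refine (add_le_add (mul_le_mul hpa hmb (norm_nonneg _) (by positivity))
        (mul_le_mul hma hpb (norm_nonneg _) (by positivity))).trans (le_of_eq ?_)
      rw [hF]; ring
  have t3 : ‖2 * Complex.I * G x t * t' * (eMinus x t β κ a * eMinus x t β κ b)‖ ≤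
      2 * |M| * (C * C * F) * E := by
    rw [norm_mul, norm_mul, norm_mul, norm_mul, norm_mul, Complex.norm_I, mul_one,
      Complex.norm_real, Real.norm_eq_abs]
    have h2 : ‖(2 : ℂ)‖ = 2 := by simp
    rw [h2]
    calc _ ≤ 2 * |M| * 1 * ((C * Real.exp (-(5 * |a|))) * (C * Real.exp (-(5 * |b|)))) := by
          gcongr
          exact h.G_le.trans hMM
      _ = 2 * |M| * (C * C * F) * 1 := by rw [hF]; ring
      _ ≤ _ := by gcongr
  rw [dV, ← hEF]
  refine (norm_sub_le _ _).trans ((add_le_add ((norm_sub_le _ _).trans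
    (add_le_add t1 t2)) t3).trans (le_of_eq ?_))
  ring

end ImpenetrableAnyons

/-! ### Exponential weights and mean value estimates -/

namespace FredholmTheory

/-- The weight `C e^{-|a|}`. -/
noncomputable def expWeight (C a : ℝ) : ℝ := C * Real.exp (-|a|)

theorem expWeight_pos {C : ℝ} (hC : 0 < C) (a : ℝ) : 0 < expWeight C a :=
  mul_pos hC (Real.exp_pos _)

theorem integrable_exp_neg_abs : Integrable fun a : ℝ => Real.exp (-|a|) := by
  have h1 : IntegrableOn (fun a : ℝ => Real.exp (-|a|)) (Set.Ioi 0) := by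
    refine (integrableOn_exp_neg_Ioi 0).congr_fun (fun a ha => ?_) measurableSet_Ioi
    simp only [abs_of_pos (Set.mem_Ioi.1 ha)]
  have h2 : IntegrableOn (fun a : ℝ => Real.exp (-|a|)) (Set.Iic 0) := by
    refine (integrableOn_exp_Iic 0).congr_fun (fun a ha => ?_) measurableSet_Iic
    simp only [abs_of_nonpos (Set.mem_Iic.1 ha), neg_neg]
  rw [← integrableOn_univ, ← Set.Iic_union_Ioi (a := (0 : ℝ))]
  exact h2.union h1

theorem isWeight_expWeight {C : ℝ} (hC : 0 < C) : IsWeight (expWeight C) where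
  cont := by unfold expWeight; fun_prop
  pos := expWeight_pos hC
  int := by
    refine (integrable_exp_neg_abs.const_mul (C * C)).mono' ?_ (ae_of_all _ fun a => ?_)
    · exact Continuous.aestronglyMeasurable (by unfold expWeight; fun_prop)
    · have h1 : Real.exp (-|a|) ≤ 1 := Real.exp_le_one_iff.2 (by linarith [abs_nonneg a])
      rw [Real.norm_of_nonneg (mul_nonneg (expWeight_pos hC a).le (expWeight_pos hC a).le)]
      have h2 := Real.exp_pos (-|a|)
      calc expWeight C a * expWeight C a = C * C * (Real.exp (-|a|) * Real.exp (-|a|)) := by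
            unfold expWeight; ring
        _ ≤ C * C * (Real.exp (-|a|) * 1) := by gcongr
        _ = _ := by ring

theorem integrable_abs_mul_expWeight {C : ℝ} (hC : 0 < C) :
    Integrable fun a => |a| * (expWeight C a * expWeight C a) := by
  refine (integrable_exp_neg_abs.const_mul (C * C)).mono' ?_ (ae_of_all _ fun a => ?_)
  · exact Continuous.aestronglyMeasurable (by unfold expWeight; fun_prop)
  · have h1 : |a| * Real.exp (-|a|) ≤ 1 := by
      rw [Real.exp_neg, ← div_eq_mul_inv, div_le_one (Real.exp_pos _)]
      linarith [Real.add_one_le_exp |a|]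
    rw [Real.norm_of_nonneg (mul_nonneg (abs_nonneg a)
      (mul_nonneg (expWeight_pos hC a).le (expWeight_pos hC a).le))]
    calc _ = C * C * (Real.exp (-|a|) * (|a| * Real.exp (-|a|))) := by unfold expWeight; ring
      _ ≤ C * C * (Real.exp (-|a|) * 1) := by gcongr
      _ = _ := by ring

/-- A mean value estimate, uniform in an index. -/
theorem eventually_norm_sub_le_of_hasDerivAt {ι : Type*} {F F' : ℝ → ι → ℂ} {bd : ι → ℝ} {s : ℝ}
    (h : ∀ᶠ r in 𝓝 s, ∀ i, HasDerivAt (fun r => F r i) (F' r i) r ∧ ‖F' r i‖ ≤ bd i) :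
    ∀ᶠ r in 𝓝 s, ∀ i, ‖F r i - F s i‖ ≤ |r - s| * bd i := by
  obtain ⟨ε, hε, hb⟩ := Metric.eventually_nhds_iff_ball.1 h
  filter_upwards [Metric.ball_mem_nhds s hε] with r hr i
  have := (convex_ball s ε).norm_image_sub_le_of_norm_hasDerivWithin_le
    (f := fun r => F r i) (f' := fun r => F' r i) (C := bd i)
    (fun x hx => ((hb x hx i).1).hasDerivWithinAt) (fun x hx => (hb x hx i).2)
    (Metric.mem_ball_self hε) hr
  rwa [Real.norm_eq_abs, mul_comm] at this

variable {w w' : ℝ → ℝ} {g : ℝ → ℝ → ℂ} {g' : ℝ → ℂ} {s : ℝ}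

/-- Serves to change the weight (with `φ = 1`) and to multiply by the spectral variable, which is
paid for by a slower decay. -/
theorem DiffFam.continuous_mul {φ : ℝ → ℂ} (hφ : Continuous φ) {c : ℝ} (hc : 0 ≤ c)
    (hb : ∀ a, ‖φ a‖ * w a ≤ c * w' a) (hg : DiffFam w g g' s) :
    DiffFam w' (fun r a => φ a * g r a) (fun a => φ a * g' a) s where
  cont := hg.cont.mono fun r h => hφ.mul h
  bdd := by
    obtain ⟨d, hd, h⟩ := hg.bdd
    refine ⟨d * c, mul_nonneg hd hc, fun a => ?_⟩
    rw [norm_mul]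
    calc ‖φ a‖ * ‖g s a‖ ≤ ‖φ a‖ * (d * w a) := by gcongr; exact h a
      _ = d * (‖φ a‖ * w a) := by ring
      _ ≤ d * (c * w' a) := mul_le_mul_of_nonneg_left (hb a) hd
      _ = _ := by ring
  lip := by
    obtain ⟨d, hd, h⟩ := hg.lip
    refine ⟨d * c, mul_nonneg hd hc, h.mono fun r h a => ?_⟩
    rw [← mul_sub, norm_mul]
    calc ‖φ a‖ * ‖g r a - g s a‖ ≤ ‖φ a‖ * (|r - s| * (d * w a)) := by gcongr; exact h a
      _ = |r - s| * (d * (‖φ a‖ * w a)) := by ring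
      _ ≤ |r - s| * (d * (c * w' a)) :=
        mul_le_mul_of_nonneg_left (mul_le_mul_of_nonneg_left (hb a) hd) (abs_nonneg _)
      _ = _ := by ring
  deriv a := (hg.deriv a).const_mul (φ a)

end FredholmTheory

/-! ### The kernel along curves in parameter space -/

namespace ImpenetrableAnyons

open FredholmTheory

/-- A curve in parameter space with constant velocity, at most one in every direction. -/
structure ParamCurve (X T Bt Z : ℝ → ℝ) (x' t' β' ξ' s : ℝ) : Prop where
  hasDerivAt_x : ∀ r, HasDerivAt X x' r
  hasDerivAt_t : ∀ r, HasDerivAt T t' r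
  hasDerivAt_β : ∀ r, HasDerivAt Bt β' r
  hasDerivAt_shift : ∀ r, HasDerivAt Z ξ' r
  x_le : |x'| ≤ 1
  t_le : |t'| ≤ 1
  β_le : |β'| ≤ 1
  shift_le : |ξ'| ≤ 1
  shift_zero : Z s = 0
  ne : T s ≠ 0

namespace ParamCurve

variable {X T Bt Z : ℝ → ℝ} {x' t' β' ξ' s : ℝ}

theorem exists_bound (hc : ParamCurve X T Bt Z x' t' β' ξ' s) :
    ∃ M, 0 < M ∧ ∀ᶠ r in 𝓝 s, ParamBound M (X r) (T r) (Bt r) ∧ |Z r| ≤ 1 := by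
  obtain ⟨M, hM, h⟩ := exists_paramBound
    (continuous_iff_continuousAt.2 fun r => (hc.hasDerivAt_x r).continuousAt)
    (continuous_iff_continuousAt.2 fun r => (hc.hasDerivAt_t r).continuousAt)
    (continuous_iff_continuousAt.2 fun r => (hc.hasDerivAt_β r).continuousAt) hc.ne
  refine ⟨M, hM, h.and ?_⟩
  have h1 := (hc.hasDerivAt_shift s).continuousAt.abs
  exact (h1.eventually_lt_const (u := 1) (by simp [hc.shift_zero])).mono fun r h => h.le

theorem exp_shift_le {k a z : ℝ} (hk : 0 ≤ k) (hz : |z| ≤ 1) :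
    Real.exp (-(k * |a + z|)) ≤ Real.exp k * Real.exp (-(k * |a|)) := by
  rw [← Real.exp_add]
  refine Real.exp_le_exp.2 ?_
  have h1 : |a| ≤ |a + z| + |z| := by
    have := abs_sub (a + z) z
    rwa [add_sub_cancel_right] at this
  nlinarith

/-- The functions `e₊` and `e₋` along a curve form a differentiable family. -/
theorem diffFam_e (hc : ParamCurve X T Bt Z x' t' β' ξ' s) (l : PM) (κ : ℝ) :
    DiffFam (fun a => Real.exp (-(4 * |a|))) (fun r a => e l (X r) (T r) (Bt r) κ (a + Z r))
      (de l x' t' β' ξ' (X s) (T s) (Bt s) κ) s := by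
  obtain ⟨M, hM, hev⟩ := hc.exists_bound
  obtain ⟨C, hC, hb⟩ := exists_norm_e_le M
  obtain ⟨D, hD, hd⟩ := exists_norm_de_le M
  have hder : ∀ r, T r ≠ 0 → ∀ a, HasDerivAt (fun r => e l (X r) (T r) (Bt r) κ (a + Z r))
      (de l x' t' β' ξ' (X r) (T r) (Bt r) κ (a + Z r)) r := fun r hr a =>
    hasDerivAt_e l κ (hc.hasDerivAt_x r) (hc.hasDerivAt_t r) (hc.hasDerivAt_β r)
      ((hc.hasDerivAt_shift r).const_add a) hr
  have hmono : ∀ {k : ℝ}, 4 ≤ k → ∀ ξ : ℝ, Real.exp (-(k * |ξ|)) ≤ Real.exp (-(4 * |ξ|)) :=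
    fun hk ξ => Real.exp_le_exp.2 (by nlinarith [abs_nonneg ξ])
  constructor
  · filter_upwards [hev] with r hr
    exact continuous_e l κ continuous_const continuous_const continuous_const (by fun_prop)
      fun _ => hr.1.ne
  · refine ⟨C, hC.le, fun a => ?_⟩
    rw [hc.shift_zero, add_zero]
    exact (hb _ _ _ hev.self_of_nhds.1 l κ a).trans
      (mul_le_mul_of_nonneg_left (hmono (by norm_num) a) hC.le)
  · refine ⟨D * Real.exp 4, by positivity, ?_⟩
    refine eventually_norm_sub_le_of_hasDerivAt
      (F' := fun r a => de l x' t' β' ξ' (X r) (T r) (Bt r) κ (a + Z r)) ?_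
    filter_upwards [hev] with r hr a
    refine ⟨hder r hr.1.ne a, (hd _ _ _ hr.1 l x' t' β' ξ' κ _ hc.x_le hc.t_le hc.β_le
      hc.shift_le).trans ?_⟩
    rw [mul_assoc]
    exact mul_le_mul_of_nonneg_left ((hmono (by norm_num) _).trans
      (exp_shift_le (by norm_num) hr.2)) hD.le
  · intro a
    have := hder s hc.ne a
    rwa [hc.shift_zero, add_zero] at this

/-- The kernels `V` along a curve form a differentiable family. -/
theorem exists_diffKer_V (hc : ParamCurve X T Bt Z x' t' β' ξ' s) (κ : ℝ) : ∃ C, 0 < C ∧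
    DiffKer (expWeight C) (fun r a b => V (X r) (T r) (Bt r) κ (a + Z r) (b + Z r))
      (dV x' t' β' ξ' (X s) (T s) (Bt s) κ) s := by
  obtain ⟨M, hM, hev⟩ := hc.exists_bound
  obtain ⟨C, hC, hb⟩ := exists_norm_V_le M
  obtain ⟨D, hD, hd⟩ := exists_norm_dV_le M
  -- The weight enters the kernel bound twice, so what is needed is `(C + D) e⁸ ≤ A²`. The added one
  -- ensures `A ≤ A²`.
  set A := (C + D) * (Real.exp 4 * Real.exp 4) + 1 with hA
  have hA1 : 1 ≤ A := by rw [hA]; linarith [show 0 < (C + D) * (Real.exp 4 * Real.exp 4) by positivity]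
  have hA0 : 0 < A := by linarith
  have key : ∀ {E a b z : ℝ}, 0 ≤ E → E ≤ C + D → |z| ≤ 1 →
      E * (Real.exp (-(4 * |a + z|)) * Real.exp (-(4 * |b + z|))) ≤
        expWeight A a * expWeight A b := by
    intro E a b z hE hED hz
    have hm : ∀ ξ : ℝ, Real.exp (-(4 * |ξ|)) ≤ Real.exp (-|ξ|) := fun ξ =>
      Real.exp_le_exp.2 (by linarith [abs_nonneg ξ])
    have h1 : ∀ ξ, Real.exp (-(4 * |ξ + z|)) ≤ Real.exp 4 * Real.exp (-|ξ|) := fun ξ =>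
      (exp_shift_le (by norm_num) hz).trans (mul_le_mul_of_nonneg_left (hm ξ) (Real.exp_pos _).le)
    calc _ ≤ (C + D) * ((Real.exp 4 * Real.exp (-|a|)) * (Real.exp 4 * Real.exp (-|b|))) := by
          refine mul_le_mul hED (mul_le_mul (h1 a) (h1 b) ?_ ?_) ?_ ?_ <;> positivity
      _ = ((C + D) * (Real.exp 4 * Real.exp 4)) * (Real.exp (-|a|) * Real.exp (-|b|)) := by ring
      _ ≤ (A * A) * (Real.exp (-|a|) * Real.exp (-|b|)) := by
          refine mul_le_mul_of_nonneg_right ?_ (by positivity)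
          nlinarith
      _ = _ := by unfold expWeight; ring
  have hder : ∀ r, T r ≠ 0 → ∀ a b,
      HasDerivAt (fun r => V (X r) (T r) (Bt r) κ (a + Z r) (b + Z r))
      (dV x' t' β' ξ' (X r) (T r) (Bt r) κ (a + Z r) (b + Z r)) r := fun r hr a b =>
    hasDerivAt_V κ a b (hc.hasDerivAt_x r) (hc.hasDerivAt_t r) (hc.hasDerivAt_β r)
      (hc.hasDerivAt_shift r) hr
  refine ⟨A, hA0, ?_⟩
  constructor
  · filter_upwards [hev] with r hr
    refine ⟨?_, fun a b => ?_⟩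
    · exact continuous_V (Y := ℝ × ℝ) κ continuous_const continuous_const continuous_const
        (by fun_prop) (by fun_prop) fun _ => hr.1.ne
    · refine (hb _ _ _ hr.1 κ _ _).trans (le_trans ?_ (key (E := C) hC.le (by linarith) hr.2))
      gcongr <;> norm_num
  · exact Eventually.of_forall fun r a b => V_symm _ _ _ _ _ _
  · refine ⟨?_, fun a b => ?_⟩
    · exact continuous_dV (Y := ℝ × ℝ) x' t' β' ξ' κ continuous_const continuous_const
        continuous_const (by fun_prop) (by fun_prop) fun _ => hc.ne
    · have := key (E := D) (a := a) (b := b) (z := 0) hD.le (by linarith) (by simp)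
      rw [add_zero, add_zero] at this
      exact (hd _ _ _ hev.self_of_nhds.1 x' t' β' ξ' κ a b hc.x_le hc.t_le hc.β_le
        hc.shift_le).trans this
  · have := eventually_norm_sub_le_of_hasDerivAt (ι := ℝ × ℝ) (s := s)
      (F := fun r p => V (X r) (T r) (Bt r) κ (p.1 + Z r) (p.2 + Z r))
      (F' := fun r p => dV x' t' β' ξ' (X r) (T r) (Bt r) κ (p.1 + Z r) (p.2 + Z r))
      (bd := fun p => expWeight A p.1 * expWeight A p.2) ?_
    · exact this.mono fun r h a b => h (a, b)
    · filter_upwards [hev] with r hr p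
      exact ⟨hder r hr.1.ne _ _, (hd _ _ _ hr.1 x' t' β' ξ' κ _ _ hc.x_le hc.t_le hc.β_le
        hc.shift_le).trans (key (E := D) hD.le (by linarith) hr.2)⟩
  · intro a b
    have := hder s hc.ne a b
    rwa [hc.shift_zero, add_zero, add_zero] at this

theorem diffFam_e_expWeight (hc : ParamCurve X T Bt Z x' t' β' ξ' s) (l : PM) (κ : ℝ) {C : ℝ}
    (hC : 0 < C) : DiffFam (expWeight C) (fun r a => e l (X r) (T r) (Bt r) κ (a + Z r))
      (de l x' t' β' ξ' (X s) (T s) (Bt s) κ) s := by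
  have := (hc.diffFam_e l κ).continuous_mul (φ := fun _ => 1) (w' := expWeight C) continuous_const
    (c := C⁻¹) (by positivity) fun a => ?_
  · simpa using this
  · rw [expWeight, norm_one, one_mul, inv_mul_cancel_left₀ hC.ne']
    exact Real.exp_le_exp.2 (by linarith [abs_nonneg a])

theorem diffFam_id_mul_e (hc : ParamCurve X T Bt Z x' t' β' ξ' s) (l : PM) (κ : ℝ) {C : ℝ}
    (hC : 0 < C) : DiffFam (expWeight C)
      (fun r a => (a : ℂ) * e l (X r) (T r) (Bt r) κ (a + Z r))
      (fun a => (a : ℂ) * de l x' t' β' ξ' (X s) (T s) (Bt s) κ a) s := by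
  refine (hc.diffFam_e l κ).continuous_mul (φ := fun a => (a : ℂ)) (w' := expWeight C)
    (by fun_prop) (c := C⁻¹) (by positivity) fun a => ?_
  rw [expWeight, inv_mul_cancel_left₀ hC.ne', Complex.norm_real, Real.norm_eq_abs]
  calc |a| * Real.exp (-(4 * |a|)) ≤ Real.exp |a| * Real.exp (-(4 * |a|)) := by
        gcongr; exact abs_le_exp_abs a
    _ = Real.exp (-(3 * |a|)) := by rw [← Real.exp_add]; congr 1; ring
    _ ≤ _ := Real.exp_le_exp.2 (by linarith [abs_nonneg a])

end ParamCurve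

theorem paramCurve_x (x t β : ℝ) (ht : t ≠ 0) :
    ParamCurve (fun r => r) (fun _ => t) (fun _ => β) (fun _ => 0) 1 0 0 0 x :=
  ⟨hasDerivAt_id, fun r => hasDerivAt_const r t, fun r => hasDerivAt_const r β,
    fun r => hasDerivAt_const r 0, by simp, by simp, by simp, by simp, rfl, ht⟩

theorem paramCurve_t (x t β : ℝ) (ht : t ≠ 0) :
    ParamCurve (fun _ => x) (fun r => r) (fun _ => β) (fun _ => 0) 0 1 0 0 t :=
  ⟨fun r => hasDerivAt_const r x, hasDerivAt_id, fun r => hasDerivAt_const r β,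
    fun r => hasDerivAt_const r 0, by simp, by simp, by simp, by simp, rfl, ht⟩

theorem paramCurve_β (x t β : ℝ) (ht : t ≠ 0) :
    ParamCurve (fun _ => x) (fun _ => t) (fun r => r) (fun _ => 0) 0 0 1 0 β :=
  ⟨fun r => hasDerivAt_const r x, fun r => hasDerivAt_const r t, hasDerivAt_id,
    fun r => hasDerivAt_const r 0, by simp, by simp, by simp, by simp, rfl, ht⟩

/-- The parameters are fixed and both spectral variables are translated; this direction gives the
derivative of a solution in its own argument. -/
theorem paramCurve_shift (x t β : ℝ) (ht : t ≠ 0) :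
    ParamCurve (fun _ => x) (fun _ => t) (fun _ => β) (fun r => r) 0 0 0 1 0 :=
  ⟨fun r => hasDerivAt_const r x, fun r => hasDerivAt_const r t, fun r => hasDerivAt_const r β,
    hasDerivAt_id, by simp, by simp, by simp, by simp, rfl, ht⟩

/-- Local bounds on the parameters provide a single weight near `q₀`. Continuity is needed in all
three parameters jointly, for the branch of the logarithm. -/
theorem continuousAt_detV (κ : ℝ) {q₀ : ℝ × ℝ × ℝ} (h0 : q₀.2.1 ≠ 0) :
    ContinuousAt (fun q : ℝ × ℝ × ℝ => detV q.1 q.2.1 q.2.2 κ) q₀ := by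
  obtain ⟨M, hM, hev⟩ := exists_paramBound (Y := ℝ × ℝ × ℝ) (X := fun q => q.1)
    (T := fun q => q.2.1) (Bt := fun q => q.2.2) (s := q₀) (by fun_prop) (by fun_prop)
    (by fun_prop) h0
  obtain ⟨C, hC, hb⟩ := exists_norm_V_le M
  have hA : 0 < C + 1 := by linarith
  refine tendsto_fredholmDet (isWeight_expWeight hA) ?_ ?_
  · filter_upwards [hev] with q hq
    refine ⟨?_, fun a b => ?_⟩
    · exact continuous_V (Y := ℝ × ℝ) κ continuous_const continuous_const continuous_const
        (by fun_prop) (by fun_prop) fun _ => hq.ne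
    · refine (hb _ _ _ hq κ a b).trans ?_
      have hm : ∀ ξ : ℝ, Real.exp (-(5 * |ξ|)) ≤ Real.exp (-|ξ|) := fun ξ =>
        Real.exp_le_exp.2 (by linarith [abs_nonneg ξ])
      calc _ ≤ ((C + 1) * (C + 1)) * (Real.exp (-|a|) * Real.exp (-|b|)) := by
            refine mul_le_mul (by nlinarith) (mul_le_mul (hm a) (hm b) ?_ ?_) ?_ ?_ <;> positivity
        _ = _ := by unfold expWeight; ring
  · intro a b
    have hopen : IsOpen {q : ℝ × ℝ × ℝ | q.2.1 ≠ 0} := isOpen_ne_fun (by fun_prop) (by fun_prop)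
    have : ContinuousOn (fun q : ℝ × ℝ × ℝ => V q.1 q.2.1 q.2.2 κ a b)
        {q : ℝ × ℝ × ℝ | q.2.1 ≠ 0} := by
      rw [continuousOn_iff_continuous_domRestrict]
      exact continuous_V κ (by fun_prop) (by fun_prop) (by fun_prop) continuous_const
        continuous_const fun q => q.2
    exact this.continuousAt (hopen.mem_nhds h0)

end ImpenetrableAnyons

/-! ### Traces and identities for kernels of integrable form -/

namespace FredholmTheory

open ImpenetrableAnyons (fredholmDet)

variable {w : ℝ → ℝ} {K L : ℝ → ℝ → ℂ} {Ks : ℝ → ℝ → ℝ → ℂ} {f g h u v α : ℝ → ℂ} {s : ℝ}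

theorem integrable_prod_of_norm_le {F : ℝ × ℝ → ℂ} {φ ψ : ℝ → ℝ} (hF : Continuous F)
    (hφ : Integrable φ) (hψ : Integrable ψ) (hb : ∀ a b, ‖F (a, b)‖ ≤ φ a * ψ b) :
    Integrable F (volume.prod volume) :=
  (hφ.mul_prod hψ).mono' hF.aestronglyMeasurable (ae_of_all _ fun p => hb p.1 p.2)

theorem IsBdd.bdd_mul (hα : Continuous α) (hα1 : ∀ a, ‖α a‖ ≤ 1) (hg : IsBdd w g) :
    IsBdd w fun a => α a * g a := by
  obtain ⟨hc, c, h0, hb⟩ := hg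
  refine ⟨hα.mul hc, c, h0, fun a => ?_⟩
  rw [norm_mul]
  exact (mul_le_of_le_one_left (norm_nonneg _) (hα1 a)).trans (hb a)

theorem IsBddKernel.integrable_diag (hw : IsWeight w) (hK : IsBddKernel w K) :
    Integrable fun a => K a a := by
  obtain ⟨hc, c, h0, hb⟩ := hK
  have : Continuous fun a => K a a := hc.comp (continuous_id.prodMk continuous_id)
  exact (hw.int.const_mul c).mono' this.aestronglyMeasurable (ae_of_all _ fun a => hb a a)

theorem IsBdd.abs_mul_adm (hw1 : Integrable fun a => |a| * (w a * w a)) (hw : IsWeight w)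
    (hg : IsBdd w g) : IsAdm w fun a => (a : ℂ) * g a := by
  obtain ⟨hc, c, h0, hb⟩ := hg
  have hcont : Continuous fun a : ℝ => (a : ℂ) * g a := Complex.continuous_ofReal.mul hc
  refine ⟨hcont.aestronglyMeasurable, (hw1.const_mul c).mono'
    (hw.cont.mul hcont.norm).aestronglyMeasurable (ae_of_all _ fun a => ?_)⟩
  have h3 := (hw.pos a).le
  rw [Real.norm_of_nonneg (mul_nonneg h3 (norm_nonneg _)), norm_mul, Complex.norm_real,
    Real.norm_eq_abs]
  calc _ ≤ w a * (|a| * (c * w a)) := by gcongr; exact hb a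
    _ = _ := by ring

namespace IsRegular

variable (H : IsRegular w K)
include H

/-- The trace of a finite rank perturbation composed with the inverse. -/
theorem trace_finite_rank {n : ℕ} {φ ψ : Fin n → ℝ → ℂ} {c : Fin n → ℂ} (hφ : ∀ i, IsBdd w (φ i))
    (hψ : ∀ i, IsBdd w (ψ i)) (hL : ∀ a b, L a b = ∑ i, c i * (φ i a * ψ i b)) :
    ∫ x, (L x x - ∫ y, L x y * res K y x) = ∑ i, c i * ∫ x, φ i x * inv K (ψ i) x := by
  have hcol := fun x => (H.res_bdd.col H.weight x).adm H.weight
  have hpt : ∀ x, L x x - ∫ y, L x y * res K y x = ∑ i, c i * (φ i x * inv K (ψ i) x) := by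
    intro x
    have h1 : ∫ y, L x y * res K y x = ∑ i, c i * (φ i x * op (res K) (ψ i) x) := by
      calc _ = ∫ y, ∑ i, (c i * φ i x) * (ψ i y * res K y x) := by
            congr 1; ext y; rw [hL, Finset.sum_mul]; congr 1; ext i; ring
        _ = ∑ i, (c i * φ i x) * ∫ y, ψ i y * res K y x := by
            rw [integral_finsetSum _ fun i _ => ((hψ i).integrable_mul (hcol x)).const_mul _]
            simp_rw [integral_const_mul]
        _ = _ := by
            refine Finset.sum_congr rfl fun i _ => ?_
            rw [op, mul_assoc]
            congr 3; ext y
            rw [H.res_symm y x, mul_comm]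
    rw [h1, hL, ← Finset.sum_sub_distrib]
    refine Finset.sum_congr rfl fun i _ => ?_
    rw [inv]; ring
  simp_rw [hpt]
  rw [integral_finsetSum _ fun i _ => ((hφ i).integrable_mul
    ((H.inv_bdd (hψ i)).adm H.weight)).const_mul _]
  simp_rw [integral_const_mul]

/-- The trace of the logarithmic derivative in a direction in which the kernel is multiplied by a
function of either argument. -/
theorem trace_multiplier (hα : Continuous α) (hα1 : ∀ a, ‖α a‖ ≤ 1)
    (hL : ∀ a b, L a b = (α a + α b) * K a b) :
    ∫ x, (L x x - ∫ y, L x y * res K y x) = 2 * ∫ x, α x * res K x x := by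
  have hK := H.kernel.isBdd
  have hR := H.res_bdd
  have hKd := hK.integrable_diag H.weight
  have hRd := hR.integrable_diag H.weight
  have hbound : ∀ {g : ℝ → ℂ}, Integrable g → Integrable fun a => α a * g a := fun hg =>
    Integrable.bdd_mul (c := 1) hg hα.aestronglyMeasurable (ae_of_all _ hα1)
  have hrow := fun x => hK.row H.weight x
  have hcol := fun x => (hR.col H.weight x)
  have hF : Integrable (fun p : ℝ × ℝ => α p.2 * (K p.1 p.2 * res K p.2 p.1))
      (volume.prod volume) := by
    obtain ⟨k1, c, hc, k2⟩ := hK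
    obtain ⟨r1, d, hd, r2⟩ := hR
    have r1' : Continuous fun p : ℝ × ℝ => res K p.2 p.1 := by
      rw [show (fun p : ℝ × ℝ => res K p.2 p.1) = fun p => res K p.1 p.2 from
        funext fun p => H.res_symm _ _]
      exact r1
    refine integrable_prod_of_norm_le (φ := fun a => c * d * (w a * w a))
      (ψ := fun a => w a * w a) ((hα.comp continuous_snd).mul (k1.mul r1'))
      (H.weight.int.const_mul _) H.weight.int fun a b => ?_
    have hwa := (H.weight.pos a).le
    have hwb := (H.weight.pos b).le
    rw [norm_mul, norm_mul]
    calc _ ≤ 1 * ((c * (w a * w b)) * (d * (w b * w a))) :=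
          mul_le_mul (hα1 b) (mul_le_mul (k2 a b) (r2 b a) (norm_nonneg _) (by positivity))
            (by positivity) zero_le_one
      _ = _ := by ring
  -- With the multiplier at the outer variable, `K R = K - R` on the diagonal evaluates the inner
  -- integral. With the multiplier at the inner variable Fubini is needed first.
  have hpt : ∀ x, L x x - ∫ y, L x y * res K y x =
      α x * K x x + α x * res K x x - ∫ y, α y * (K x y * res K y x) := by
    intro x
    have i1 : Integrable fun y => K x y * res K y x :=
      (hrow x).integrable_mul ((hcol x).adm H.weight)
    have h1 : ∫ y, L x y * res K y x =
        α x * (∫ y, K x y * res K y x) + ∫ y, α y * (K x y * res K y x) := by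
      rw [← integral_const_mul, ← integral_add (i1.const_mul _) (hbound i1)]
      congr 1; ext y; rw [hL]; ring
    rw [h1, hL, H.res_eq x x]
    ring
  -- After the exchange `R K = K - R` applies, and the integrals of `α K` over the diagonal cancel
  -- from the total.
  have hswap : ∫ x, ∫ y, α y * (K x y * res K y x) = ∫ y, α y * (K y y - res K y y) := by
    rw [integral_integral_swap hF]
    congr 1; ext y
    rw [integral_const_mul]
    congr 1
    rw [H.res_eq' y y, sub_sub_cancel]
    congr 1; ext x; ring
  have k1 : Integrable fun x => α x * K x x + α x * res K x x := (hbound hKd).add (hbound hRd)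
  have k2 : Integrable fun x => ∫ y, α y * (K x y * res K y x) := hF.integral_prod_left
  simp_rw [hpt]
  rw [integral_sub k1 k2,
    integral_add (hbound hKd) (hbound hRd), hswap]
  simp_rw [mul_sub]
  rw [integral_sub (hbound hKd) (hbound hRd)]
  ring

theorem inv_op (hg : IsAdm w g) (x : ℝ) : inv K (op K g) x = g x - inv K g x := by
  have hop := (H.kernel.isBdd.op_bdd H.weight hg).adm H.weight
  have h1 := H.inv_add hg hop x
  rw [H.inv_add_op hg x] at h1
  rw [h1]; ring

/-- The diagonal of the resolvent of a kernel of integrable form. -/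
theorem res_diag (hw1 : Integrable fun a => |a| * (w a * w a)) (hu : IsBdd w u) (hv : IsBdd w v)
    (hcom : ∀ a b : ℝ, ((a : ℂ) - b) * K a b = u a * v b - v a * u b) {x : ℝ} {p' m' : ℂ}
    (hp : HasDerivAt (inv K u) p' x) (hm : HasDerivAt (inv K v) m' x) :
    res K x x = p' * inv K v x - m' * inv K u x := by
  have h1 : HasDerivAt (fun a => inv K u a * inv K v x - inv K v a * inv K u x)
      (p' * inv K v x - m' * inv K u x) x := (hp.mul_const _).fun_sub (hm.mul_const _)
  have h2 := hasDerivAt_iff_tendsto_slope.1 h1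
  have h3 : Tendsto (fun a => res K a x) (𝓝[≠] x) (𝓝 (res K x x)) :=
    ((H.res_bdd.col H.weight x).1.tendsto x).mono_left nhdsWithin_le_nhds
  refine tendsto_nhds_unique (h3.congr' ?_) h2
  filter_upwards [self_mem_nhdsWithin] with a ha
  have hne : (a : ℂ) - x ≠ 0 := sub_ne_zero.2 (by exact_mod_cast ha)
  have h4 := H.sub_mul_res hw1 hu hv hcom a x
  rw [slope_def_module, Complex.real_smul]
  push_cast
  rw [← div_eq_inv_mul, eq_div_iff hne, mul_comm, h4]
  ring

/-- A symmetrization identity for the resolvent of a kernel of integrable form. -/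
theorem integral_commutator (hw1 : Integrable fun a => |a| * (w a * w a)) (hu : IsBdd w u)
    (hv : IsBdd w v) (hcom : ∀ a b : ℝ, ((a : ℂ) - b) * K a b = u a * v b - v a * u b)
    (hα : Continuous α) (hα1 : ∀ a, ‖α a‖ ≤ 1) :
    ∫ x, α x * (op (res K) (fun y => y * α y * inv K u y) x * inv K v x -
        op (res K) (fun y => y * α y * inv K v y) x * inv K u x) =
      (∫ x, α x * (inv K u x * inv K u x)) * (∫ x, α x * (inv K v x * inv K v x)) -
        (∫ x, α x * (inv K u x * inv K v x)) ^ 2 := by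
  set p := inv K u with hp
  set m := inv K v with hm
  have hpb : IsBdd w p := H.inv_bdd hu
  have hmb : IsBdd w m := H.inv_bdd hv
  have hαp := hpb.bdd_mul hα hα1
  have hαm := hmb.bdd_mul hα hα1
  have hR := H.res_bdd
  have hρp : IsAdm w fun y => (y : ℂ) * α y * p y := by
    simp_rw [mul_assoc]; exact hαp.abs_mul_adm hw1 H.weight
  have hρm : IsAdm w fun y => (y : ℂ) * α y * m y := by
    simp_rw [mul_assoc]; exact hαm.abs_mul_adm hw1 H.weight
  let J : ℝ × ℝ → ℂ := fun z =>
    α z.1 * (z.2 * α z.2) * res K z.1 z.2 * (p z.2 * m z.1 - m z.2 * p z.1)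
  have hJ : Integrable J (volume.prod volume) := by
    obtain ⟨r1, d, hd, r2⟩ := hR
    obtain ⟨p1, cp, hcp, p2⟩ := hpb
    obtain ⟨m1, cm, hcm, m2⟩ := hmb
    refine integrable_prod_of_norm_le (φ := fun a => 2 * cp * cm * d * (w a * w a))
      (ψ := fun a => |a| * (w a * w a)) ?_ (H.weight.int.const_mul _) hw1 fun a b => ?_
    · have r1' : Continuous fun z : ℝ × ℝ => res K z.1 z.2 := r1
      simp only [J]
      fun_prop
    · have hwa := (H.weight.pos a).le
      have hwb := (H.weight.pos b).le
      have h1 : ‖p b * m a - m b * p a‖ ≤ 2 * cp * cm * (w a * w b) := by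
        refine (norm_sub_le _ _).trans ?_
        rw [norm_mul, norm_mul]
        refine (add_le_add (mul_le_mul (p2 b) (m2 a) (norm_nonneg _) (by positivity))
          (mul_le_mul (m2 b) (p2 a) (norm_nonneg _) (by positivity))).trans (le_of_eq ?_)
        ring
      have h2 : ‖α a * (b * α b)‖ ≤ |b| := by
        rw [norm_mul, norm_mul, Complex.norm_real, Real.norm_eq_abs]
        calc _ ≤ 1 * (|b| * 1) := by
              gcongr
              · exact hα1 a
              · exact hα1 b
          _ = _ := by ring
      simp only [J]
      rw [norm_mul, norm_mul]
      calc _ ≤ |b| * (d * (w a * w b)) * (2 * cp * cm * (w a * w b)) := by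
            refine mul_le_mul (mul_le_mul h2 (r2 a b) (norm_nonneg _) (abs_nonneg _)) h1
              (norm_nonneg _) (by positivity)
        _ = _ := by ring
  have hS : ∫ x, α x * (op (res K) (fun y => y * α y * p y) x * m x -
      op (res K) (fun y => y * α y * m y) x * p x) = ∫ z, J z ∂(volume.prod volume) := by
    rw [integral_prod J hJ]
    congr 1; ext x
    have i1 := hR.integrable H.weight hρp x
    have i2 := hR.integrable H.weight hρm x
    rw [op, op, ← integral_mul_const, ← integral_mul_const,
      ← integral_sub (i1.mul_const _) (i2.mul_const _), ← integral_const_mul]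
    congr 1; ext y
    simp only [J]
    ring
  have hpp := hpb.integrable_mul (hαp.adm H.weight)
  have hmm := hmb.integrable_mul (hαm.adm H.weight)
  have hpm := hpb.integrable_mul (hαm.adm H.weight)
  -- Adding to `J` its image under the exchange of variables replaces the factor `b` by `(a - b)
  -- R(a,b)` up to sign, and `sub_mul_res` makes the sum equal to `α(a) α(b) (p(a) m(b) - m(a)
  -- p(b))²`. Expanding the square gives products of single integrals.
  have h2 : (∫ z, J z ∂(volume.prod volume)) + ∫ z, J z ∂(volume.prod volume) =
      (∫ x, p x * (α x * p x)) * (∫ x, m x * (α x * m x)) +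
      (∫ x, m x * (α x * m x)) * (∫ x, p x * (α x * p x)) -
      2 * ((∫ x, p x * (α x * m x)) * ∫ x, p x * (α x * m x)) := by
    have hswap : ∫ z, J z ∂(volume.prod volume) = ∫ z : ℝ × ℝ, J z.swap ∂(volume.prod volume) :=
      (integral_prod_swap J).symm
    nth_rewrite 2 [hswap]
    have k1 : Integrable (fun z : ℝ × ℝ => p z.1 * (α z.1 * p z.1) * (m z.2 * (α z.2 * m z.2)) +
        m z.1 * (α z.1 * m z.1) * (p z.2 * (α z.2 * p z.2))) (volume.prod volume) :=
      (hpp.mul_prod hmm).add (hmm.mul_prod hpp)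
    have hJs : Integrable (fun z : ℝ × ℝ => J z.swap) (volume.prod volume) := hJ.swap
    rw [← integral_add hJ hJs, ← integral_prod_mul, ← integral_prod_mul, ← integral_prod_mul,
      ← integral_const_mul, ← integral_add (hpp.mul_prod hmm) (hmm.mul_prod hpp),
      ← integral_sub k1 ((hpm.mul_prod hpm).const_mul 2)]
    congr 1; ext ⟨a, b⟩
    have h3 := H.sub_mul_res hw1 hu hv hcom a b
    simp only [J, Prod.fst_swap, Prod.snd_swap]
    rw [H.res_symm b a]
    rw [← hp, ← hm] at h3
    linear_combination α a * α b * (p a * m b - m a * p b) * h3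
  have e1 : ∀ φ ψ : ℝ → ℂ, ∫ x, φ x * (α x * ψ x) = ∫ x, α x * (φ x * ψ x) := fun φ ψ => by
    congr 1; ext x; ring
  rw [hS]
  rw [e1, e1, e1] at h2
  linear_combination h2 / 2

/-- Translation invariance of the inverse. -/
theorem inv_translate {τ : ℝ} (Hτ : IsRegular w fun a b => K (a + τ) (b + τ)) (hg : IsBdd w g)
    (hτ : IsAdm w fun a => inv K g (a + τ)) (a : ℝ) :
    inv (fun a b => K (a + τ) (b + τ)) (fun a => g (a + τ)) a = inv K g (a + τ) := by
  refine (Hτ.eq_inv (g := fun a => inv K g (a + τ)) hτ (fun x => ?_) a).symm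
  rw [op, integral_add_right_eq_self (fun y => K (x + τ) y * inv K g y) τ]
  exact H.inv_add_op_inv (hg.adm H.weight) (x + τ)

/-- The inverse applied to the derivative of the integral equation under a shift. -/
theorem inv_shift {ρ : ℝ → ℂ} {c : ℂ} (hu : IsBdd w u) (hv : IsBdd w v) (hg : IsBdd w g)
    (hρ : IsAdm w fun y => ρ y * inv K g y)
    (hL : ∀ a b, L a b = -2 * (ρ a + ρ b) * K a b - c * (u a * v b + v a * u b)) (x : ℝ) :
    inv K (fun y => -2 * (ρ y * g y) - op L (inv K g) y) x =
      -2 * (ρ x * inv K g x) + 4 * op (res K) (fun y => ρ y * inv K g y) x +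
        c * (inv K u x * (∫ y, v y * inv K g y) + inv K v x * ∫ y, u y * inv K g y) := by
  have hK := H.kernel.isBdd
  have hG := (H.inv_bdd hg).adm H.weight
  have hop := (hK.op_bdd H.weight hρ).adm H.weight
  have hU := (hu.adm H.weight).const_mul (c * ∫ y, v y * inv K g y)
  have hV := (hv.adm H.weight).const_mul (c * ∫ y, u y * inv K g y)
  -- Inserting `g = φ + K φ`, with `φ = inv K g`, removes the terms `ρ K φ`. What is left is `-2 ρ φ
  -- + 2 K(ρ φ)` plus multiples of `u` and `v`, and `(1 + K)⁻¹ K = 1 - (1 + K)⁻¹ = R`.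
  have hq : (fun y => -2 * (ρ y * g y) - op L (inv K g) y) = fun y =>
      (-2 * (ρ y * inv K g y) + 2 * op K (fun z => ρ z * inv K g z) y) +
      ((c * ∫ z, v z * inv K g z) * u y + (c * ∫ z, u z * inv K g z) * v y) := by
    ext y
    have h1 : op L (inv K g) y = -2 * ρ y * op K (inv K g) y -
        2 * op K (fun z => ρ z * inv K g z) y -
        (c * u y * (∫ z, v z * inv K g z) + c * v y * ∫ z, u z * inv K g z) := by
      have i1 := hK.integrable H.weight hG y
      have i2 := hK.integrable H.weight hρ y
      have i3 := hv.integrable_mul hG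
      have i4 := hu.integrable_mul hG
      have k1 : Integrable fun z => -2 * ρ y * (K y z * inv K g z) -
          2 * (K y z * (ρ z * inv K g z)) := (i1.const_mul _).sub (i2.const_mul _)
      have k2 : Integrable fun z => c * u y * (v z * inv K g z) + c * v y * (u z * inv K g z) :=
        (i3.const_mul _).add (i4.const_mul _)
      rw [op, op, op, ← integral_const_mul, ← integral_const_mul, ← integral_const_mul,
        ← integral_const_mul, ← integral_sub (i1.const_mul _) (i2.const_mul _),
        ← integral_add (i3.const_mul _) (i4.const_mul _),
        ← integral_sub k1 k2]
      congr 1; ext z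
      rw [hL]; ring
    rw [h1]
    linear_combination (2 * ρ y) * H.inv_add_op_inv (hg.adm H.weight) y
  have e1 := hρ.const_mul (-2)
  have e2 := hop.const_mul 2
  rw [hq, H.inv_add (e1.add e2 H.weight) (hU.add hV H.weight), H.inv_add e1 e2, H.inv_add hU hV,
    inv_const_mul, inv_const_mul, inv_const_mul, inv_const_mul, H.inv_op hρ, inv]
  ring

end IsRegular

/-- Derivative of a pairing in a direction in which the kernel is multiplied by a function of
either argument. -/
theorem hasDerivAt_integral_mul_inv (hw : IsWeight w)
    (hK : DiffKer w Ks (fun a b => (α a + α b) * Ks s a b) s) (hdet : fredholmDet (Ks s) ≠ 0)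
    (hα : Continuous α) (hα1 : ∀ a, ‖α a‖ ≤ 1) {g h : ℝ → ℝ → ℂ}
    (hg : DiffFam w g (fun a => α a * g s a) s) (hh : DiffFam w h (fun a => α a * h s a) s) :
    HasDerivAt (fun r => ∫ x, g r x * inv (Ks r) (h r) x)
      (2 * ∫ x, α x * (inv (Ks s) (g s) x * inv (Ks s) (h s) x)) s := by
  have H := (hK.regular hw hdet).self_of_nhds
  refine (hg.hasDerivAt_integral_mul hw (hh.inv hw hK hdet)).congr_deriv ?_
  set φ := inv (Ks s) (h s) with hφ
  have hKb := H.kernel.isBdd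
  have hgb := hg.isBdd
  have hhb := hh.isBdd
  have hφb : IsBdd w φ := H.inv_bdd hhb
  have hαφ := hφb.bdd_mul hα hα1
  have hop := hKb.op_bdd hw (hαφ.adm hw)
  -- Inserting `h = φ + K φ` cancels `α K φ`.
  have hq : (fun x => α x * h s x - op (fun a b => (α a + α b) * Ks s a b) φ x) = fun x =>
      α x * φ x - op (Ks s) (fun y => α y * φ y) x := by
    ext x
    have h1 : op (fun a b => (α a + α b) * Ks s a b) φ x =
        α x * op (Ks s) φ x + op (Ks s) (fun y => α y * φ y) x := by
      have i1 := hKb.integrable hw (hφb.adm hw) x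
      have i2 := hKb.integrable hw (hαφ.adm hw) x
      rw [op, op, op, ← integral_const_mul, ← integral_add (i1.const_mul _) i2]
      congr 1; ext y; ring
    rw [h1]
    linear_combination (-α x) * H.inv_add_op_inv (hhb.adm hw) x
  have hψ := H.inv_bdd hgb
  rw [hq]
  have hqb := hαφ.sub hop
  have j1 := (hgb.bdd_mul hα hα1).integrable_mul (hφb.adm hw)
  have j2 := hgb.integrable_mul ((H.inv_bdd hqb).adm hw)
  have j3 := hψ.integrable_mul (hαφ.adm hw)
  have j4 := hψ.integrable_mul (hop.adm hw)
  have j5 := (hKb.op_bdd hw (hψ.adm hw)).integrable_mul (hαφ.adm hw)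
  -- The operator `1 - K` is moved to `ψ = inv (Ks s) (g s)`. Together with `g = ψ + K ψ` in the
  -- other summand, the terms with `K ψ` cancel and `2 α ψ φ` remains.
  have h2 : ∫ x, inv (Ks s) (g s) x * (α x * φ x - op (Ks s) (fun y => α y * φ y) x) =
      ∫ x, (inv (Ks s) (g s) x - op (Ks s) (inv (Ks s) (g s)) x) * (α x * φ x) := by
    simp_rw [mul_sub, sub_mul]
    rw [integral_sub j3 j4, integral_sub j3 j5,
      integral_mul_op_symm hKb H.symm (hψ.adm hw) (hαφ.adm hw)]
  rw [integral_add j1 j2, H.integral_mul_inv hgb (hqb.adm hw), h2, ← integral_add j1 ?_,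
    ← integral_const_mul]
  · congr 1; ext x
    linear_combination (-α x * φ x) * H.inv_add_op_inv (hgb.adm hw) x
  · exact (hψ.sub (hKb.op_bdd hw (hψ.adm hw))).integrable_mul (hαφ.adm hw)

end FredholmTheory

/-! ### Square integrability and translations -/

namespace FredholmTheory

variable {w : ℝ → ℝ} {g : ℝ → ℂ}

theorem IsWeight.memLp (hw : IsWeight w) : MemLp w 2 volume := by
  rw [memLp_two_iff_integrable_sq hw.cont.aestronglyMeasurable]
  simpa only [sq] using hw.int

theorem IsBdd.memLp (hw : IsWeight w) (hg : IsBdd w g) : MemLp g 2 volume := by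
  obtain ⟨hc, c, h0, hb⟩ := hg
  refine MemLp.of_le (hw.memLp.const_mul c) hc.aestronglyMeasurable (ae_of_all _ fun a => ?_)
  exact (hb a).trans (le_abs_self _)

/-- Cauchy-Schwarz against the weight: every square integrable solution falls under the uniqueness
statement for functions integrable against the weight. -/
theorem isAdm_of_memLp (hw : IsWeight w) (hg : MemLp g 2 volume) : IsAdm w g :=
  ⟨hg.1, hw.memLp.integrable_mul hg.norm⟩

theorem IsBdd.translate {C : ℝ} (hC : 0 < C) (hg : IsBdd (expWeight C) g) (τ : ℝ) :
    IsBdd (expWeight C) fun a => g (a + τ) := by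
  obtain ⟨hc, c, h0, hb⟩ := hg
  refine ⟨hc.comp (continuous_add_const τ), c * Real.exp |τ|, by positivity, fun a => ?_⟩
  refine (hb _).trans ?_
  rw [mul_assoc]
  refine mul_le_mul_of_nonneg_left ?_ h0
  calc expWeight C (a + τ) ≤ C * (Real.exp |τ| * Real.exp (-|a|)) := by
        rw [expWeight, ← Real.exp_add]
        gcongr
        have h1 : |a| ≤ |a + τ| + |τ| := by
          have := abs_sub (a + τ) τ
          rwa [add_sub_cancel_right] at this
        linarith
    _ = _ := by rw [expWeight]; ring

theorem integral_sum_const_mul {n : ℕ} (c : Fin n → ℂ) {F : Fin n → ℝ → ℂ}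
    (hF : ∀ i, Integrable (F i)) : ∫ x, ∑ i, c i * F i x = ∑ i, c i * ∫ x, F i x := by
  rw [integral_finsetSum _ fun i _ => (hF i).const_mul _]
  simp_rw [integral_const_mul]

end FredholmTheory

/-! ### The potentials and the derivatives of the determinant -/

namespace ImpenetrableAnyons

open FredholmTheory

variable {x t β κ : ℝ}

theorem isBdd_e (ht : t ≠ 0) (β κ : ℝ) (l : PM) {C : ℝ} (hC : 0 < C) :
    IsBdd (expWeight C) (e l x t β κ) := by
  simpa only [add_zero] using ((paramCurve_x x t β ht).diffFam_e_expWeight l κ hC).isBdd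

theorem isBdd_id_mul_e (ht : t ≠ 0) (β κ : ℝ) (l : PM) {C : ℝ} (hC : 0 < C) :
    IsBdd (expWeight C) fun a => (a : ℂ) * e l x t β κ a := by
  simpa only [add_zero] using ((paramCurve_x x t β ht).diffFam_id_mul_e l κ hC).isBdd

theorem exists_isRegular (ht : t ≠ 0) (hdet : detV x t β κ ≠ 0) :
    ∃ C, 0 < C ∧ IsRegular (expWeight C) (V x t β κ) := by
  obtain ⟨C, hC, hK⟩ := (paramCurve_x x t β ht).exists_diffKer_V κ
  simp only [add_zero] at hK
  exact ⟨C, hC, (hK.regular (isWeight_expWeight hC) hdet).self_of_nhds⟩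

/-- The integral equation has a unique square integrable solution, given by the resolvent. -/
theorem isSolution_iff (ht : t ≠ 0) (hdet : detV x t β κ ≠ 0) (l : PM) (φ : ℝ → ℂ) :
    IsSolution l x t β κ φ ↔ φ = inv (V x t β κ) (e l x t β κ) := by
  obtain ⟨C, hC, H⟩ := exists_isRegular ht hdet
  have he := isBdd_e (x := x) ht β κ l hC
  constructor
  · intro h
    ext a
    exact H.eq_inv (isAdm_of_memLp H.weight h.1) h.2 a
  · rintro rfl
    exact ⟨(H.inv_bdd he).memLp H.weight, H.inv_add_op_inv (he.adm H.weight)⟩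

/-- Since a solution exists, the choice operator returns one, and uniqueness identifies it. -/
theorem f_eq (ht : t ≠ 0) (hdet : detV x t β κ ≠ 0) (l : PM) :
    f l x t β κ = inv (V x t β κ) (e l x t β κ) :=
  (isSolution_iff ht hdet l _).1 (Classical.epsilon_spec (p := IsSolution l x t β κ)
    ⟨_, (isSolution_iff ht hdet l _).2 rfl⟩)

theorem B_eq (ht : t ≠ 0) (hdet : detV x t β κ ≠ 0) (l m : PM) :
    B l m x t β κ = ∫ ξ, e l x t β κ ξ * inv (V x t β κ) (e m x t β κ) ξ := by
  rw [B, f_eq ht hdet]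

theorem C_eq (ht : t ≠ 0) (hdet : detV x t β κ ≠ 0) (l m : PM) :
    C l m x t β κ = ∫ ξ : ℝ, (ξ * e l x t β κ ξ) * inv (V x t β κ) (e m x t β κ) ξ := by
  rw [C, f_eq ht hdet]

theorem B_symm (ht : t ≠ 0) (hdet : detV x t β κ ≠ 0) (l m : PM) :
    B l m x t β κ = B m l x t β κ := by
  obtain ⟨C, hC, H⟩ := exists_isRegular ht hdet
  rw [B_eq ht hdet, B_eq ht hdet, H.integral_mul_inv (isBdd_e ht β κ l hC)
    ((isBdd_e ht β κ m hC).adm H.weight)]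
  congr 1; ext ξ; ring

/-- Symmetry of the inverse moves the factor `ξ` under it; the trace in the direction of `t`
contains both forms. -/
theorem C_eq' (ht : t ≠ 0) (hdet : detV x t β κ ≠ 0) (l m : PM) :
    C l m x t β κ = ∫ ξ : ℝ, e m x t β κ ξ * inv (V x t β κ) (fun ξ => ξ * e l x t β κ ξ) ξ := by
  obtain ⟨C, hC, H⟩ := exists_isRegular ht hdet
  rw [C_eq ht hdet, H.integral_mul_inv (isBdd_id_mul_e ht β κ l hC)
    ((isBdd_e ht β κ m hC).adm H.weight)]
  congr 1; ext ξ; ring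

theorem eventually_detV_ne (ht : t ≠ 0) (hdet : detV x t β κ ≠ 0) :
    ∀ᶠ b in 𝓝 β, detV x t b κ ≠ 0 := by
  have h1 : ∀ᶠ q : ℝ × ℝ × ℝ in 𝓝 (x, t, β), detV q.1 q.2.1 q.2.2 κ ≠ 0 :=
    (continuousAt_detV κ ht).eventually_ne hdet
  have h2 : Tendsto (fun b : ℝ => ((x, t, b) : ℝ × ℝ × ℝ)) (𝓝 β) (𝓝 (x, t, β)) :=
    Continuous.tendsto (by fun_prop) β
  exact h2.eventually h1

/-- The complex-valued version of the hole density. -/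
noncomputable def holeC (β ξ : ℝ) : ℂ := hole β ξ

theorem continuous_holeC (β : ℝ) : Continuous (holeC β) :=
  Complex.continuous_ofReal.comp (continuous_hole continuous_const continuous_id)

theorem norm_holeC_le (β ξ : ℝ) : ‖holeC β ξ‖ ≤ 1 := by
  rw [holeC, Complex.norm_real]
  exact abs_hole_le β ξ

theorem dV_β (x t β κ : ℝ) : dV 0 0 1 0 x t β κ = fun a b =>
    (holeC β a + holeC β b) * V x t β κ a b := by
  ext a b
  rw [dV, holeC, holeC]
  push_cast
  ring

theorem de_β (l : PM) (x t β κ : ℝ) : de l 0 0 1 0 x t β κ = fun a =>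
    holeC β a * e l x t β κ a := by
  ext a
  cases l
  · simp only [de, dPlus, e, holeC]
    push_cast
    ring
  · simp only [de, dMinus, e, holeC]
    push_cast
    ring

theorem exists_diffKer_β (ht : t ≠ 0) (x β κ : ℝ) : ∃ C, 0 < C ∧
    DiffKer (expWeight C) (fun r => V x t r κ)
      (fun a b => (holeC β a + holeC β b) * V x t β κ a b) β := by
  obtain ⟨C, hC, hK⟩ := (paramCurve_β x t β ht).exists_diffKer_V κ
  simp only [add_zero, dV_β] at hK
  exact ⟨C, hC, hK⟩

/-- In the direction of `β` the functions `e_l` are multiplied by `holeC` and the kernel by its sum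
over the two arguments, as `hasDerivAt_integral_mul_inv` requires. -/
theorem hasDerivAt_B (ht : t ≠ 0) (hdet : detV x t β κ ≠ 0) (l m : PM) :
    HasDerivAt (fun b => B l m x t b κ) (2 * ∫ ξ, holeC β ξ *
      (inv (V x t β κ) (e l x t β κ) ξ * inv (V x t β κ) (e m x t β κ) ξ)) β := by
  obtain ⟨C, hC, hK⟩ := exists_diffKer_β ht x β κ
  have he : ∀ l, DiffFam (expWeight C) (fun b => e l x t b κ)
      (fun a => holeC β a * e l x t β κ a) β := fun l => by
    simpa only [add_zero, de_β] using (paramCurve_β x t β ht).diffFam_e_expWeight l κ hC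
  refine (hasDerivAt_integral_mul_inv (isWeight_expWeight hC) hK hdet (continuous_holeC β)
    (norm_holeC_le β) (he l) (he m)).congr_of_eventuallyEq ?_
  filter_upwards [eventually_detV_ne ht hdet] with b hb using B_eq ht hb l m

theorem hasDerivAt_C (ht : t ≠ 0) (hdet : detV x t β κ ≠ 0) (l m : PM) :
    HasDerivAt (fun b => C l m x t b κ) (2 * ∫ ξ, holeC β ξ *
      (inv (V x t β κ) (fun ξ => ξ * e l x t β κ ξ) ξ * inv (V x t β κ) (e m x t β κ) ξ)) β := by
  obtain ⟨C, hC, hK⟩ := exists_diffKer_β ht x β κ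
  have he : DiffFam (expWeight C) (fun b => e m x t b κ)
      (fun a => holeC β a * e m x t β κ a) β := by
    simpa only [add_zero, de_β] using (paramCurve_β x t β ht).diffFam_e_expWeight m κ hC
  have hxe : DiffFam (expWeight C) (fun b a => a * e l x t b κ a)
      (fun a => holeC β a * (a * e l x t β κ a)) β := by
    simpa only [add_zero, de_β, mul_left_comm] using
      (paramCurve_β x t β ht).diffFam_id_mul_e l κ hC
  refine (hasDerivAt_integral_mul_inv (isWeight_expWeight hC) hK hdet (continuous_holeC β)
    (norm_holeC_le β) hxe he).congr_of_eventuallyEq ?_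
  filter_upwards [eventually_detV_ne ht hdet] with b hb using C_eq ht hb l m

/-- Here `∂V = -i (e₊ ⊗ e₋ + e₋ ⊗ e₊)`, so the trace is `-i (B₊₋ + B₋₊)`. -/
theorem hasDerivAt_detV_x (ht : t ≠ 0) (hdet : detV x t β κ ≠ 0) :
    HasDerivAt (fun y => detV y t β κ)
      (detV x t β κ * (-2 * Complex.I * B PM.plus PM.minus x t β κ)) x := by
  obtain ⟨C, hC, hK⟩ := (paramCurve_x x t β ht).exists_diffKer_V κ
  simp only [add_zero] at hK
  have hw := isWeight_expWeight hC
  have H := (hK.regular hw hdet).self_of_nhds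
  refine (hK.hasDerivAt_fredholmDet hw hdet).congr_deriv ?_
  have hp := isBdd_e (x := x) ht β κ PM.plus hC
  have hm := isBdd_e (x := x) ht β κ PM.minus hC
  rw [H.trace_finite_rank (φ := ![e PM.plus x t β κ, e PM.minus x t β κ])
    (ψ := ![e PM.minus x t β κ, e PM.plus x t β κ]) (c := ![-Complex.I, -Complex.I])]
  · simp only [Fin.sum_univ_two, Matrix.cons_val_zero, Matrix.cons_val_one]
    rw [← B_eq ht hdet, ← B_eq ht hdet, B_symm ht hdet PM.minus PM.plus, detV]
    ring
  · intro i; fin_cases i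
    · exact hp
    · exact hm
  · intro i; fin_cases i
    · exact hm
    · exact hp
  · intro a b
    simp only [Fin.sum_univ_two, Matrix.cons_val_zero, Matrix.cons_val_one, dV, e]
    push_cast
    ring

/-- The factor `a + b` in `∂V` splits the two products of `e_±` into four terms of rank one, which
give each of `C₊₋` and `C₋₊` twice. The fifth term carries `G`. -/
theorem hasDerivAt_detV_t (ht : t ≠ 0) (hdet : detV x t β κ ≠ 0) :
    HasDerivAt (fun s => detV x s β κ)
      (detV x t β κ * (-2 * Complex.I * G x t * B PM.minus PM.minus x t β κ
          - 2 * Complex.I * (C PM.plus PM.minus x t β κ + C PM.minus PM.plus x t β κ))) t := by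
  obtain ⟨C, hC, hK⟩ := (paramCurve_t x t β ht).exists_diffKer_V κ
  simp only [add_zero] at hK
  have hw := isWeight_expWeight hC
  have H := (hK.regular hw hdet).self_of_nhds
  refine (hK.hasDerivAt_fredholmDet hw hdet).congr_deriv ?_
  have hp := isBdd_e (x := x) ht β κ PM.plus hC
  have hm := isBdd_e (x := x) ht β κ PM.minus hC
  have hxp := isBdd_id_mul_e (x := x) ht β κ PM.plus hC
  have hxm := isBdd_id_mul_e (x := x) ht β κ PM.minus hC
  rw [H.trace_finite_rank
    (φ := ![fun a => a * e PM.plus x t β κ a, e PM.plus x t β κ, fun a => a * e PM.minus x t β κ a,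
      e PM.minus x t β κ, e PM.minus x t β κ])
    (ψ := ![e PM.minus x t β κ, fun a => a * e PM.minus x t β κ a, e PM.plus x t β κ,
      fun a => a * e PM.plus x t β κ a, e PM.minus x t β κ])
    (c := ![-Complex.I, -Complex.I, -Complex.I, -Complex.I, -2 * Complex.I * G x t])]
  · simp only [Fin.sum_univ_five, Matrix.cons_val]
    rw [← B_eq ht hdet, ← C_eq ht hdet, ← C_eq ht hdet, ← C_eq' ht hdet, ← C_eq' ht hdet, detV]
    ring
  · intro i; fin_cases i
    · exact hxp
    · exact hp
    · exact hxm
    · exact hm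
    · exact hm
  · intro i; fin_cases i
    · exact hm
    · exact hxm
    · exact hp
    · exact hxp
    · exact hm
  · intro a b
    simp only [Fin.sum_univ_five, Matrix.cons_val, dV, e]
    push_cast
    ring

/-- The inverse applied to `ξ e_l`. -/
theorem inv_id_mul_e (ht : t ≠ 0) (hdet : detV x t β κ ≠ 0) (l : PM) (ξ : ℝ) :
    inv (V x t β κ) (fun y => y * e l x t β κ y) ξ = ξ * inv (V x t β κ) (e l x t β κ) ξ +
      inv (V x t β κ) (e PM.plus x t β κ) ξ * B PM.minus l x t β κ -
      inv (V x t β κ) (e PM.minus x t β κ) ξ * B PM.plus l x t β κ := by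
  obtain ⟨C, hC, H⟩ := exists_isRegular ht hdet
  have he := isBdd_e (x := x) ht β κ l hC
  rw [B_eq ht hdet, B_eq ht hdet]
  exact H.inv_id_mul (isBdd_e ht β κ PM.plus hC) (isBdd_e ht β κ PM.minus hC)
    (sub_mul_V x t β κ) he
    ((H.inv_bdd he).abs_mul_adm (integrable_abs_mul_expWeight hC) H.weight) ξ

/-- The vanishing coefficient is kept so that both signs fit the single hypothesis `hde` of
`hasDerivAt_inv_e`. -/
theorem de_shift_minus (x t β κ : ℝ) : de PM.minus 0 0 0 1 x t β κ = fun y : ℝ =>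
    Complex.I * x * e PM.minus x t β κ y + 2 * Complex.I * t * (y * e PM.minus x t β κ y) +
      0 * e PM.minus x t β κ y + -2 * (y * holeC β y * e PM.minus x t β κ y) := by
  ext y
  simp only [de, dMinus, e, holeC]
  push_cast
  ring

theorem de_shift_plus (x t β κ : ℝ) : de PM.plus 0 0 0 1 x t β κ = fun y : ℝ =>
    -Complex.I * x * e PM.plus x t β κ y + -(2 * Complex.I * t) * (y * e PM.plus x t β κ y) +
      -(4 * Complex.I * t * G x t) * e PM.minus x t β κ y +
      -2 * (y * holeC β y * e PM.plus x t β κ y) := by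
  ext y
  simp only [de, dPlus, e, holeC]
  push_cast
  ring

/-- The derivative of the solution of the integral equation in the spectral variable. -/
theorem hasDerivAt_inv_e (ht : t ≠ 0) (hdet : detV x t β κ ≠ 0) (l : PM) {c₁ c₂ c₃ : ℂ}
    (hde : de l 0 0 0 1 x t β κ = fun y : ℝ => c₁ * e l x t β κ y + c₂ * (y * e l x t β κ y) +
      c₃ * e PM.minus x t β κ y + -2 * (y * holeC β y * e l x t β κ y)) (ξ : ℝ) :
    HasDerivAt (inv (V x t β κ) (e l x t β κ))
      (c₁ * inv (V x t β κ) (e l x t β κ) ξ +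
        c₂ * inv (V x t β κ) (fun y => y * e l x t β κ y) ξ +
        c₃ * inv (V x t β κ) (e PM.minus x t β κ) ξ +
        (-2 * (ξ * holeC β ξ * inv (V x t β κ) (e l x t β κ) ξ) +
          4 * op (res (V x t β κ)) (fun y => y * holeC β y * inv (V x t β κ) (e l x t β κ) y) ξ +
          2 * Complex.I * t * (inv (V x t β κ) (e PM.plus x t β κ) ξ * B PM.minus l x t β κ +
            inv (V x t β κ) (e PM.minus x t β κ) ξ * B PM.plus l x t β κ))) ξ := by
  obtain ⟨C, hC, hK⟩ := (paramCurve_shift x t β ht).exists_diffKer_V κ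
  have hw := isWeight_expWeight hC
  have hw1 := integrable_abs_mul_expWeight hC
  have h0 : (fun a b => V x t β κ (a + 0) (b + 0)) = V x t β κ := by simp only [add_zero]
  have hdet0 : fredholmDet (fun a b => V x t β κ (a + 0) (b + 0)) ≠ 0 := by rw [h0]; exact hdet
  have hreg := hK.regular hw hdet0
  have H : IsRegular (expWeight C) (V x t β κ) := by rw [← h0]; exact hreg.self_of_nhds
  have he := isBdd_e (x := x) ht β κ l hC
  have hm := isBdd_e (x := x) ht β κ PM.minus hC
  have hp := isBdd_e (x := x) ht β κ PM.plus hC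
  have hxe := isBdd_id_mul_e (x := x) ht β κ l hC
  have hf := H.inv_bdd he
  have hρ : ∀ {g : ℝ → ℂ}, IsBdd (expWeight C) g →
      IsAdm (expWeight C) fun y => (y : ℂ) * holeC β y * g y := fun hg => by
    simp_rw [mul_assoc]
    exact (hg.bdd_mul (continuous_holeC β) (norm_holeC_le β)).abs_mul_adm hw1 hw
  have hder := ((((paramCurve_shift x t β ht).diffFam_e_expWeight l κ hC).inv hw hK hdet0).deriv ξ)
  -- Evaluating the solution at `ξ + r` amounts to solving the equation with translated kernel and
  -- right-hand side, so `DiffFam.inv` gives the derivative at `r = 0`.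
  have hev : ∀ᶠ r in 𝓝 (0 : ℝ), inv (V x t β κ) (e l x t β κ) (ξ + r) =
      inv (fun a b => V x t β κ (a + r) (b + r)) (fun a => e l x t β κ (a + r)) ξ := by
    filter_upwards [hreg] with r hr
    exact (H.inv_translate hr he ((hf.translate hC r).adm hw) ξ).symm
  have h1 := hder.congr_of_eventuallyEq hev
  have h2 : HasDerivAt (fun y => inv (V x t β κ) (e l x t β κ) (ξ + (y - ξ))) _ ξ :=
    HasDerivAt.comp_sub_const (f := fun r => inv (V x t β κ) (e l x t β κ) (ξ + r)) ξ ξ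
      (by rw [sub_self]; exact h1)
  simp only [add_sub_cancel] at h2
  refine h2.congr_deriv ?_
  simp only [add_zero]
  have hL : IsBdd (expWeight C) (op (dV 0 0 0 1 x t β κ) (inv (V x t β κ) (e l x t β κ))) :=
    hK.kernel'.isBdd.op_bdd hw (hf.adm hw)
  -- Under the common shift `∂V(a,b) = -2 (a h(a) + b h(b)) V(a,b) - 2it (e₊(a) e₋(b) + e₋(a)
  -- e₊(b))`, where `h` is `holeC β`.
  have hsh := H.inv_shift (ρ := fun y => (y : ℂ) * holeC β y) (c := 2 * Complex.I * t)
    (L := dV 0 0 0 1 x t β κ) hp hm he (hρ hf) (fun a b => by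
      simp only [dV, e, holeC]; push_cast; ring) ξ
  have hq : (fun y => de l 0 0 0 1 x t β κ y - op (dV 0 0 0 1 x t β κ)
      (inv (V x t β κ) (e l x t β κ)) y) = fun y : ℝ =>
      (c₁ * e l x t β κ y + c₂ * (y * e l x t β κ y) + c₃ * e PM.minus x t β κ y) +
      (-2 * (y * holeC β y * e l x t β κ y) -
        op (dV 0 0 0 1 x t β κ) (inv (V x t β κ) (e l x t β κ)) y) := by
    ext y
    rw [hde]
    ring
  have b1 := (he.adm hw).const_mul c₁
  have b2 := (hxe.adm hw).const_mul c₂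
  have b3 := (hm.adm hw).const_mul c₃
  have b4 := ((hρ he).const_mul (-2)).sub (hL.adm hw) hw
  rw [hq, H.inv_add ((b1.add b2 hw).add b3 hw) b4, H.inv_add (b1.add b2 hw) b3, H.inv_add b1 b2,
    IsRegular.inv_const_mul, IsRegular.inv_const_mul, IsRegular.inv_const_mul, hsh,
    B_eq ht hdet, B_eq ht hdet]

/-- The trace is `2 ∫ h R(ξ,ξ)` with `R(ξ,ξ) = f₊' f₋ - f₋' f₊`. In this combination the terms `ξ h
f₊ f₋` cancel, and so do those with `B₊₋` and `B₋₊`, by symmetry. -/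
theorem hasDerivAt_detV_β (ht : t ≠ 0) (hdet : detV x t β κ ≠ 0) :
    HasDerivAt (fun b => detV x t b κ)
      (detV x t β κ * (-2 * Complex.I * t *
            deriv (fun b : ℝ => C PM.plus PM.minus x t b κ + C PM.minus PM.plus x t b κ) β
          - 2 * Complex.I * x * deriv (fun b : ℝ => B PM.plus PM.minus x t b κ) β
          - 2 * Complex.I * t * B PM.minus PM.minus x t β κ *
            deriv (fun b : ℝ => B PM.plus PM.plus x t b κ) β
          + 2 * Complex.I * t * (B PM.plus PM.plus x t β κ - 2 * G x t) *
            deriv (fun b : ℝ => B PM.minus PM.minus x t b κ) β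
          + 2 * deriv (fun b : ℝ => B PM.plus PM.plus x t b κ) β *
            deriv (fun b : ℝ => B PM.minus PM.minus x t b κ) β
          - 2 * (deriv (fun b : ℝ => B PM.plus PM.minus x t b κ) β) ^ 2)) β := by
  obtain ⟨C, hC, hK⟩ := exists_diffKer_β ht x β κ
  have hw := isWeight_expWeight hC
  have hw1 := integrable_abs_mul_expWeight hC
  have H := (hK.regular hw hdet).self_of_nhds
  refine (hK.hasDerivAt_fredholmDet hw hdet).congr_deriv ?_
  rw [H.trace_multiplier (continuous_holeC β) (norm_holeC_le β) fun a b => rfl,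
    ((hasDerivAt_C ht hdet PM.plus PM.minus).fun_add (hasDerivAt_C ht hdet PM.minus PM.plus)).deriv,
    (hasDerivAt_B ht hdet PM.plus PM.minus).deriv, (hasDerivAt_B ht hdet PM.plus PM.plus).deriv,
    (hasDerivAt_B ht hdet PM.minus PM.minus).deriv]
  change detV x t β κ * _ = _
  congr 1
  have hu := isBdd_e (x := x) ht β κ PM.plus hC
  have hv := isBdd_e (x := x) ht β κ PM.minus hC
  have hhu := H.inv_bdd (isBdd_id_mul_e (x := x) ht β κ PM.plus hC)
  have hhv := H.inv_bdd (isBdd_id_mul_e (x := x) ht β κ PM.minus hC)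
  have hcomm := H.integral_commutator hw1 hu hv (sub_mul_V x t β κ) (continuous_holeC β)
    (norm_holeC_le β)
  have hdiag := fun ξ => H.res_diag hw1 hu hv (sub_mul_V x t β κ)
    (hasDerivAt_inv_e ht hdet PM.plus (de_shift_plus x t β κ) ξ)
    (hasDerivAt_inv_e ht hdet PM.minus (de_shift_minus x t β κ) ξ)
  simp only [inv_id_mul_e ht hdet] at hdiag
  have hhu' := inv_id_mul_e ht hdet PM.plus
  have hhv' := inv_id_mul_e ht hdet PM.minus
  have hsymm := B_symm ht hdet PM.minus PM.plus
  have hp := H.inv_bdd hu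
  have hm := H.inv_bdd hv
  set p := inv (V x t β κ) (e PM.plus x t β κ)
  set m := inv (V x t β κ) (e PM.minus x t β κ)
  set hP := inv (V x t β κ) (fun y => y * e PM.plus x t β κ y)
  set hM := inv (V x t β κ) (fun y => y * e PM.minus x t β κ y)
  set α := holeC β
  have hα : ∀ {g : ℝ → ℂ}, IsBdd (expWeight C) g → IsBdd (expWeight C) fun y => α y * g y :=
    fun hg => hg.bdd_mul (continuous_holeC β) (norm_holeC_le β)
  have hint : ∀ {g k : ℝ → ℂ}, IsBdd (expWeight C) g → IsBdd (expWeight C) k →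
      Integrable fun y => α y * (g y * k y) := fun {g k} hg hk => by
    simpa only [mul_assoc] using (hα hg).integrable_mul (hk.adm hw)
  have hρ : ∀ {g : ℝ → ℂ}, IsBdd (expWeight C) g →
      IsBdd (expWeight C) (op (res (V x t β κ)) fun y => (y : ℂ) * α y * g y) := fun hg => by
    simp_rw [mul_assoc]
    exact H.res_bdd.op_bdd hw ((hα hg).abs_mul_adm hw1 hw)
  have hc : Integrable fun y => α y * (op (res (V x t β κ)) (fun y => y * α y * p y) y * m y -
      op (res (V x t β κ)) (fun y => y * α y * m y) y * p y) := by
    simp_rw [mul_sub]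
    exact (hint (hρ hp) hm).sub (hint (hρ hm) hp)
  -- The surviving terms of `h R(ξ,ξ)`. The outer factor 2 of the trace turns the first five
  -- integrals into `β`-derivatives of potentials; the last is evaluated by `hcomm`, and its total
  -- factor 8 is `2 · 2 · 2`, one 2 for each of the two derivatives in a product.
  have key := integral_sum_const_mul
    (c := ![-2 * Complex.I * x, -2 * Complex.I * t, -2 * Complex.I * t,
      2 * Complex.I * t * (B PM.plus PM.plus x t β κ - 2 * G x t),
      -2 * Complex.I * t * B PM.minus PM.minus x t β κ, 4])
    (F := ![fun y => α y * (p y * m y), fun y => α y * (hP y * m y), fun y => α y * (hM y * p y),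
      fun y => α y * (m y * m y), fun y => α y * (p y * p y),
      fun y => α y * (op (res (V x t β κ)) (fun y => y * α y * p y) y * m y -
      op (res (V x t β κ)) (fun y => y * α y * m y) y * p y)]) (by
    intro i; fin_cases i
    · exact hint hp hm
    · exact hint hhu hm
    · exact hint hhv hp
    · exact hint hm hm
    · exact hint hp hp
    · exact hc)
  simp only [Fin.sum_univ_six, Matrix.cons_val] at key
  rw [hcomm] at key
  refine (congrArg (2 * ·) (Eq.trans (integral_congr_ae (ae_of_all _ fun y => ?_)) key)).trans ?_
  · rw [hdiag, hhu', hhv', hsymm]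
    ring
  · ring

/-- A continuous branch of the logarithm is differentiable along with the function. -/
theorem hasDerivAt_of_exp_eq {σ D : ℝ → ℂ} {s : ℝ} {L : ℂ} (hσ : ContinuousAt σ s)
    (hexp : ∀ᶠ r in 𝓝 s, Complex.exp (σ r) = D r) (hD : HasDerivAt D (D s * L) s) :
    HasDerivAt σ L s := by
  have h0 := hexp.self_of_nhds
  have hne : D s ≠ 0 := by rw [← h0]; exact Complex.exp_ne_zero _
  have h1 : HasDerivAt (fun r => Complex.log (D r / D s)) L s := by
    refine ((hD.div_const (D s)).clog_real (by simp [hne])).congr_deriv ?_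
    field_simp
  -- Near `s` the increment of `σ` has imaginary part smaller than `π` in modulus, so the principal
  -- logarithm of the quotient recovers it.
  have h2 : ContinuousAt (fun r => |(σ r - σ s).im|) s :=
    (Complex.continuous_im.continuousAt.comp (hσ.sub continuousAt_const)).abs
  have h3 : ∀ᶠ r in 𝓝 s, |(σ r - σ s).im| < Real.pi :=
    h2.eventually_lt_const (by simp [Real.pi_pos])
  refine (h1.const_add (σ s)).congr_of_eventuallyEq ?_
  filter_upwards [hexp, h3] with r hr hr3
  rw [← hr, ← h0, ← Complex.exp_sub, Complex.log_exp (abs_lt.1 hr3).1 (abs_lt.1 hr3).2.le]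
  ring

/-- Dividing by the value at the base point makes the quotient 1 there, so near it the values stay
in the slit plane, where the principal logarithm is continuous. -/
theorem exists_isLogDetBranchNear (ht : t ≠ 0) (hdet : detV x t β κ ≠ 0) :
    ∃ σ : ℝ → ℝ → ℝ → ℂ, IsLogDetBranchNear κ σ x t β := by
  have hopen : IsOpen {q : ℝ × ℝ × ℝ | q.2.1 ≠ 0} := isOpen_ne_fun (by fun_prop) (by fun_prop)
  have hcont : ContinuousOn (fun q : ℝ × ℝ × ℝ => detV q.1 q.2.1 q.2.2 κ / detV x t β κ)
      {q : ℝ × ℝ × ℝ | q.2.1 ≠ 0} := fun q hq =>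
    ((continuousAt_detV κ hq).div_const _).continuousWithinAt
  refine ⟨fun y s b => Complex.log (detV x t β κ) + Complex.log (detV y s b κ / detV x t β κ),
    _, hcont.isOpen_inter_preimage hopen Complex.isOpen_slitPlane, ⟨ht, ?_⟩, ?_, ?_⟩
  · simp [hdet]
  · exact continuousOn_const.add ((hcont.mono Set.inter_subset_left).clog fun q hq => hq.2)
  · rintro q ⟨-, hq⟩
    rw [Complex.exp_add, Complex.exp_log hdet, Complex.exp_log (Complex.slitPlane_ne_zero hq),
      mul_div_cancel₀ _ hdet]

theorem IsLogDetBranchNear.hasDerivAt {σ : ℝ → ℝ → ℝ → ℂ} (h : IsLogDetBranchNear κ σ x t β)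
    {c : ℝ → ℝ × ℝ × ℝ} {s : ℝ} (hc : Continuous c) (hs : c s = (x, t, β)) {L : ℂ}
    (hD : HasDerivAt (fun r => detV (c r).1 (c r).2.1 (c r).2.2 κ) (detV x t β κ * L) s) :
    HasDerivAt (fun r => σ (c r).1 (c r).2.1 (c r).2.2) L s := by
  obtain ⟨U, hU, hmem, hσ, hexp⟩ := h
  have hU' : U ∈ 𝓝 (c s) := hU.mem_nhds (by rwa [hs])
  refine hasDerivAt_of_exp_eq (D := fun r => detV (c r).1 (c r).2.1 (c r).2.2 κ) ?_ ?_ ?_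
  · exact ContinuousAt.comp (g := fun q : ℝ × ℝ × ℝ => σ q.1 q.2.1 q.2.2) (hσ.continuousAt hU')
      hc.continuousAt
  · exact (hc.continuousAt.eventually hU').mono fun r hr => hexp _ hr
  · simpa only [hs] using hD

end ImpenetrableAnyons

/-! ### The theorem -/

open ImpenetrableAnyons in
theorem mainTheorem3 (x t β κ : ℝ) (ht : t ≠ 0) (hdet : detV x t β κ ≠ 0) :
    (∀ s : PM, ∃! φ : ℝ → ℂ, IsSolution s x t β κ φ) ∧
    (∀ l m : PM, DifferentiableAt ℝ (fun b : ℝ => B l m x t b κ) β ∧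
      DifferentiableAt ℝ (fun b : ℝ => C l m x t b κ) β) ∧
    (∃ σ : ℝ → ℝ → ℝ → ℂ, IsLogDetBranchNear κ σ x t β) ∧
    ∀ σ : ℝ → ℝ → ℝ → ℂ, IsLogDetBranchNear κ σ x t β →
      HasDerivAt (fun y : ℝ => σ y t β)
        (-2 * Complex.I * B PM.plus PM.minus x t β κ) x ∧
      HasDerivAt (fun s : ℝ => σ x s β)
        (-2 * Complex.I * G x t * B PM.minus PM.minus x t β κ
          - 2 * Complex.I * (C PM.plus PM.minus x t β κ + C PM.minus PM.plus x t β κ)) t ∧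
      HasDerivAt (fun b : ℝ => σ x t b)
        (-2 * Complex.I * t *
            deriv (fun b : ℝ => C PM.plus PM.minus x t b κ + C PM.minus PM.plus x t b κ) β
          - 2 * Complex.I * x * deriv (fun b : ℝ => B PM.plus PM.minus x t b κ) β
          - 2 * Complex.I * t * B PM.minus PM.minus x t β κ *
            deriv (fun b : ℝ => B PM.plus PM.plus x t b κ) β
          + 2 * Complex.I * t * (B PM.plus PM.plus x t β κ - 2 * G x t) *
            deriv (fun b : ℝ => B PM.minus PM.minus x t b κ) β
          + 2 * deriv (fun b : ℝ => B PM.plus PM.plus x t b κ) β *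
            deriv (fun b : ℝ => B PM.minus PM.minus x t b κ) β
          - 2 * (deriv (fun b : ℝ => B PM.plus PM.minus x t b κ) β) ^ 2) β := by
  refine ⟨fun s => ⟨_, (isSolution_iff ht hdet s _).2 rfl,
      fun φ hφ => (isSolution_iff ht hdet s φ).1 hφ⟩,
    fun l m => ⟨(hasDerivAt_B ht hdet l m).differentiableAt,
      (hasDerivAt_C ht hdet l m).differentiableAt⟩,
    exists_isLogDetBranchNear ht hdet, fun σ hσ => ⟨?_, ?_, ?_⟩⟩
  · exact hσ.hasDerivAt (c := fun y => (y, t, β)) (by fun_prop) rfl (hasDerivAt_detV_x ht hdet)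
  · exact hσ.hasDerivAt (c := fun s => (x, s, β)) (by fun_prop) rfl (hasDerivAt_detV_t ht hdet)
  · exact hσ.hasDerivAt (c := fun b => (x, t, b)) (by fun_prop) rfl (hasDerivAt_detV_β ht hdet)
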